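/- **Theorem.** Let $K$ be a field and let $t\in K$ satisfy $t\neq 0$ and $1+t+\cdots+t^{n-1}\neq 0$ for all $n\ge 1$ (for example $K=\mathbb{Q}(t)$ with $t$ an indeterminate). For a partition $\lambda$ let $|\lambda|$ be its size, $l(\lambda)$ its number of nonzero parts, $m_i(\lambda)$ the number of its parts equal to $i$, and $o(\lambda)$ the number of its odd parts. For a box $s$ of the diagram of $\lambda$ let $a(s)$ be the number of boxes in the same row strictly to the east of $s$ and $l(s)$ the number of boxes in the same column strictly to the south of $s$, and put $$c_\lambda(t)=\prod_{s\in\lambda:\ a(s)=0,\ l(s)\text{ even}}\bigl(1-t^{l(s)+1}\bigr).$$ For $n\ge l(\lambda)$ write $\lambda=(\lambda_1\ge\cdots\ge\lambda_n\ge 0)$, counting the zero parts in $m_0(\lambda)$, and let $$P_\lambda(x_1,\dots,x_n;t)=\frac{1}{v_\lambda(t)}\sum_{w\in S_n}w\Bigl(x_1^{\lambda_1}\cdots x_n^{\lambda_n}\prod_{i<j}\frac{x_i-tx_j}{x_i-x_j}\Bigr),\qquad v_\lambda(t)=\prod_{i\ge 0}\prod_{j=1}^{m_i(\lambda)}\frac{1-t^j}{1-t},$$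 where $\frac{1-t^j}{1-t}$ stands for $1+t+\cdots+t^{j-1}$. Let $P_\lambda(x;t)$ be the Hall–Littlewood function in infinitely many variables $x_1,x_2,\dots$, the coefficientwise limit of $P_\lambda(x_1,\dots,x_n;t)$ as $n\to\infty$. Then, in the ring of formal power series $K[[x_1,x_2,\dots]]$ with the topology of coefficientwise convergence ($K$ discrete), the sum and the products below converge unconditionally and $$\sum_{\lambda}\frac{c_\lambda(t)\,P_\lambda(x;t)}{t^{o(\lambda)/2+|\lambda|/2}}=\prod_{i\ge1}\frac{1+x_i/t}{1+x_i}\ \prod_{i\le j}\frac{1-x_ix_j}{1-x_ix_j/t},$$ where the sum is over all partitions $\lambda$ of all natural numbers in which every even part occurs with even multiplicity. (The number $o(\lambda)+|\lambda|$ is always even, so the exponent of $t$ is an integer.) -/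

import Mathlib

open scoped MvPowerSeries.WithPiTopology

namespace HallLittlewood

/-! Partitions are Young diagrams in English convention: the cell `(i, j)` lies in row `i` and
column `j` (both counted from `0`), row `i` has `μ.rowLen i` cells, column `j` has `μ.colLen j`
cells.  Hence `μ.rowLen i` is the `i`-th part (`0` beyond the last row), `μ.colLen 0` is the number
`l(μ)` of nonzero parts and `μ.card` is the size `|μ|`. -/

/-- The number `o(μ)` of odd parts of `μ`, counted with multiplicity. -/
def oddParts (μ : YoungDiagram) : ℕ :=
  ((Finset.range (μ.colLen 0)).filter fun i => Odd (μ.rowLen i)).card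

/-- Every (positive) even part of `μ` occurs with even multiplicity. -/
def EvenPartsEvenMult (μ : YoungDiagram) : Prop :=
  ∀ k : ℕ, Even k → Even (μ.rowLens.count k)

/-- The arm of a cell: the number of cells of `μ` in the same row strictly to the east. -/
def arm (μ : YoungDiagram) (s : ℕ × ℕ) : ℕ :=
  (μ.cells.filter fun u => u.1 = s.1 ∧ s.2 < u.2).card

/-- The leg of a cell: the number of cells of `μ` in the same column strictly to the south. -/
def leg (μ : YoungDiagram) (s : ℕ × ℕ) : ℕ :=
  (μ.cells.filter fun u => u.2 = s.2 ∧ s.1 < u.1).card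

/-- `c_μ(t) = ∏ (1 - t ^ (leg s + 1))` over the cells `s` with arm `0` and even leg. -/
def cCoeff {K : Type*} [Field K] (t : K) (μ : YoungDiagram) : K :=
  ∏ s ∈ μ.cells.filter (fun s => arm μ s = 0 ∧ Even (leg μ s)), (1 - t ^ (leg μ s + 1))

/-- The number of indices `k < n` such that the `k`-th part of `μ` equals `i`: the multiplicity
`m_i(μ)` when `μ` is written with `n` parts, some of which may be `0`. -/
def mult (n : ℕ) (μ : YoungDiagram) (i : ℕ) : ℕ :=
  ((Finset.range n).filter fun k => μ.rowLen k = i).card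

/-- `v_μ(t) = ∏_{i ≥ 0} ∏_{j = 1}^{m_i} (1 - t ^ j) / (1 - t)`, where `μ` is written with `n` parts
and `(1 - t ^ j) / (1 - t)` means the polynomial `1 + t + ⋯ + t ^ (j - 1)`. -/
def vFactor {K : Type*} [Field K] (t : K) (n : ℕ) (μ : YoungDiagram) : K :=
  ∏ i ∈ Finset.range (μ.rowLen 0 + 1), ∏ j ∈ Finset.Icc 1 (mult n μ i), ∑ a ∈ Finset.range j, t ^ a

/-- The symmetrization
`v_μ(t)⁻¹ ∑_{w ∈ S_n} w (x_1 ^ μ_1 ⋯ x_n ^ μ_n ∏_{i < j} (x_i - t x_j) / (x_i - x_j))`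
evaluated at elements `x_1, …, x_n` of a field. -/
noncomputable def symmetrization {L : Type*} [Field L] (t : L) (n : ℕ) (μ : YoungDiagram)
    (x : Fin n → L) : L :=
  (vFactor t n μ)⁻¹ * ∑ w : Equiv.Perm (Fin n), (∏ i, x (w i) ^ μ.rowLen i) *
    ∏ i, ∏ j ∈ Finset.Ioi i, (x (w i) - t * x (w j)) / (x (w i) - x (w j))

/-- Numerator of a summand of the symmetrization. -/
def numer {R : Type*} [CommRing R] (t : R) (n : ℕ) (μ : YoungDiagram) (x : Fin n → R) : R :=
  (∏ i, x i ^ μ.rowLen i) * ∏ i, ∏ j ∈ Finset.Ioi i, (x i - t * x j)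

/-- The alternating sum of numerators. -/
def altSum {R : Type*} [CommRing R] (t : R) (n : ℕ) (μ : YoungDiagram) (x : Fin n → R) : R :=
  ∑ w : Equiv.Perm (Fin n), ((Equiv.Perm.sign w : ℤ) : R) * numer t n μ (x ∘ w)

/-- The common denominator `∏_{i < j} (x_i - x_j)`. -/
def delta {R : Type*} [CommRing R] (n : ℕ) (x : Fin n → R) : R :=
  ∏ i, ∏ j ∈ Finset.Ioi i, (x i - x j)

theorem delta_perm {R : Type*} [CommRing R] (n : ℕ) (x : Fin n → R) (w : Equiv.Perm (Fin n)) :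
    delta n (x ∘ w) = ((Equiv.Perm.sign w : ℤ) : R) * delta n x := by
  have h : ∀ y : Fin n → R, delta n y = (Matrix.vandermonde (fun i => - y i)).det := by
    intro y
    rw [Matrix.det_vandermonde]
    unfold delta
    refine Finset.prod_congr rfl fun i _ => Finset.prod_congr rfl fun j _ => ?_
    ring
  rw [h, h, ← Matrix.det_permute]
  rfl

theorem delta_ne_zero {R : Type*} [CommRing R] [IsDomain R] (n : ℕ) (x : Fin n → R)
    (hx : Function.Injective x) : delta n x ≠ 0 := by
  unfold delta
  refine Finset.prod_ne_zero_iff.2 fun i _ => Finset.prod_ne_zero_iff.2 fun j hj => ?_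
  rw [sub_ne_zero]
  intro h
  exact (Finset.mem_Ioi.1 hj).ne (hx h)

theorem symmetrization_eq {L : Type*} [Field L] (t : L) (n : ℕ) (μ : YoungDiagram)
    (x : Fin n → L) :
    symmetrization t n μ x = (vFactor t n μ)⁻¹ * (altSum t n μ x / delta n x) := by
  unfold symmetrization altSum
  rw [Finset.sum_div]
  congr 1
  refine Finset.sum_congr rfl fun w _ => ?_
  have h : ∏ i, ∏ j ∈ Finset.Ioi i, (x (w i) - x (w j)) =
      ((Equiv.Perm.sign w : ℤ) : L) * delta n x := delta_perm n x w
  simp only [Finset.prod_div_distrib]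
  rw [h]
  rcases Int.units_eq_one_or (Equiv.Perm.sign w) with hs | hs <;> rw [hs] <;>
    simp [numer, mul_div_assoc, neg_div, div_neg]

theorem altSum_eq_zero {R : Type*} [CommRing R] (t : R) (n : ℕ) (μ : YoungDiagram)
    (x : Fin n → R) (i j : Fin n) (hij : i ≠ j) (h : x i = x j) : altSum t n μ x = 0 := by
  have hx : x ∘ Equiv.swap i j = x := by
    funext k
    simp only [Function.comp_apply, Equiv.swap_apply_def]
    split_ifs with h1 h2
    · rw [h1, h]
    · rw [h2, h]
    · rfl
  unfold altSum
  refine Finset.sum_involution (fun w _ => Equiv.swap i j * w) ?_ ?_ ?_ ?_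
  · intro w _
    have : x ∘ ⇑(Equiv.swap i j * w) = x ∘ w := by
      rw [Equiv.Perm.coe_mul, ← Function.comp_assoc, hx]
    rw [this, Equiv.Perm.sign_mul, Equiv.Perm.sign_swap hij]
    simp
  · intro w _ _ hw
    exact hij (Equiv.swap_eq_one_iff.1 (mul_eq_right.1 hw))
  · intro w _
    exact Finset.mem_univ _
  · intro w _
    rw [← mul_assoc, Equiv.swap_mul_self, one_mul]

theorem map_altSum {R S : Type*} [CommRing R] [CommRing S] (f : R →+* S) (t : R) (n : ℕ)
    (μ : YoungDiagram) (x : Fin n → R) :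
    f (altSum t n μ x) = altSum (f t) n μ (fun i => f (x i)) := by
  simp [altSum, numer, map_sum, map_mul, map_prod]

theorem map_delta {R S : Type*} [CommRing R] [CommRing S] (f : R →+* S) (n : ℕ) (x : Fin n → R) :
    f (delta n x) = delta n (fun i => f (x i)) := by
  simp [delta, map_prod]

theorem map_vFactor {K L : Type*} [Field K] [Field L] (f : K →+* L) (t : K) (n : ℕ)
    (μ : YoungDiagram) : f (vFactor t n μ) = vFactor (f t) n μ := by
  simp [vFactor, map_sum, map_prod]

open MvPolynomial in
theorem X_sub_X_dvd {K : Type*} [Field K] {σ : Type*} [DecidableEq σ] (i j : σ)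
    (p : MvPolynomial σ K)
    (h : aeval (Function.update (X : σ → MvPolynomial σ K) i (X j)) p = 0) :
    (X i - X j : MvPolynomial σ K) ∣ p := by
  have key : ∀ q : MvPolynomial σ K, (X i - X j : MvPolynomial σ K) ∣
      q - aeval (Function.update (X : σ → MvPolynomial σ K) i (X j)) q := by
    intro q
    induction q using MvPolynomial.induction_on with
    | C a => simp
    | add p q hp hq =>
      rw [map_add, add_sub_add_comm]
      exact dvd_add hp hq
    | mul_X p k hp =>
      rw [map_mul, aeval_X]
      by_cases hk : k = i
      · subst hk
        rw [Function.update_self]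
        have : p * X k - (aeval (Function.update (X : σ → MvPolynomial σ K) k (X j))) p * X j =
          (p - (aeval (Function.update (X : σ → MvPolynomial σ K) k (X j))) p) * X j +
            (X k - X j) * p := by ring
        rw [this]
        exact dvd_add (hp.mul_right _) (dvd_mul_right _ _)
      · rw [Function.update_of_ne hk, ← sub_mul]
        exact hp.mul_right _
  have := key p
  rwa [h, sub_zero] at this

open MvPolynomial in
theorem delta_dvd_altSum {K : Type*} [Field K] (t : K) (n : ℕ) (μ : YoungDiagram) :
    delta n (X : Fin n → MvPolynomial (Fin n) K) ∣ altSum (C t) n μ X := by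
  have key : ∀ s : Finset (Σ _ : Fin n, Fin n), (∀ p ∈ s, p.1 < p.2) →
      (∏ p ∈ s, (X p.1 - X p.2 : MvPolynomial (Fin n) K)) ∣ altSum (C t) n μ X := by
    intro s
    induction s using Finset.induction_on with
    | empty => simp
    | insert a s ha ih =>
      intro hs
      obtain ⟨B, hB⟩ := ih fun p hp => hs p (Finset.mem_insert_of_mem hp)
      have hlt : a.1 < a.2 := hs a (Finset.mem_insert_self _ _)
      have h0 := congrArg
        (aeval (Function.update (X : Fin n → MvPolynomial (Fin n) K) a.1 (X a.2))) hB
      rw [map_mul, map_prod] at h0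
      have hA : aeval (Function.update (X : Fin n → MvPolynomial (Fin n) K) a.1 (X a.2))
          (altSum (C t) n μ (X : Fin n → MvPolynomial (Fin n) K)) = 0 := by
        have := map_altSum (aeval (Function.update (X : Fin n → MvPolynomial (Fin n) K)
          a.1 (X a.2)) : MvPolynomial (Fin n) K →ₐ[K] MvPolynomial (Fin n) K).toRingHom
          (C t) n μ X
        refine this.trans (altSum_eq_zero _ _ _ _ a.1 a.2 hlt.ne ?_)
        simp [Function.update_of_ne hlt.ne']
      rw [hA] at h0
      have hne : ∏ p ∈ s, aeval (Function.update (X : Fin n → MvPolynomial (Fin n) K)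
          a.1 (X a.2)) (X p.1 - X p.2 : MvPolynomial (Fin n) K) ≠ 0 := by
        refine Finset.prod_ne_zero_iff.2 fun p hp => ?_
        have hp' : p.1 < p.2 := hs p (Finset.mem_insert_of_mem hp)
        rw [map_sub, aeval_X, aeval_X, sub_ne_zero]
        simp only [Function.update_apply]
        have hpa : p ≠ a := fun h => ha (h ▸ hp)
        have hpa' : ¬ (p.1 = a.1 ∧ p.2 = a.2) := fun h => hpa (Sigma.ext h.1 (heq_of_eq h.2))
        split_ifs with h1 h2 h2
        · exact absurd (h1.trans h2.symm) hp'.ne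
        · intro h
          exact hpa' ⟨h1, (X_injective h).symm⟩
        · intro h
          have := X_injective h
          rw [this, h2] at hp'
          exact lt_asymm hlt hp'
        · intro h
          exact hp'.ne (X_injective h)
      have hB0 := (mul_eq_zero.1 h0.symm).resolve_left hne
      obtain ⟨D, rfl⟩ := X_sub_X_dvd _ _ _ hB0
      rw [Finset.prod_insert ha, hB]
      exact ⟨D, by ring⟩
  have := key (Finset.univ.sigma fun i => Finset.Ioi i) (by simp)
  rwa [Finset.prod_sigma] at this

open MvPolynomial in
/-- The symmetrization of the indeterminates is a polynomial. -/
theorem exists_polynomial {K : Type*} [Field K] (t : K) (n : ℕ) (μ : YoungDiagram) :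
    ∃ p : MvPolynomial (Fin n) K,
      algebraMap (MvPolynomial (Fin n) K) (FractionRing (MvPolynomial (Fin n) K)) p =
        symmetrization (algebraMap K (FractionRing (MvPolynomial (Fin n) K)) t) n μ
          (fun i => algebraMap (MvPolynomial (Fin n) K) _ (X i)) := by
  obtain ⟨B, hB⟩ := delta_dvd_altSum t n μ
  refine ⟨C (vFactor t n μ)⁻¹ * B, ?_⟩
  have hd : delta n (fun i => algebraMap (MvPolynomial (Fin n) K)
      (FractionRing (MvPolynomial (Fin n) K)) (X i)) ≠ 0 :=
    delta_ne_zero _ _ fun i j h => X_injective (IsFractionRing.injective _ _ h)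
  have hC : ∀ a : K, algebraMap K (FractionRing (MvPolynomial (Fin n) K)) a =
      algebraMap (MvPolynomial (Fin n) K) (FractionRing (MvPolynomial (Fin n) K)) (C a) :=
    fun a => IsScalarTower.algebraMap_apply K (MvPolynomial (Fin n) K) _ a
  have h1 := congrArg (algebraMap (MvPolynomial (Fin n) K)
    (FractionRing (MvPolynomial (Fin n) K))) hB
  rw [map_mul, map_altSum, map_delta, ← hC] at h1
  rw [symmetrization_eq, h1, mul_div_cancel_left₀ _ hd, map_mul, ← hC, map_inv₀, map_vFactor]

/-- The Hall–Littlewood polynomial `P_μ(x_1, …, x_n; t)`, for a partition `μ` with at most `n`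
nonzero parts: the polynomial given by the symmetrization of the indeterminates. -/
noncomputable def poly {K : Type*} [Field K] (t : K) (n : ℕ) (μ : YoungDiagram) :
    MvPolynomial (Fin n) K :=
  (exists_polynomial t n μ).choose

/-- The Hall–Littlewood function `P_μ(x_1, x_2, …; t)` in the variables `x_i`, `i : ℕ`, as a formal
power series: the limit of `P_μ(x_1, …, x_n; t)` for `n → ∞`.  The coefficient of a monomial `m` is
the one it has in `P_μ(x_1, …, x_n; t)` for the first `n ≥ l(μ)` such that `m` involves
only `x_1, …, x_n`; by `coeff_func` below, all larger `n` give the same coefficient. -/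
noncomputable def func {K : Type*} [Field K] (t : K) (μ : YoungDiagram) : MvPowerSeries ℕ K :=
  fun m => MvPolynomial.coeff m (MvPolynomial.rename Fin.val
    (poly t (max (μ.colLen 0) (m.support.sup Nat.succ)) μ))

theorem poly_spec {K : Type*} [Field K] (t : K) (n : ℕ) (μ : YoungDiagram) :
    algebraMap (MvPolynomial (Fin n) K) (FractionRing (MvPolynomial (Fin n) K)) (poly t n μ) =
      symmetrization (algebraMap K (FractionRing (MvPolynomial (Fin n) K)) t) n μ
        (fun i => algebraMap (MvPolynomial (Fin n) K) _ (MvPolynomial.X i)) :=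
  (exists_polynomial t n μ).choose_spec

open MvPolynomial in
theorem aeval_poly {K L : Type*} [Field K] [Field L] [Algebra K L] (t : K) (n : ℕ)
    (μ : YoungDiagram) (y : Fin n → L) (hy : Function.Injective y) :
    aeval y (poly t n μ) = symmetrization (algebraMap K L t) n μ y := by
  have hC : ∀ a : K, algebraMap K (FractionRing (MvPolynomial (Fin n) K)) a =
      algebraMap (MvPolynomial (Fin n) K) (FractionRing (MvPolynomial (Fin n) K)) (C a) :=
    fun a => IsScalarTower.algebraMap_apply K (MvPolynomial (Fin n) K) _ a
  have hd : delta n (fun i => algebraMap (MvPolynomial (Fin n) K)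
      (FractionRing (MvPolynomial (Fin n) K)) (X i)) ≠ 0 :=
    delta_ne_zero _ _ fun i j h => X_injective (IsFractionRing.injective _ _ h)
  have h := poly_spec t n μ
  rw [symmetrization_eq, ← mul_div_assoc, eq_div_iff hd, ← map_vFactor, ← map_inv₀, hC, hC,
    ← map_delta, ← map_altSum, ← map_mul, ← map_mul] at h
  have h2 := congrArg (aeval y) (IsFractionRing.injective _ _ h)
  rw [map_mul, map_mul] at h2
  have e1 : aeval y (delta n (X : Fin n → MvPolynomial (Fin n) K)) = delta n y := by
    refine (map_delta (aeval y : MvPolynomial (Fin n) K →ₐ[K] L).toRingHom n X).trans ?_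
    simp
  have e2 : aeval y (altSum (C t) n μ (X : Fin n → MvPolynomial (Fin n) K)) =
      altSum (algebraMap K L t) n μ y := by
    refine (map_altSum (aeval y : MvPolynomial (Fin n) K →ₐ[K] L).toRingHom _ n μ X).trans ?_
    simp
  rw [e1, e2, aeval_C, map_inv₀, map_vFactor] at h2
  rw [symmetrization_eq, ← mul_div_assoc, eq_div_iff (delta_ne_zero _ _ hy), h2]

/-- The permutation of `Fin (n + 1)` with `k ↦ n` that induces `w` on the remaining indices. -/
def extendPerm (n : ℕ) (p : Fin (n + 1) × Equiv.Perm (Fin n)) : Equiv.Perm (Fin (n + 1)) :=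
  ((finSuccEquiv' p.1).trans (Equiv.optionCongr p.2)).trans (finSuccEquiv' (Fin.last n)).symm

theorem extendPerm_self (n : ℕ) (k : Fin (n + 1)) (w : Equiv.Perm (Fin n)) :
    extendPerm n (k, w) k = Fin.last n := by
  simp [extendPerm]

theorem extendPerm_succAbove (n : ℕ) (k : Fin (n + 1)) (w : Equiv.Perm (Fin n)) (i : Fin n) :
    extendPerm n (k, w) (k.succAbove i) = (w i).castSucc := by
  simp [extendPerm]

theorem extendPerm_bijective (n : ℕ) : Function.Bijective (extendPerm n) := by
  rw [Fintype.bijective_iff_injective_and_card]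
  constructor
  · rintro ⟨k, w⟩ ⟨k', w'⟩ h
    have hk : k = k' := by
      apply (extendPerm n (k', w')).injective
      rw [extendPerm_self, ← h, extendPerm_self]
    subst hk
    congr 1
    ext i
    have := congrArg (fun e => e (k.succAbove i)) h
    simp only [extendPerm_succAbove] at this
    rw [Fin.castSucc_injective _ this]
  · simp [Fintype.card_perm, Nat.factorial_succ]

theorem prod_pairs_succAbove {L : Type*} [CommMonoid L] (n : ℕ) (k : Fin (n + 1))
    (g : Fin (n + 1) → Fin (n + 1) → L) :
    ∏ i, ∏ j ∈ Finset.Ioi i, g i j =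
      ((∏ i ∈ Finset.Iio k, g i k) * ∏ j ∈ Finset.Ioi k, g k j) *
        ∏ i : Fin n, ∏ j ∈ Finset.Ioi i, g (k.succAbove i) (k.succAbove j) := by
  have h : ∀ (m : ℕ) (f : Fin m → Fin m → L), ∏ i, ∏ j ∈ Finset.Ioi i, f i j =
      ∏ i, ∏ j, if i < j then f i j else 1 := by
    intro m f
    refine Finset.prod_congr rfl fun i _ => ?_
    rw [← Finset.prod_filter]
    congr 1
    ext j
    simp
  have h1 : ∏ i ∈ Finset.Iio k, g i k = ∏ i, if i < k then g i k else 1 := by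
    rw [← Finset.prod_filter]
    congr 1
    ext j
    simp
  have h2 : ∏ j ∈ Finset.Ioi k, g k j = ∏ j, if k < j then g k j else 1 := by
    rw [← Finset.prod_filter]
    congr 1
    ext j
    simp
  rw [h, h, h1, h2, Fin.prod_univ_succAbove _ k, Fin.prod_univ_succAbove _ k,
    Fin.prod_univ_succAbove (fun i => if i < k then g i k else 1) k]
  simp only [lt_irrefl, if_false, one_mul]
  rw [mul_comm (∏ i, if k.succAbove i < k then g (k.succAbove i) k else 1), mul_assoc]
  congr 1
  rw [← Finset.prod_mul_distrib]
  refine Finset.prod_congr rfl fun i _ => ?_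
  rw [Fin.prod_univ_succAbove _ k]
  simp only [Fin.succAbove_lt_succAbove_iff]

theorem rowLen_eq_zero_iff (μ : YoungDiagram) (k : ℕ) : μ.rowLen k = 0 ↔ μ.colLen 0 ≤ k := by
  rw [← not_lt, ← YoungDiagram.mem_iff_lt_colLen, YoungDiagram.mem_iff_lt_rowLen, not_lt,
    Nat.le_zero]

theorem sum_step {L : Type*} [Field L] (t : L) (n : ℕ) (μ : YoungDiagram) (x : Fin n → L)
    (hx0 : ∀ i, x i ≠ 0) (hμ : μ.colLen 0 ≤ n) :
    ∑ w : Equiv.Perm (Fin (n + 1)),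
      (∏ i, (Fin.snoc x 0 : Fin (n + 1) → L) (w i) ^ μ.rowLen i) *
        ∏ i, ∏ j ∈ Finset.Ioi i, ((Fin.snoc x 0 : Fin (n + 1) → L) (w i) -
          t * (Fin.snoc x 0 : Fin (n + 1) → L) (w j)) /
          ((Fin.snoc x 0 : Fin (n + 1) → L) (w i) - (Fin.snoc x 0 : Fin (n + 1) → L) (w j)) =
    (∑ a ∈ Finset.range (n + 1 - μ.colLen 0), t ^ a) *
      ∑ w : Equiv.Perm (Fin n), (∏ i, x (w i) ^ μ.rowLen i) *
        ∏ i, ∏ j ∈ Finset.Ioi i, (x (w i) - t * x (w j)) / (x (w i) - x (w j)) := by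
  have hnz : ∀ (k : Fin (n + 1)) (w : Equiv.Perm (Fin n)) (i : Fin (n + 1)), i ≠ k →
      (Fin.snoc x 0 : Fin (n + 1) → L) (extendPerm n (k, w) i) ≠ 0 := by
    intro k w i hi
    obtain ⟨i, rfl⟩ := Fin.exists_succAbove_eq hi
    rw [extendPerm_succAbove, Fin.snoc_castSucc]
    exact hx0 _
  rw [← (extendPerm_bijective n).sum_comp, Fintype.sum_prod_type]
  have hk : ∀ k : Fin (n + 1), ∑ w : Equiv.Perm (Fin n),
      ((∏ i, (Fin.snoc x 0 : Fin (n + 1) → L) (extendPerm n (k, w) i) ^ μ.rowLen i) *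
        ∏ i, ∏ j ∈ Finset.Ioi i, ((Fin.snoc x 0 : Fin (n + 1) → L) (extendPerm n (k, w) i) -
          t * (Fin.snoc x 0 : Fin (n + 1) → L) (extendPerm n (k, w) j)) /
          ((Fin.snoc x 0 : Fin (n + 1) → L) (extendPerm n (k, w) i) -
            (Fin.snoc x 0 : Fin (n + 1) → L) (extendPerm n (k, w) j))) =
      (if μ.colLen 0 ≤ k then t ^ (n - (k : ℕ)) else 0) *
      ∑ w : Equiv.Perm (Fin n), (∏ i, x (w i) ^ μ.rowLen i) *
        ∏ i, ∏ j ∈ Finset.Ioi i, (x (w i) - t * x (w j)) / (x (w i) - x (w j)) := by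
    intro k
    rw [Finset.mul_sum]
    refine Finset.sum_congr rfl fun w _ => ?_
    rw [prod_pairs_succAbove n k, Fin.prod_univ_succAbove _ k]
    simp only [extendPerm_self, extendPerm_succAbove, Fin.snoc_castSucc, Fin.snoc_last, mul_zero,
      sub_zero, zero_sub]
    split_ifs with hl
    · have e1 : ∏ i ∈ Finset.Iio k, (Fin.snoc x 0 : Fin (n + 1) → L) (extendPerm n (k, w) i) /
          (Fin.snoc x 0 : Fin (n + 1) → L) (extendPerm n (k, w) i) = 1 :=
        Finset.prod_eq_one fun i hi => div_self (hnz k w i (Finset.mem_Iio.1 hi).ne)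
      have e2 : ∏ j ∈ Finset.Ioi k,
          -(t * (Fin.snoc x 0 : Fin (n + 1) → L) (extendPerm n (k, w) j)) /
          -(Fin.snoc x 0 : Fin (n + 1) → L) (extendPerm n (k, w) j) = t ^ (n - (k : ℕ)) := by
        rw [Finset.prod_congr rfl (g := fun _ => t), Finset.prod_const, Fin.card_Ioi]
        · simp
        · intro j hj
          rw [neg_div_neg_eq, mul_div_cancel_right₀ _ (hnz k w j (Finset.mem_Ioi.1 hj).ne')]
      have e3 : ∀ i : Fin n, μ.rowLen (k.succAbove i) = μ.rowLen i := by
        intro i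
        rcases lt_or_ge i.castSucc k with h | h
        · rw [Fin.succAbove_of_castSucc_lt _ _ h]
          rfl
        · rw [Fin.succAbove_of_le_castSucc _ _ h]
          have h' : (k : ℕ) ≤ i := h
          rw [(rowLen_eq_zero_iff μ _).2 (hl.trans h'), (rowLen_eq_zero_iff μ _).2]
          rw [Fin.val_succ]
          omega
      rw [e1, e2, (rowLen_eq_zero_iff μ k).2 hl]
      simp only [e3, pow_zero, one_mul]
      ring
    · rw [zero_pow (mt (rowLen_eq_zero_iff μ k).1 hl)]
      simp
  rw [Finset.sum_congr rfl fun k _ => hk k, ← Finset.sum_mul]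
  congr 1
  rw [Fin.sum_univ_eq_sum_range (fun k => if μ.colLen 0 ≤ k then t ^ (n - k) else 0),
    ← Finset.sum_range_reflect]
  have hsplit : n + 1 = (n + 1 - μ.colLen 0) + μ.colLen 0 := by omega
  conv_lhs => rw [hsplit]
  rw [Finset.sum_range_add, Finset.sum_eq_zero (s := Finset.range (μ.colLen 0)), add_zero]
  · refine Finset.sum_congr rfl fun a ha => ?_
    have := Finset.mem_range.1 ha
    rw [if_pos (by omega)]
    congr 1
    omega
  · intro a ha
    have := Finset.mem_range.1 ha
    rw [if_neg (by omega)]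

theorem mult_zero (n : ℕ) (μ : YoungDiagram) :
    mult n μ 0 = n - μ.colLen 0 := by
  have : (Finset.range n).filter (fun k => μ.rowLen k = 0) = Finset.Ico (μ.colLen 0) n := by
    ext k
    simp [rowLen_eq_zero_iff, and_comm]
  rw [mult, this, Nat.card_Ico]

theorem mult_succ (n : ℕ) (μ : YoungDiagram) (hμ : μ.colLen 0 ≤ n) (i : ℕ) (hi : i ≠ 0) :
    mult (n + 1) μ i = mult n μ i := by
  rw [mult, mult, Finset.range_add_one, Finset.filter_insert, if_neg]
  rw [(rowLen_eq_zero_iff μ n).2 hμ]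
  exact hi.symm

theorem vFactor_succ {K : Type*} [Field K] (t : K) (n : ℕ) (μ : YoungDiagram)
    (hμ : μ.colLen 0 ≤ n) :
    vFactor t (n + 1) μ = (∑ a ∈ Finset.range (n + 1 - μ.colLen 0), t ^ a) * vFactor t n μ := by
  unfold vFactor
  rw [Finset.prod_range_succ', Finset.prod_range_succ', mult_zero,
    mult_zero, Nat.sub_add_comm hμ,
    Finset.prod_Icc_succ_top (Nat.le_add_left 1 _), mul_comm (∑ a ∈ _, _), ← mul_assoc]
  congr 2
  refine Finset.prod_congr rfl fun i _ => ?_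
  rw [mult_succ _ _ hμ _ (Nat.succ_ne_zero i)]

theorem symmetrization_snoc {L : Type*} [Field L] (t : L) (n : ℕ) (μ : YoungDiagram)
    (x : Fin n → L) (hx0 : ∀ i, x i ≠ 0) (hμ : μ.colLen 0 ≤ n)
    (ht : ∑ a ∈ Finset.range (n + 1 - μ.colLen 0), t ^ a ≠ 0) :
    symmetrization t (n + 1) μ (Fin.snoc x 0 : Fin (n + 1) → L) = symmetrization t n μ x := by
  unfold symmetrization
  rw [sum_step t n μ x hx0 hμ, vFactor_succ t n μ hμ, mul_inv]
  field_simp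

open MvPolynomial in
/-- Stability: setting the last variable to `0`. -/
theorem killCompl_poly {K : Type*} [Field K] (t : K) (n : ℕ) (μ : YoungDiagram)
    (hμ : μ.colLen 0 ≤ n) (ht : ∑ a ∈ Finset.range (n + 1 - μ.colLen 0), t ^ a ≠ 0) :
    killCompl (Fin.castSucc_injective n) (poly t (n + 1) μ) = poly t n μ := by
  apply IsFractionRing.injective (MvPolynomial (Fin n) K) (FractionRing (MvPolynomial (Fin n) K))
  have hx0 : ∀ i : Fin n, algebraMap (MvPolynomial (Fin n) K)
      (FractionRing (MvPolynomial (Fin n) K)) (X i) ≠ 0 := fun i h =>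
    X_ne_zero i ((map_eq_zero_iff _ (IsFractionRing.injective _ _)).1 h)
  have hinj : Function.Injective (fun i : Fin n => algebraMap (MvPolynomial (Fin n) K)
      (FractionRing (MvPolynomial (Fin n) K)) (X i)) :=
    fun i j h => X_injective (IsFractionRing.injective _ _ h)
  have ht' : ∑ a ∈ Finset.range (n + 1 - μ.colLen 0),
      (algebraMap K (FractionRing (MvPolynomial (Fin n) K)) t) ^ a ≠ 0 := by
    simp only [← map_pow, ← map_sum]
    exact (map_ne_zero _).2 ht
  rw [poly_spec, ← symmetrization_snoc _ n μ _ hx0 hμ ht', ← aeval_poly]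
  · have : ((Algebra.ofId (MvPolynomial (Fin n) K)
        (FractionRing (MvPolynomial (Fin n) K))).restrictScalars K).comp
        (killCompl (Fin.castSucc_injective n)) =
        aeval (Fin.snoc (fun i : Fin n => algebraMap (MvPolynomial (Fin n) K)
          (FractionRing (MvPolynomial (Fin n) K)) (X i)) 0 :
            Fin (n + 1) → FractionRing (MvPolynomial (Fin n) K)) := by
      ext i
      refine Fin.lastCases ?_ (fun i => ?_) i
      · simp [killCompl]
      · have := killCompl_rename_app (R := K) (Fin.castSucc_injective n) (X i)
        rw [rename_X] at this
        simp only [AlgHom.comp_apply, this]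
        simp [Algebra.ofId_apply]
    exact congrArg (fun f => f (poly t (n + 1) μ)) this
  · intro i j h
    induction i using Fin.lastCases with
    | last =>
      induction j using Fin.lastCases with
      | last => rfl
      | cast j =>
        rw [Fin.snoc_last, Fin.snoc_castSucc] at h
        exact absurd h.symm (hx0 j)
    | cast i =>
      induction j using Fin.lastCases with
      | last =>
        rw [Fin.snoc_last, Fin.snoc_castSucc] at h
        exact absurd h (hx0 i)
      | cast j =>
        rw [Fin.snoc_castSucc, Fin.snoc_castSucc] at h
        rw [hinj h]

open MvPolynomial in
/-- The coefficients of `P_μ(x_1, …, x_n; t)` are eventually constant in `n`, with value the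
coefficient of the Hall–Littlewood function. -/
theorem coeff_func {K : Type*} [Field K] (t : K)
    (ht : ∀ n : ℕ, 0 < n → ∑ a ∈ Finset.range n, t ^ a ≠ 0) (μ : YoungDiagram) (m : ℕ →₀ ℕ)
    (n : ℕ) (hμ : μ.colLen 0 ≤ n) (hm : ∀ i ∈ m.support, i < n) :
    MvPowerSeries.coeff m (func t μ) = coeff m (rename Fin.val (poly t n μ)) := by
  have hN : max (μ.colLen 0) (m.support.sup Nat.succ) ≤ n :=
    max_le hμ (Finset.sup_le fun i hi => hm i hi)
  induction n, hN using Nat.le_induction with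
  | base => rfl
  | succ n hn ih =>
    have hμ' : μ.colLen 0 ≤ n := (le_max_left _ _).trans hn
    have hm' : ∀ i ∈ m.support, i < n := fun i hi =>
      (Finset.le_sup (f := Nat.succ) hi).trans ((le_max_right _ _).trans hn)
    rw [ih hμ' hm', ← killCompl_poly t n μ hμ' (ht _ (by omega))]
    have hr : (m.support : Set ℕ) ⊆ Set.range (Fin.val : Fin n → ℕ) := by
      intro i hi
      exact ⟨⟨i, hm' i hi⟩, rfl⟩
    obtain ⟨d, rfl⟩ : ∃ d : Fin n →₀ ℕ, d.mapDomain Fin.val = m :=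
      ⟨_, Finsupp.mapDomain_comapDomain Fin.val Fin.val_injective m hr⟩
    rw [coeff_rename_mapDomain _ Fin.val_injective, coeff_killCompl]
    have : Finsupp.mapDomain Fin.val d =
        Finsupp.mapDomain (Fin.val : Fin (n + 1) → ℕ) (Finsupp.mapDomain Fin.castSucc d) := by
      rw [← Finsupp.mapDomain_comp]
      rfl
    rw [this, coeff_rename_mapDomain _ Fin.val_injective]

/-- `o(μ) + |μ|` is even, so `(o(μ) + |μ|) / 2` is a natural number. -/
theorem even_oddParts_add_card (μ : YoungDiagram) : Even (oddParts μ + μ.card) := by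
  have h : μ.card = ∑ i ∈ Finset.range (μ.colLen 0), μ.rowLen i := by
    have hmaps : Set.MapsTo Prod.fst (μ.cells : Set (ℕ × ℕ)) (Finset.range (μ.colLen 0)) := by
      intro s hs
      have h1 : (s.1, s.2) ∈ μ := hs
      exact Finset.mem_coe.2 (Finset.mem_range.2 (YoungDiagram.mem_iff_lt_colLen.1
        (μ.up_left_mem le_rfl (Nat.zero_le _) h1)))
    refine (Finset.card_eq_sum_card_fiberwise hmaps).trans ?_
    refine Finset.sum_congr rfl fun i _ => ?_
    rw [YoungDiagram.rowLen_eq_card]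
    rfl
  rw [h, oddParts, Finset.card_filter, ← Finset.sum_add_distrib]
  refine Finset.even_sum _ fun i _ => ?_
  split_ifs with ho
  · exact odd_one.add_odd ho
  · simpa using ho

end HallLittlewood

/-! In `n` variables, `P_μ` is a sum over the distinct exponent vectors `f` whose values are the
parts of `μ`, with term `∏ x_i ^ f i` times the product of `(x_i - t x_j) / (x_i - x_j)` over the
pairs with `f j < f i`: symmetrizing over variables with equal exponents produces exactly the
`t`-factorials in `v_μ` (`sum_perm_eq`). The coefficient of `P_μ` in the theorem is a product over
the part sizes `k` of a weight depending on `k` and its multiplicity (`prod_partWeight`). So the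
left side in `n` variables is a sum over all exponent vectors of a product over their level sets.

Removing the level set of exponent `0` expresses this sum over a set `S` of variables through sums
over subsets `T`, by a twisted convolution `conv` with kernel `cross`. Up to powers of `t` the
weights are 2-periodic in `k`, which gives a coupled system for two functions of `S`: `E`, where `0`
is weighted like an even part, and `O`, where it is weighted like an odd one.

Convolutions compose through `t`-binomial coefficients (`conv_conv`), and the two weight sequences
are Rogers–Szegő polynomials at `-1` and `-t`. Hence convolving with them is convolving with the
constant sequence `1` and then with `(-1) ^ k` or `(-t) ^ k`. Writing `*` for `conv`, the system
becomes `F = 1 * (∏ x_i / t) ((-t) ^ k * F')` and `F' = 1 * (∏ x_i) ((-1) ^ k * F)`, where `F` is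
the sum in the theorem. Induction on `S` shows that the solution is unique.

It remains to see that two explicit products solve the system. After inverting the sequence `1`,
both equations are instances of `conv_prodSide`. That identity is proved by interpolation in one
variable `y`: with denominators cleared, the difference of the two sides has degree at most `2 #S +
2`, is divisible by `y ^ 2 - t`, and vanishes at `0` and at all `x_i` and `t / x_i`; this exceeds
its degree by one.

An auxiliary variable recording the degree makes the infinite sums formal and the genericity
conditions automatic. Finally, a given monomial sees only finitely many variables and partitions, so
its coefficient is already determined at a finite level. -/

namespace HallLittlewood

open Finset Polynomial

/-! ### Twisted convolutions and the product side for a finite set of variables. -/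

section Defs
variable {ι L : Type*} [LinearOrder ι] [Field L]

/-- The elementary factor `(a - t b) / (a - b)` of the symmetrization. -/
def ratio (t a b : L) : L := (a - t * b) / (a - b)

/-- The product of `ratio` over `T × U`. -/
def cross (t : L) (x : ι → L) (T U : Finset ι) : L :=
  ∏ i ∈ T, ∏ j ∈ U, ratio t (x i) (x j)

/-- The twisted convolution of a sequence of scalars with a function on finite sets. -/
def conv (t : L) (x : ι → L) (c : ℕ → L) (A : Finset ι → L) (S : Finset ι) : L :=
  ∑ T ∈ S.powerset, c #(S \ T) * cross t x T (S \ T) * A T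

/-- The factor attached to a pair of variables. -/
def pairFactor (t a b : L) : L := (1 - a * b) / (1 - a * b / t)

/-- The factor attached to one variable. -/
def oneFactor (t u v a : L) : L := (1 + u * a + v * a ^ 2) / (1 - a ^ 2 / t)

/-- The product side of the Littlewood identity in the variables indexed by `T`. -/
def prodSide (t u v : L) (x : ι → L) (T : Finset ι) : L :=
  (∏ i ∈ T, oneFactor t u v (x i)) *
    ∏ i ∈ T, ∏ j ∈ T, if i < j then pairFactor t (x i) (x j) else 1

theorem pairFactor_comm (t a b : L) : pairFactor t a b = pairFactor t b a := by
  simp [pairFactor, mul_comm]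

/-- The pair factor is symmetric, so the new index may sit anywhere in the order. -/
theorem prodSide_insert (t u v : L) (x : ι → L) {n : ι} {T : Finset ι} (hn : n ∉ T) :
    prodSide t u v x (insert n T) =
      oneFactor t u v (x n) * (∏ j ∈ T, pairFactor t (x n) (x j)) * prodSide t u v x T := by
  have h : ∏ j ∈ T, pairFactor t (x n) (x j) =
      (∏ j ∈ T, if n < j then pairFactor t (x n) (x j) else 1) *
        ∏ j ∈ T, if j < n then pairFactor t (x j) (x n) else 1 := by
    rw [← prod_mul_distrib]
    refine prod_congr rfl fun j hj => ?_
    rcases lt_trichotomy n j with h | h | h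
    · simp [h, not_lt.2 h.le]
    · exact absurd (h ▸ hj) hn
    · simp [h, not_lt.2 h.le, pairFactor_comm]
  unfold prodSide
  rw [prod_insert hn, prod_insert hn, prod_insert hn, h]
  simp only [prod_insert hn, prod_mul_distrib, lt_irrefl, if_false]
  ring

theorem cross_insert_left (t : L) (x : ι → L) {n : ι} {T : Finset ι} (hn : n ∉ T)
    (U : Finset ι) : cross t x (insert n T) U =
      (∏ j ∈ U, ratio t (x n) (x j)) * cross t x T U := by
  rw [cross, prod_insert hn]; rfl

theorem cross_insert_right (t : L) (x : ι → L) {n : ι} {U : Finset ι} (hn : n ∉ U)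
    (T : Finset ι) : cross t x T (insert n U) =
      (∏ j ∈ T, ratio t (x j) (x n)) * cross t x T U := by
  simp only [cross, prod_insert hn, prod_mul_distrib]

theorem sum_powerset_insert_compl {M : Type*} [AddCommMonoid M] {n : ι} {S : Finset ι}
    (hn : n ∉ S) (f : Finset ι → Finset ι → M) :
    ∑ T ∈ (insert n S).powerset, f T (insert n S \ T) =
      ∑ T ∈ S.powerset, (f (insert n T) (S \ T) + f T (insert n (S \ T))) := by
  rw [sum_powerset_insert hn, add_comm, ← sum_add_distrib]
  refine sum_congr rfl fun T hT => ?_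
  have hnT : n ∉ T := fun h => hn (mem_powerset.1 hT h)
  rw [insert_sdiff_insert, sdiff_insert_of_notMem hn, insert_sdiff_of_notMem _ hnT]

/-- Isolates the dependence on `x n`: the index `n` lies either in the upper set or in its
complement, and in the latter case it raises the index of `c` by one. -/
theorem conv_insert (t : L) (x : ι → L) (c : ℕ → L) (A : Finset ι → L) {n : ι} {S : Finset ι}
    (hn : n ∉ S) : conv t x c A (insert n S) = ∑ T ∈ S.powerset, cross t x T (S \ T) *
      (c #(S \ T) * (∏ j ∈ S \ T, ratio t (x n) (x j)) * A (insert n T) +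
        c (#(S \ T) + 1) * (∏ j ∈ T, ratio t (x j) (x n)) * A T) := by
  unfold conv
  rw [sum_powerset_insert_compl hn fun T U => c #U * cross t x T U * A T]
  refine sum_congr rfl fun T hT => ?_
  have hnT : n ∉ T := fun h => hn (mem_powerset.1 hT h)
  have hnU : n ∉ S \ T := fun h => hn (sdiff_subset h)
  rw [cross_insert_left _ _ hnT, cross_insert_right _ _ hnU, card_insert_of_notMem hnU]
  ring

end Defs

/-! ### Clearing denominators in one distinguished variable. -/

section Cleared
variable {ι L M N : Type*} [LinearOrder ι] [Field L] [CommRing M] [Algebra L M] [CommRing N]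
  [Algebra L N]

/-- The summand with the variable `y` in the upper set, with denominators cleared. -/
def upperTerm (t u v : L) (x : ι → L) (T U : Finset ι) (y : M) : M :=
  (1 + algebraMap L M u * y + algebraMap L M v * y ^ 2) *
    (∏ j ∈ T, (1 - algebraMap L M (x j) * y) * (y - algebraMap L M (x j))) *
    ∏ k ∈ U, (y - algebraMap L M (t * x k)) * (1 - algebraMap L M (x k / t) * y)

/-- The summand with the variable `y` in the lower set, with denominators cleared. -/
def lowerTerm (t : L) (x : ι → L) (T U : Finset ι) (y : M) : M :=
  (1 - algebraMap L M t⁻¹ * y ^ 2) *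
    (∏ j ∈ T, (algebraMap L M t * y - algebraMap L M (x j)) * (1 - algebraMap L M (x j / t) * y)) *
    ∏ k ∈ U, (y - algebraMap L M (x k)) * (1 - algebraMap L M (x k / t) * y)

/-- The convolution over `insert n S` as a function of the variable `y` with index `n`, with
denominators cleared. -/
def clearedConv (t u v : L) (x : ι → L) (c : ℕ → L) (S : Finset ι) (y : M) : M :=
  ∑ T ∈ S.powerset, algebraMap L M (cross t x T (S \ T) * prodSide t u v x T) *
    (algebraMap L M (c #(S \ T)) * upperTerm t u v x T (S \ T) y +
      algebraMap L M (c (#(S \ T) + 1)) * lowerTerm t x T (S \ T) y)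

/-- Links the three uses of the variable `y`: as an indeterminate, as an element of the field, and
as a square root of `t`. -/
theorem map_clearedConv (f : M →ₐ[L] N) (t u v : L) (x : ι → L) (c : ℕ → L) (S : Finset ι)
    (y : M) : f (clearedConv t u v x c S y) = clearedConv t u v x c S (f y) := by
  simp [clearedConv, upperTerm, lowerTerm, map_sum, map_prod]

end Cleared

section Eval
variable {ι L : Type*} [LinearOrder ι] [Field L]

theorem clearedConv_eq {t : L} (ht0 : t ≠ 0) (u v : L) (x : ι → L) (c : ℕ → L) {n : ι} {S : Finset ι}
    (hn : n ∉ S) (hx : ∀ i ∈ S, x n ≠ x i) (hxx : ∀ i ∈ S, x n * x i ≠ t) (hnn : x n ^ 2 ≠ t) :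
    clearedConv t u v x c S (x n) = conv t x c (prodSide t u v x) (insert n S) *
      ((1 - x n ^ 2 / t) * ∏ j ∈ S, (x n - x j) * (1 - x n * x j / t)) := by
  have h1 : ∀ j ∈ S, x n - x j ≠ 0 := fun j hj => sub_ne_zero.2 (hx j hj)
  have h2 : ∀ j ∈ S, 1 - x n * x j / t ≠ 0 := fun j hj h => hxx j hj (by field_simp at h; linear_combination -h)
  have h3 : 1 - x n ^ 2 / t ≠ 0 := fun h => hnn (by field_simp at h; linear_combination -h)
  rw [conv_insert _ _ _ _ hn, sum_mul]
  refine sum_congr rfl fun T hT => ?_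
  have hT' := mem_powerset.1 hT
  have hnT : n ∉ T := fun h => hn (hT' h)
  rw [prodSide_insert _ _ _ _ hnT, ← prod_sdiff hT']
  have e1 : upperTerm t u v x T (S \ T) (x n) =
      (∏ j ∈ S \ T, ratio t (x n) (x j)) * (oneFactor t u v (x n) * ∏ j ∈ T, pairFactor t (x n) (x j)) *
      ((1 - x n ^ 2 / t) * ((∏ j ∈ S \ T, (x n - x j) * (1 - x n * x j / t)) *
        ∏ j ∈ T, (x n - x j) * (1 - x n * x j / t))) := by
    have a1 : ∏ j ∈ T, (1 - x j * x n) * (x n - x j) =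
        (∏ j ∈ T, pairFactor t (x n) (x j)) * ∏ j ∈ T, (x n - x j) * (1 - x n * x j / t) := by
      rw [← prod_mul_distrib]
      refine prod_congr rfl fun j hj => ?_
      have := h2 j (hT' hj)
      rw [pairFactor, div_mul_eq_mul_div, eq_div_iff this]
      ring
    have a2 : ∏ j ∈ S \ T, (x n - t * x j) * (1 - x j / t * x n) =
        (∏ j ∈ S \ T, ratio t (x n) (x j)) * ∏ j ∈ S \ T, (x n - x j) * (1 - x n * x j / t) := by
      rw [← prod_mul_distrib]
      refine prod_congr rfl fun j hj => ?_
      have e : ratio t (x n) (x j) * (x n - x j) = x n - t * x j :=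
        div_mul_cancel₀ _ (h1 j (sdiff_subset hj))
      rw [← mul_assoc, e]
      ring
    have a3 : 1 + u * x n + v * x n ^ 2 = oneFactor t u v (x n) * (1 - x n ^ 2 / t) := by
      rw [oneFactor, div_mul_cancel₀ _ h3]
    simp only [upperTerm, Algebra.algebraMap_self, RingHom.id_apply]
    rw [a1, a2, a3]
    ring
  have e2 : lowerTerm t x T (S \ T) (x n) = (∏ j ∈ T, ratio t (x j) (x n)) *
      ((1 - x n ^ 2 / t) * ((∏ j ∈ S \ T, (x n - x j) * (1 - x n * x j / t)) *
        ∏ j ∈ T, (x n - x j) * (1 - x n * x j / t))) := by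
    have a1 : ∏ j ∈ T, (t * x n - x j) * (1 - x j / t * x n) =
        (∏ j ∈ T, ratio t (x j) (x n)) * ∏ j ∈ T, (x n - x j) * (1 - x n * x j / t) := by
      rw [← prod_mul_distrib]
      refine prod_congr rfl fun j hj => ?_
      have e : ratio t (x j) (x n) * (x j - x n) = x j - t * x n :=
        div_mul_cancel₀ _ fun h => h1 j (hT' hj) (by linear_combination -h)
      linear_combination (1 - x n * x j / t) * e
    have a2 : ∏ j ∈ S \ T, (x n - x j) * (1 - x j / t * x n) =
        ∏ j ∈ S \ T, (x n - x j) * (1 - x n * x j / t) := by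
      refine prod_congr rfl fun j hj => ?_
      ring
    simp only [lowerTerm, Algebra.algebraMap_self, RingHom.id_apply]
    rw [a1, a2]
    ring
  simp only [Algebra.algebraMap_self, RingHom.id_apply]
  rw [e1, e2]
  ring

/-- At a root of `y ^ 2 = t` the cleared convolution reduces to the one over `S`. -/
theorem clearedConv_of_sq {M : Type*} [CommRing M] [Algebra L M] {t : L} (ht0 : t ≠ 0) (u v : L) (x : ι → L)
    (c : ℕ → L) (S : Finset ι) (y : M) (hy : y ^ 2 = algebraMap L M t) :
    clearedConv t u v x c S y = algebraMap L M (conv t x c (prodSide t u v x) S) *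
      ((1 + algebraMap L M u * y + algebraMap L M v * y ^ 2) *
        ∏ j ∈ S, (1 - algebraMap L M (x j) * y) * (y - algebraMap L M (x j))) := by
  have hM : algebraMap L M t⁻¹ * algebraMap L M t = 1 := by
    rw [← map_mul, inv_mul_cancel₀ ht0, map_one]
  rw [conv, map_sum, sum_mul]
  refine sum_congr rfl fun T hT => ?_
  rw [← prod_sdiff (mem_powerset.1 hT)]
  -- When `y ^ 2 = t`, both `(y - t x) (1 - x y / t)` and `(1 - x y) (y - x)` equal `y - x - t x + x
  -- ^ 2 y`. The product over `S` then no longer depends on `T` and factors out.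
  have e1 : ∏ k ∈ S \ T, (y - algebraMap L M (t * x k)) * (1 - algebraMap L M (x k / t) * y) =
      ∏ j ∈ S \ T, (1 - algebraMap L M (x j) * y) * (y - algebraMap L M (x j)) := by
    refine prod_congr rfl fun k _ => ?_
    rw [div_eq_mul_inv, map_mul, map_mul]
    linear_combination (algebraMap L M (x k) - algebraMap L M (x k) * algebraMap L M t⁻¹) * hy +
      (algebraMap L M (x k)^2*y - algebraMap L M (x k)) * hM
  have e2 : lowerTerm t x T (S \ T) y = 0 := by
    rw [lowerTerm, hy, hM]; simp
  rw [e2, upperTerm, e1]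
  simp only [map_mul]
  ring

end Eval

end HallLittlewood

namespace HallLittlewood
open Finset Polynomial

/-! ### Values of the cleared convolution at `x i`, `t / x i` and `0`. -/

section Roots
variable {ι L : Type*} [Field L]

theorem upperTerm_eq_zero_left (t u v : L) (x : ι → L) {T : Finset ι} (U : Finset ι) {i : ι}
    (hi : i ∈ T) : upperTerm t u v x T U (x i) = 0 := by
  rw [upperTerm, prod_eq_zero hi] <;> simp

theorem upperTerm_eq_zero_right (t u v : L) (x : ι → L) (T : Finset ι) {U : Finset ι} {i : ι}
    (hi : i ∈ U) (y : L) (hy : x i / t * y = 1) : upperTerm t u v x T U y = 0 := by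
  rw [upperTerm, prod_eq_zero hi] <;> simp [hy]

theorem lowerTerm_eq_zero_right (t : L) (x : ι → L) (T : Finset ι) {U : Finset ι} {i : ι}
    (hi : i ∈ U) : lowerTerm t x T U (x i) = 0 := by
  rw [lowerTerm, prod_eq_zero hi] <;> simp

theorem lowerTerm_eq_zero_of_mem (t : L) (x : ι → L) (T U : Finset ι) {i : ι}
    (hi : i ∈ T ∨ i ∈ U) (y : L) (hy : x i / t * y = 1) : lowerTerm t x T U y = 0 := by
  rcases hi with h | h <;> rw [lowerTerm, prod_eq_zero h] <;> simp [hy]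

variable [LinearOrder ι]

/-- The apparent pole at `y = x i` cancels, for every sequence `c`. Only the terms with `y` and `x
i` on opposite sides of the partition survive; exchanging the two variables pairs these with
opposite signs. -/
theorem clearedConv_insert_root {t : L} (u v : L) (x : ι → L) (c : ℕ → L) {i : ι}
    {S : Finset ι} (hi : i ∉ S) (hx : ∀ j ∈ S, x i ≠ x j) (hxx : ∀ j ∈ S, x i * x j ≠ t)
    (hii : x i ^ 2 ≠ t) (ht0 : t ≠ 0) :
    clearedConv t u v x c (insert i S) (x i) = 0 := by
  have h1 : ∀ j ∈ S, x i - x j ≠ 0 := fun j hj => sub_ne_zero.2 (hx j hj)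
  have h2 : ∀ j ∈ S, 1 - x i * x j / t ≠ 0 := fun j hj h =>
    hxx j hj (by field_simp at h; linear_combination -h)
  have h3 : 1 - x i ^ 2 / t ≠ 0 := fun h => hii (by field_simp at h; linear_combination -h)
  unfold clearedConv
  rw [sum_powerset_insert_compl hi fun T U => algebraMap L L (cross t x T U * prodSide t u v x T) *
    (algebraMap L L (c #U) * upperTerm t u v x T U (x i) +
      algebraMap L L (c (#U + 1)) * lowerTerm t x T U (x i))]
  refine sum_eq_zero fun T hT => ?_
  have hT' := mem_powerset.1 hT
  have hiT : i ∉ T := fun h => hi (hT' h)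
  have hiU : i ∉ S \ T := fun h => hi (sdiff_subset h)
  rw [upperTerm_eq_zero_left _ _ _ _ _ (mem_insert_self i T),
    lowerTerm_eq_zero_right _ _ _ (mem_insert_self i (S \ T)), card_insert_of_notMem hiU,
    cross_insert_left _ _ hiT, cross_insert_right _ _ hiU, prodSide_insert _ _ _ _ hiT]
  have e1 : (∏ j ∈ T, ratio t (x j) (x i)) * upperTerm t u v x T (insert i (S \ T)) (x i) =
      - ((∏ j ∈ S \ T, ratio t (x i) (x j)) *
        (oneFactor t u v (x i) * ∏ j ∈ T, pairFactor t (x i) (x j)) *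
        lowerTerm t x (insert i T) (S \ T) (x i)) := by
    simp only [upperTerm, lowerTerm, prod_insert hiT, prod_insert hiU, Algebra.algebraMap_self,
      RingHom.id_apply]
    have a1 : (∏ j ∈ T, ratio t (x j) (x i)) * ∏ j ∈ T, (1 - x j * x i) * (x i - x j) =
        (∏ j ∈ T, pairFactor t (x i) (x j)) * ∏ j ∈ T, (t * x i - x j) * (1 - x j / t * x i) := by
      rw [← prod_mul_distrib, ← prod_mul_distrib]
      refine prod_congr rfl fun j hj => ?_
      have e : ratio t (x j) (x i) * (x j - x i) = x j - t * x i :=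
        div_mul_cancel₀ _ fun h => h1 j (hT' hj) (by linear_combination -h)
      have e' : pairFactor t (x i) (x j) * (1 - x i * x j / t) = 1 - x i * x j :=
        div_mul_cancel₀ _ (h2 j (hT' hj))
      linear_combination (- (1 - x j * x i)) * e - (t * x i - x j) * e'
    have a2 : ∏ j ∈ S \ T, (x i - t * x j) * (1 - x j / t * x i) =
        (∏ j ∈ S \ T, ratio t (x i) (x j)) *
          ∏ j ∈ S \ T, (x i - x j) * (1 - x j / t * x i) := by
      rw [← prod_mul_distrib]
      refine prod_congr rfl fun j hj => ?_
      have e : ratio t (x i) (x j) * (x i - x j) = x i - t * x j :=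
        div_mul_cancel₀ _ (h1 j (sdiff_subset hj))
      linear_combination (-(1 - x j / t * x i)) * e
    have a3 : oneFactor t u v (x i) * (1 - x i ^ 2 / t) = 1 + u * x i + v * x i ^ 2 :=
      div_mul_cancel₀ _ h3
    rw [a2]
    linear_combination (((1 + u * x i + v * x i ^ 2) * (x i - t * x i) * (1 - x i / t * x i)) *
      ((∏ j ∈ S \ T, ratio t (x i) (x j)) *
          ∏ j ∈ S \ T, (x i - x j) * (1 - x j / t * x i))) * a1 - (∏ j ∈ S \ T, ratio t (x i) (x j)) *
          (∏ j ∈ S \ T, (x i - x j) * (1 - x j / t * x i)) * (∏ j ∈ T, pairFactor t (x i) (x j)) * (∏ j ∈ T, (t * x i - x j) * (1 - x j / t * x i)) * (x i - t * x i) * (1 - x i / t * x i) * a3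
  simp only [Algebra.algebraMap_self, RingHom.id_apply]
  linear_combination (cross t x T (S \ T) * prodSide t u v x T * c (#(S \ T) + 1)) * e1

/-- At `y = t / x i` only the terms with both `y` and `x i` in the upper set survive. Their
`i`-dependent factors combine into a product over all of `S`, independent of `T`, which leaves the
convolution without `i`. -/
theorem clearedConv_insert_inv {t : L} (ht0 : t ≠ 0) (u v : L) (x : ι → L) (c : ℕ → L) {i : ι}
    {S : Finset ι} (hi : i ∉ S) (hx : ∀ j ∈ S, x i ≠ x j) (hxx : ∀ j ∈ S, x i * x j ≠ t)
    (hi0 : x i ≠ 0) :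
    clearedConv t u v x c (insert i S) (t / x i) =
      (1 + u * (t / x i) + v * (t / x i) ^ 2) * oneFactor t u v (x i) *
        ((1 - t) * (t / x i - x i) * ∏ j ∈ S, t * (x i - t * x j) * (1 - x i * x j) / x i ^ 2) *
        conv t x c (prodSide t u v x) S := by
  have h1 : ∀ j ∈ S, x i - x j ≠ 0 := fun j hj => sub_ne_zero.2 (hx j hj)
  have h2 : ∀ j ∈ S, 1 - x i * x j / t ≠ 0 := fun j hj h =>
    hxx j hj (by field_simp at h; linear_combination -h)
  have hy : x i / t * (t / x i) = 1 := by field_simp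
  unfold clearedConv
  rw [sum_powerset_insert_compl hi fun T U => algebraMap L L (cross t x T U * prodSide t u v x T) *
    (algebraMap L L (c #U) * upperTerm t u v x T U (t / x i) +
      algebraMap L L (c (#U + 1)) * lowerTerm t x T U (t / x i)), conv, mul_sum]
  refine sum_congr rfl fun T hT => ?_
  have hT' := mem_powerset.1 hT
  have hiT : i ∉ T := fun h => hi (hT' h)
  rw [upperTerm_eq_zero_right _ _ _ _ _ (mem_insert_self i (S \ T)) _ hy,
    lowerTerm_eq_zero_of_mem _ _ _ _ (.inl (mem_insert_self i T)) _ hy,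
    lowerTerm_eq_zero_of_mem _ _ _ _ (.inr (mem_insert_self i _)) _ hy,
    cross_insert_left _ _ hiT, prodSide_insert _ _ _ _ hiT, ← prod_sdiff hT']
  have a1 : (∏ j ∈ T, pairFactor t (x i) (x j)) *
      ∏ j ∈ T, (1 - x j * (t / x i)) * (t / x i - x j) =
        ∏ j ∈ T, t * (x i - t * x j) * (1 - x i * x j) / x i ^ 2 := by
    rw [← prod_mul_distrib]
    refine prod_congr rfl fun j hj => ?_
    have e' : pairFactor t (x i) (x j) * (1 - x i * x j / t) = 1 - x i * x j :=
      div_mul_cancel₀ _ (h2 j (hT' hj))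
    rw [← e']
    field_simp
  have a2 : (∏ j ∈ S \ T, ratio t (x i) (x j)) *
      ∏ j ∈ S \ T, (t / x i - t * x j) * (1 - x j / t * (t / x i)) =
        ∏ j ∈ S \ T, t * (x i - t * x j) * (1 - x i * x j) / x i ^ 2 := by
    rw [← prod_mul_distrib]
    refine prod_congr rfl fun j hj => ?_
    have e : ratio t (x i) (x j) * (x i - x j) = x i - t * x j :=
      div_mul_cancel₀ _ (h1 j (sdiff_subset hj))
    rw [← e]
    field_simp
  rw [← a1, ← a2]
  simp only [upperTerm, prod_insert hiT, Algebra.algebraMap_self, RingHom.id_apply]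
  have e0 : 1 - x i * (t / x i) = 1 - t := by field_simp
  rw [e0]
  ring

/-- At `y = 0` the upper term is `t ^ #U` times the lower one, which the recursion for `c` cancels.
-/
theorem clearedConv_zero {t : L} (u v : L) (x : ι → L) (c : ℕ → L) (S : Finset ι)
    (hc : ∀ k, c (k + 1) = - (t ^ k * c k)) : clearedConv t u v x c S (0 : L) = 0 := by
  refine sum_eq_zero fun T hT => ?_
  have h : upperTerm t u v x T (S \ T) (0 : L) = t ^ #(S \ T) * lowerTerm t x T (S \ T) (0 : L) := by
    simp only [upperTerm, lowerTerm, Algebra.algebraMap_self, RingHom.id_apply]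
    simp only [mul_zero, sub_zero, zero_sub, one_mul, mul_one, ← mul_neg, prod_mul_distrib,
      prod_const]
    simp
    ring
  rw [h, hc]
  simp only [Algebra.algebraMap_self, RingHom.id_apply]
  ring

end Roots

/-! ### Degree and top coefficient of the cleared convolution. -/

section Degree
variable {ι L : Type*} [Field L]

theorem natDegree_prod_le_card_mul {f : ι → L[X]} (T : Finset ι) {d : ℕ}
    (h : ∀ j ∈ T, (f j).natDegree ≤ d) : (∏ j ∈ T, f j).natDegree ≤ #T * d :=
  (natDegree_prod_le _ _).trans (sum_le_card_nsmul _ _ _ h)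

theorem natDegree_upperTerm_le (t u v : L) (x : ι → L) (T U : Finset ι) :
    (upperTerm t u v x T U (X : L[X])).natDegree ≤ 2 + #T * 2 + #U * 2 := by
  unfold upperTerm
  refine natDegree_mul_le_of_le (natDegree_mul_le_of_le ?_ ?_) ?_
  · simp only [algebraMap_eq]; compute_degree
  · refine (natDegree_prod_le _ _).trans (sum_le_card_nsmul _ _ _ fun j _ => ?_)
    simp only [algebraMap_eq]; compute_degree
  · refine (natDegree_prod_le _ _).trans (sum_le_card_nsmul _ _ _ fun j _ => ?_)
    simp only [algebraMap_eq]; compute_degree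

theorem natDegree_lowerTerm_le (t : L) (x : ι → L) (T U : Finset ι) :
    (lowerTerm t x T U (X : L[X])).natDegree ≤ 2 + #T * 2 + #U * 2 := by
  unfold lowerTerm
  refine natDegree_mul_le_of_le (natDegree_mul_le_of_le ?_ ?_) ?_
  · simp only [algebraMap_eq]; compute_degree
  · refine (natDegree_prod_le _ _).trans (sum_le_card_nsmul _ _ _ fun j _ => ?_)
    simp only [algebraMap_eq]; compute_degree
  · refine (natDegree_prod_le _ _).trans (sum_le_card_nsmul _ _ _ fun j _ => ?_)
    simp only [algebraMap_eq]; compute_degree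

theorem coeff_mul_mul_of_natDegree_le {p q r : L[X]} {a b c : ℕ} (hp : p.natDegree ≤ a)
    (hq : q.natDegree ≤ b) (hr : r.natDegree ≤ c) :
    (p * q * r).coeff (a + b + c) = p.coeff a * q.coeff b * r.coeff c := by
  rw [coeff_mul_add_eq_of_natDegree_le (natDegree_mul_le_of_le hp hq) hr, coeff_mul_add_eq_of_natDegree_le hp hq]

theorem coeff_upperTerm (t u v : L) (x : ι → L) (T U : Finset ι) :
    (upperTerm t u v x T U (X : L[X])).coeff (2 + #T * 2 + #U * 2) =
      v * (∏ j ∈ T, - x j) * ∏ k ∈ U, - (x k / t) := by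
  unfold upperTerm
  have h1 : ∀ j, ((1 - C (x j) * X) * (X - C (x j)) : L[X]).natDegree ≤ 2 := fun j => by
    compute_degree
  have h2 : ∀ j, ((X - C (t * x j)) * (1 - C (x j / t) * X) : L[X]).natDegree ≤ 2 := fun j => by
    compute_degree
  simp only [algebraMap_eq]
  rw [coeff_mul_mul_of_natDegree_le (by compute_degree)
    (natDegree_prod_le_card_mul _ fun j _ => h1 j)
    (natDegree_prod_le_card_mul _ fun j _ => h2 j),
    coeff_prod_of_natDegree_le _ _ _ fun j _ => h1 j,
    coeff_prod_of_natDegree_le _ _ _ fun j _ => h2 j]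
  congr 2
  · simp [coeff_one]
  · refine prod_congr rfl fun j _ => ?_
    rw [coeff_mul_add_eq_of_natDegree_le (df := 1) (dg := 1) (by compute_degree) (by compute_degree)]
    simp [coeff_one, coeff_X]
  · ext j
    rw [coeff_mul_add_eq_of_natDegree_le (df := 1) (dg := 1) (by compute_degree) (by compute_degree)]
    simp [coeff_one, coeff_X]

theorem coeff_lowerTerm {t : L} (ht0 : t ≠ 0) (x : ι → L) (T U : Finset ι) :
    (lowerTerm t x T U (X : L[X])).coeff (2 + #T * 2 + #U * 2) =
      - t⁻¹ * (∏ j ∈ T, - x j) * ∏ k ∈ U, - (x k / t) := by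
  unfold lowerTerm
  have h1 : ∀ j, ((C t * X - C (x j)) * (1 - C (x j / t) * X) : L[X]).natDegree ≤ 2 := fun j => by
    compute_degree
  have h2 : ∀ j, ((X - C (x j)) * (1 - C (x j / t) * X) : L[X]).natDegree ≤ 2 := fun j => by
    compute_degree
  simp only [algebraMap_eq]
  rw [coeff_mul_mul_of_natDegree_le (by compute_degree)
    (natDegree_prod_le_card_mul _ fun j _ => h1 j)
    (natDegree_prod_le_card_mul _ fun j _ => h2 j),
    coeff_prod_of_natDegree_le _ _ _ fun j _ => h1 j,
    coeff_prod_of_natDegree_le _ _ _ fun j _ => h2 j]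
  congr 2
  · simp [coeff_one]
  · refine prod_congr rfl fun j _ => ?_
    rw [coeff_mul_add_eq_of_natDegree_le (df := 1) (dg := 1) (by compute_degree) (by compute_degree)]
    simp [coeff_one, coeff_C]
    field_simp
  · ext j
    rw [coeff_mul_add_eq_of_natDegree_le (df := 1) (dg := 1) (by compute_degree) (by compute_degree)]
    simp [coeff_one, coeff_X]

variable [LinearOrder ι]

theorem natDegree_clearedConv_le (t u v : L) (x : ι → L) (c : ℕ → L) (S : Finset ι) :
    (clearedConv t u v x c S (X : L[X])).natDegree ≤ 2 * #S + 2 := by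
  refine natDegree_sum_le_of_forall_le _ _ fun T hT => ?_
  have hcard := card_sdiff_add_card_eq_card (mem_powerset.1 hT)
  have e : 2 + #T * 2 + #(S \ T) * 2 = 2 * #S + 2 := by omega
  have h1 := natDegree_upperTerm_le t u v x T (S \ T)
  have h2 := natDegree_lowerTerm_le t x T (S \ T)
  rw [e] at h1 h2
  simp only [algebraMap_eq]
  exact (natDegree_C_mul_le _ _).trans (natDegree_add_le_of_degree_le
    ((natDegree_C_mul_le _ _).trans h1) ((natDegree_C_mul_le _ _).trans h2))

/-- The top coefficients of the upper and lower terms are in the ratio `v : -t⁻¹`, so they cancel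
within each summand. -/
theorem coeff_clearedConv {t : L} (ht0 : t ≠ 0) (u v : L) (x : ι → L) (c : ℕ → L) (S : Finset ι)
    (hc : ∀ k, c (k + 1) = v * t * c k) :
    (clearedConv t u v x c S (X : L[X])).coeff (2 * #S + 2) = 0 := by
  unfold clearedConv
  rw [finsetSum_coeff]
  refine sum_eq_zero fun T hT => ?_
  have hcard := card_sdiff_add_card_eq_card (mem_powerset.1 hT)
  have e : 2 * #S + 2 = 2 + #T * 2 + #(S \ T) * 2 := by omega
  simp only [algebraMap_eq]
  rw [e, coeff_C_mul, coeff_add, coeff_C_mul, coeff_C_mul, coeff_upperTerm, coeff_lowerTerm ht0, hc]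
  field_simp
  ring

end Degree

/-! ### The interpolation argument. -/

/-- The rational function identities behind the recursion for the sum over partitions. -/
theorem conv_prodSide {ι L : Type*} [LinearOrder ι] [Field L] {t : L} (ht0 : t ≠ 0) (x : ι → L)
    (u v u' v' τ : L) (c c' : ℕ → L)
    (hc0 : c 0 = c' 0) (hc : ∀ k, c (k + 1) = - (t ^ k * c k))
    (hc' : ∀ k, c' (k + 1) = v' * t * c' k)
    (h1 : 1 + v * t = τ * u' * t) (h2 : u = τ * (1 + v' * t)) (h3 : v = τ ^ 2 * v' * t)
    (S : Finset ι)
    (hinj : Set.InjOn x S) (hx0 : ∀ i ∈ S, x i ≠ 0) (hxx : ∀ i ∈ S, ∀ j ∈ S, x i * x j ≠ t) :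
    conv t x c (prodSide t u v x) S =
      (∏ i ∈ S, τ * x i) * conv t x c' (prodSide t u' v' x) S := by
  induction hn : #S using Nat.strong_induction_on generalizing S with
  | _ m ih =>
  subst hn
  rcases S.eq_empty_or_nonempty with rfl | ⟨n, hnS⟩
  · simp [conv, hc0, prodSide]
  obtain ⟨S, hn, rfl⟩ : ∃ S', n ∉ S' ∧ S = insert n S' :=
    ⟨S.erase n, by simp, (insert_erase hnS).symm⟩
  have ihS := ih #S (by rw [card_insert_of_notMem hn]; omega) S
    (hinj.mono (by simp)) (fun i hi => hx0 i (mem_insert_of_mem hi))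
    (fun i hi j hj => hxx i (mem_insert_of_mem hi) j (mem_insert_of_mem hj)) rfl
  -- The difference of the two sides for `insert n S`, with denominators cleared and `x n` replaced
  -- by an indeterminate.
  set N : L[X] := clearedConv t u v x c S X -
    C (∏ i ∈ S, τ * x i) * (C τ * X) * clearedConv t u' v' x c' S X with hN
  have hNe : ∀ y : L, N.eval y = clearedConv t u v x c S y -
      (∏ i ∈ S, τ * x i) * (τ * y) * clearedConv t u' v' x c' S y := by
    intro y
    have h := fun u v (c : ℕ → L) => map_clearedConv (aeval y : L[X] →ₐ[L] L) t u v x c S X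
    simp only [coe_aeval_eq_eval, aeval_X] at h
    rw [hN, eval_sub, eval_mul, eval_mul, h, h, eval_C, eval_mul, eval_C, eval_X]
  -- Modulo `X ^ 2 - t` both cleared convolutions reduce to convolutions over `S`, which the
  -- induction hypothesis compares. What remains is linear in the root and is `h1` plus the root
  -- times `h2`.
  have hdvd : X ^ 2 - C t ∣ N := by
    rw [← AdjoinRoot.mk_eq_zero, hN]
    have hs : (AdjoinRoot.root (X ^ 2 - C t)) ^ 2 = algebraMap L _ t := by
      have := AdjoinRoot.eval₂_root (X ^ 2 - C t)
      simpa [sub_eq_zero] using this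
    have h := fun u v (c : ℕ → L) =>
      map_clearedConv (AdjoinRoot.mkₐ (X ^ 2 - C t) : L[X] →ₐ[L] _) t u v x c S X
    simp only [AdjoinRoot.coe_mkₐ, AdjoinRoot.mk_X] at h
    rw [map_sub, map_mul, map_mul, map_mul, h, h, AdjoinRoot.mk_X, clearedConv_of_sq ht0 _ _ _ _ _ _ hs,
      clearedConv_of_sq ht0 _ _ _ _ _ _ hs, ihS, AdjoinRoot.mk_C, AdjoinRoot.mk_C, hs]
    have h1' := congrArg (algebraMap L (AdjoinRoot (X ^ 2 - C t))) h1
    have h2' := congrArg (algebraMap L (AdjoinRoot (X ^ 2 - C t))) h2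
    simp only [← AdjoinRoot.algebraMap_eq, map_mul, map_add, map_one] at h1' h2' ⊢
    linear_combination (h1' + AdjoinRoot.root (X ^ 2 - C t) * h2' -
      algebraMap L _ τ * algebraMap L _ u' * hs) *
      (algebraMap L (AdjoinRoot (X ^ 2 - C t)) (∏ i ∈ S, τ * x i) *
        algebraMap L _ (conv t x c' (prodSide t u' v' x) S) *
        ∏ j ∈ S, (1 - algebraMap L _ (x j) * AdjoinRoot.root (X ^ 2 - C t)) *
          (AdjoinRoot.root (X ^ 2 - C t) - algebraMap L _ (x j)))
  have hroot : ∀ i ∈ S, N.eval (x i) = 0 ∧ N.eval (t / x i) = 0 := by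
    intro i hiS
    obtain ⟨S, hi, rfl⟩ : ∃ S', i ∉ S' ∧ S = insert i S' :=
      ⟨S.erase i, by simp, (insert_erase hiS).symm⟩
    have hni : n ∉ S := fun h => hn (mem_insert_of_mem h)
    have hx : ∀ j ∈ S, x i ≠ x j := fun j hj h =>
      hi (hinj (by simp) (by simp [hj]) h ▸ hj)
    have hxx' : ∀ j ∈ S, x i * x j ≠ t := fun j hj => hxx i (by simp) j (by simp [hj])
    have hii : x i ^ 2 ≠ t := by rw [sq]; exact hxx i (by simp) i (by simp)
    have hi0 : x i ≠ 0 := hx0 i (by simp)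
    constructor
    · rw [hNe, clearedConv_insert_root u v x c hi hx hxx' hii ht0,
        clearedConv_insert_root u' v' x c' hi hx hxx' hii ht0]
      ring
    · have ihS' := ih #S (by rw [card_insert_of_notMem hn, card_insert_of_notMem hi]; omega) S
        (hinj.mono (fun j hj => by simp [mem_coe.1 hj]))
        (fun i hi => hx0 i (by simp [hi])) (fun i hi j hj => hxx i (by simp [hi]) j (by simp [hj])) rfl
      rw [hNe, clearedConv_insert_inv ht0 u v x c hi hx hxx' hi0,
        clearedConv_insert_inv ht0 u' v' x c' hi hx hxx' hi0, ihS', prod_insert hi]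
      -- The constant `τ ^ 2 * t` is `(τ * x i) * (τ * (t / x i))`: the factor of index `i` in the
      -- product, times the factor `τ * y` in `N`.
      have key : (1 + u * (t / x i) + v * (t / x i) ^ 2) * oneFactor t u v (x i) =
          τ ^ 2 * t * ((1 + u' * (t / x i) + v' * (t / x i) ^ 2) * oneFactor t u' v' (x i)) := by
        have e : x i * (t / x i) = t := by field_simp
        generalize t / x i = y at e ⊢
        rw [oneFactor, oneFactor, mul_div_assoc', mul_div_assoc', mul_div_assoc']
        congr 1
        subst e
        linear_combination (1 + v * (x i * y) + τ * u' * (x i * y) + (x i + y) * u) * h1 +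
          ((x i + y) ^ 2 - 4 * (x i * y)) * h3 +
          ((x i * y) * (u + τ * (1 + v' * (x i * y))) + (x i + y) * (τ * u' * (x i * y))) * h2
      rw [key]
      field_simp
      ring
  have hN0 : N = 0 := by
    obtain ⟨N', hN'⟩ := hdvd
    have hev : ∀ y : L, y ^ 2 ≠ t → N.eval y = 0 → N'.eval y = 0 := by
      intro y hy h
      rw [hN', eval_mul] at h
      refine (mul_eq_zero.1 h).resolve_left ?_
      simpa [sub_eq_zero] using hy
    by_contra hN0
    have hN'0 : N' ≠ 0 := fun h => hN0 (by rw [hN', h, mul_zero])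
    -- The factor `C τ * X` would allow one degree more; that coefficient vanishes by
    -- `coeff_clearedConv`.
    have hdeg : N.natDegree ≤ 2 * #S + 2 := by
      have h1 : N.natDegree ≤ 2 * #S + 2 + 1 := by
        refine (natDegree_sub_le _ _).trans (max_le ?_ ?_)
        · exact (natDegree_clearedConv_le _ _ _ _ _ _).trans (Nat.le_succ _)
        · rw [add_comm]
          refine natDegree_mul_le_of_le ?_ (natDegree_clearedConv_le _ _ _ _ _ _)
          compute_degree
      refine natDegree_le_iff_coeff_eq_zero.2 fun k hk => ?_
      rcases Nat.lt_or_ge (2 * #S + 2 + 1) k with hk' | hk'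
      · exact coeff_eq_zero_of_natDegree_lt (h1.trans_lt hk')
      · obtain rfl : k = 2 * #S + 2 + 1 := by omega
        rw [hN, coeff_sub, coeff_eq_zero_of_natDegree_lt
          ((natDegree_clearedConv_le _ _ _ _ _ _).trans_lt (Nat.lt_succ_self _)), ← mul_assoc,
          ← C_mul, mul_assoc, coeff_C_mul, coeff_X_mul, coeff_clearedConv ht0 _ _ _ _ _ hc']
        simp
    have hdegN : N.natDegree = 2 + N'.natDegree := by
      rw [hN', natDegree_mul (X_pow_sub_C_ne_zero two_pos t) hN'0, natDegree_X_pow_sub_C]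
    have hinjS : Set.InjOn x S := hinj.mono (by simp)
    have hx0' : ∀ i ∈ S, x i ≠ 0 := fun i hi => hx0 i (mem_insert_of_mem hi)
    have hxx' : ∀ i ∈ S, ∀ j ∈ S, x i * x j ≠ t := fun i hi j hj =>
      hxx i (mem_insert_of_mem hi) j (mem_insert_of_mem hj)
    classical
    -- The points `0`, `x i` and `t / x i` are `2 * #S + 1` distinct roots of `N'`, whose degree is
    -- at most `2 * #S`.
    refine hN'0 (eq_zero_of_natDegree_lt_card_of_eval_eq_zero' N'
      (insert 0 (S.image x ∪ S.image fun i => t / x i)) ?_ ?_)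
    · intro y hy
      rw [mem_insert, mem_union, mem_image, mem_image] at hy
      rcases hy with rfl | ⟨i, hi, rfl⟩ | ⟨i, hi, rfl⟩
      · refine hev 0 ?_ ?_
        · simpa using ht0.symm
        · rw [hNe, clearedConv_zero u v x c S hc]
          ring
      · exact hev _ (by rw [sq]; exact hxx' i hi i hi) (hroot i hi).1
      · refine hev _ (fun h => ?_) (hroot i hi).2
        have := hx0' i hi
        field_simp at h
        exact hxx' i hi i hi (by linear_combination -h)
    · rw [card_insert_of_notMem, card_union_of_disjoint, card_image_of_injOn hinjS,
        card_image_of_injOn]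
      · omega
      · intro i hi j hj h
        have h1 := hx0' i hi
        have h2 := hx0' j hj
        refine hinjS hi hj ?_
        simp only at h
        field_simp at h
        exact h.symm
      · rw [disjoint_left]
        intro y hy hy'
        obtain ⟨i, hi, rfl⟩ := mem_image.1 hy
        obtain ⟨j, hj, h⟩ := mem_image.1 hy'
        have h2 := hx0' j hj
        field_simp at h
        exact hxx' i hi j hj (by linear_combination -h)
      · simp only [mem_union, mem_image, not_or, not_exists, not_and]
        exact ⟨hx0', fun i hi => div_ne_zero ht0 (hx0' i hi)⟩
  have hxn : ∀ i ∈ S, x n ≠ x i := fun j hj h =>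
    hn (hinj (by simp) (by simp [hj]) h ▸ hj)
  have hxxn : ∀ j ∈ S, x n * x j ≠ t := fun j hj => hxx n (by simp) j (by simp [hj])
  have hnn : x n ^ 2 ≠ t := by rw [sq]; exact hxx n (by simp) n (by simp)
  have h := hNe (x n)
  rw [hN0, eval_zero, clearedConv_eq ht0 u v x c hn hxn hxxn hnn,
    clearedConv_eq ht0 u' v' x c' hn hxn hxxn hnn] at h
  have hne : (1 - x n ^ 2 / t) * ∏ j ∈ S, (x n - x j) * (1 - x n * x j / t) ≠ 0 := by
    refine mul_ne_zero (fun h => hnn (by field_simp at h; linear_combination -h))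
      (prod_ne_zero_iff.2 fun j hj => mul_ne_zero (sub_ne_zero.2 (hxn j hj)) fun h =>
        hxxn j hj (by field_simp at h; linear_combination -h))
  refine mul_right_cancel₀ hne ?_
  rw [prod_insert hn]
  linear_combination -h

end HallLittlewood

namespace HallLittlewood
open Finset Polynomial

/-! ### `t`-binomial coefficients and Rogers–Szegő polynomials. -/

section QBinomial
variable {R : Type*} [CommRing R]

/-- The `t`-integer `1 + t + ⋯ + t ^ (n - 1)`. -/
def qInt (t : R) (n : ℕ) : R := ∑ a ∈ range n, t ^ a

theorem qInt_succ (t : R) (n : ℕ) : qInt t (n + 1) = 1 + t * qInt t n := by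
  rw [qInt, sum_range_succ', pow_zero, add_comm, qInt, mul_sum]
  simp only [pow_succ']

theorem one_sub_mul_qInt (t : R) (n : ℕ) : (1 - t) * qInt t n = 1 - t ^ n := by
  have := mul_geom_sum t n
  rw [qInt]
  linear_combination -this

/-- The `t`-binomial coefficients. -/
def qBinom (t : R) : ℕ → ℕ → R
  | _, 0 => 1
  | 0, _ + 1 => 0
  | n + 1, k + 1 => qBinom t n k + t ^ (k + 1) * qBinom t n (k + 1)

@[simp] theorem qBinom_zero_right (t : R) (n : ℕ) : qBinom t n 0 = 1 := by cases n <;> rfl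

@[simp] theorem qBinom_zero_succ (t : R) (k : ℕ) : qBinom t 0 (k + 1) = 0 := rfl

theorem qBinom_succ_succ (t : R) (n k : ℕ) :
    qBinom t (n + 1) (k + 1) = qBinom t n k + t ^ (k + 1) * qBinom t n (k + 1) := rfl

theorem qBinom_eq_zero (t : R) {n k : ℕ} (h : n < k) : qBinom t n k = 0 := by
  induction n generalizing k with
  | zero =>
    obtain ⟨k, rfl⟩ := Nat.exists_eq_succ_of_ne_zero h.ne'
    rfl
  | succ n ih =>
    obtain ⟨k, rfl⟩ := Nat.exists_eq_succ_of_ne_zero (Nat.ne_of_gt (Nat.zero_lt_of_lt h))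
    rw [qBinom_succ_succ, ih (by omega), ih (by omega), mul_zero, add_zero]

theorem qInt_mul_qBinom (t : R) (n k : ℕ) :
    qInt t (k + 1) * qBinom t (n + 1) (k + 1) = qInt t (n + 1) * qBinom t n k := by
  induction n generalizing k with
  | zero =>
    cases k with
    | zero => simp [qBinom_succ_succ]
    | succ k => simp [qBinom_succ_succ]
  | succ n ih =>
    cases k with
    | zero =>
      have h := ih 0
      rw [qBinom_succ_succ, mul_add, qInt_succ t (n + 1)]
      simp only [zero_add, qBinom_zero_right, pow_one] at h ⊢
      have h1 : qInt t 1 = 1 := by simp [qInt]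
      rw [h1] at h ⊢
      linear_combination t * h
    | succ k =>
      have h1 := ih k
      have h2 := ih (k + 1)
      have h3 := qBinom_succ_succ t n k
      rw [qBinom_succ_succ t (n + 1), qInt_succ t (n + 1)]
      have h4 := qInt_succ t (k + 1)
      linear_combination t ^ (k + 2) * h2 + t * h1 + qBinom t (n + 1) (k + 1) * h4 -
        t * qInt t (n + 1) * h3

theorem one_sub_mul_qBinom (t : R) (n k : ℕ) :
    (1 - t ^ (k + 1)) * qBinom t (n + 1) (k + 1) = (1 - t ^ (n + 1)) * qBinom t n k := by
  rw [← one_sub_mul_qInt, ← one_sub_mul_qInt, mul_assoc, qInt_mul_qBinom, mul_assoc]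

/-- The Rogers–Szegő polynomials. -/
def rogersSzego (t c : R) (n : ℕ) : R := ∑ k ∈ range (n + 1), qBinom t n k * c ^ (n - k)

theorem rogersSzego_succ (t c : R) (n : ℕ) : rogersSzego t c (n + 1) =
    rogersSzego t c n + c * ∑ k ∈ range (n + 1), t ^ k * qBinom t n k * c ^ (n - k) := by
  have h : c * ∑ k ∈ range (n + 1), t ^ k * qBinom t n k * c ^ (n - k) =
      ∑ k ∈ range (n + 1), t ^ (k + 1) * qBinom t n (k + 1) * c ^ (n - k) + c ^ (n + 1) := by
    rw [sum_range_succ', sum_range_succ _ n, qBinom_eq_zero t (Nat.lt_succ_self n), mul_add, mul_sum]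
    simp only [pow_zero, qBinom_zero_right, Nat.sub_zero, one_mul, mul_zero, zero_mul, add_zero,
      pow_succ']
    congr 1
    refine sum_congr rfl fun k hk => ?_
    have : n - k = n - (k + 1) + 1 := by have := mem_range.1 hk; omega
    rw [this, pow_succ']
    ring
  rw [h, rogersSzego, sum_range_succ', rogersSzego]
  simp only [Nat.add_sub_add_right, qBinom_succ_succ, add_mul, sum_add_distrib, qBinom_zero_right,
    Nat.sub_zero, one_mul]
  ring

/-- Absorption, `(1 - t ^ k) [n + 1, k] = (1 - t ^ (n + 1)) [n, k - 1]`, turns the sum weighted by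
`t ^ k` in `rogersSzego_succ` into Rogers–Szegő polynomials. -/
theorem rogersSzego_add_two (t c : R) (n : ℕ) : rogersSzego t c (n + 2) =
    (1 + c) * rogersSzego t c (n + 1) - c * (1 - t ^ (n + 1)) * rogersSzego t c n := by
  have h : ∑ k ∈ range (n + 2), (1 - t ^ k) * qBinom t (n + 1) k * c ^ (n + 1 - k) =
      (1 - t ^ (n + 1)) * rogersSzego t c n := by
    rw [sum_range_succ', rogersSzego, mul_sum]
    simp only [pow_zero, sub_self, zero_mul, add_zero, one_sub_mul_qBinom, Nat.add_sub_add_right,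
      mul_assoc]
  have h2 : ∑ k ∈ range (n + 2), (1 - t ^ k) * qBinom t (n + 1) k * c ^ (n + 1 - k) =
      rogersSzego t c (n + 1) -
        ∑ k ∈ range (n + 2), t ^ k * qBinom t (n + 1) k * c ^ (n + 1 - k) := by
    rw [rogersSzego, ← sum_sub_distrib]
    exact sum_congr rfl fun k _ => by ring
  rw [rogersSzego_succ]
  linear_combination c * h2 - c * h

theorem rogersSzego_zero (t c : R) : rogersSzego t c 0 = 1 := by simp [rogersSzego]

theorem rogersSzego_one (t c : R) : rogersSzego t c 1 = 1 + c := by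
  rw [rogersSzego_succ, rogersSzego_zero]; simp

/-- The product of `1 - t ^ j` over the odd `j ≤ m`. -/
def oddProd (t : R) (m : ℕ) : R := ∏ j ∈ (range m).filter Even, (1 - t ^ (j + 1))

theorem oddProd_succ (t : R) (m : ℕ) :
    oddProd t (m + 1) = if Even m then (1 - t ^ (m + 1)) * oddProd t m else oddProd t m := by
  unfold oddProd
  rw [range_add_one, filter_insert]
  split_ifs with h
  · rw [prod_insert (by simp)]
  · rfl

/-- At `c = -t` the three-term recursion collapses to the two-step pattern of `oddProd`. These are
the weights of the odd parts. -/
theorem rogersSzego_neg (t : R) (n : ℕ) : rogersSzego t (-t) n = oddProd t n := by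
  induction n using Nat.twoStepInduction with
  | zero => simp [rogersSzego_zero, oddProd]
  | one => simp [rogersSzego_one, oddProd_succ]; simp [oddProd, sub_eq_add_neg]
  | more n h1 h2 =>
    rw [rogersSzego_add_two, h1, h2, oddProd_succ t (n + 1), oddProd_succ t n]
    by_cases h : Even n
    · simp only [h, if_true, Nat.even_add_one, not_true_eq_false, if_false]
      ring
    · simp only [h, Nat.even_add_one, not_false_eq_true, if_true, if_false]
      ring

/-- At `c = -1` the middle term of the recursion disappears, so odd indices give `0`. This encodes
the condition that even parts have even multiplicity. -/
theorem rogersSzego_neg_one (t : R) (n : ℕ) :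
    rogersSzego t (-1) n = if Even n then oddProd t n else 0 := by
  induction n using Nat.twoStepInduction with
  | zero => simp [rogersSzego_zero, oddProd]
  | one => simp [rogersSzego_one]
  | more n h1 h2 =>
    rw [rogersSzego_add_two, h1, oddProd_succ t (n + 1), oddProd_succ t n]
    by_cases h : Even n
    · simp [h, Nat.even_add_one]
      ring
    · simp [h, Nat.even_add_one]

/-- By the Pascal rule the sum cancels in consecutive pairs. It makes `altSeq` inverse to the
constant sequence `1`. -/
theorem sum_qBinom_mul (t : R) (g : ℕ → R) (hg : ∀ k, g (k + 1) = - (t ^ k * g k)) (n : ℕ) :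
    ∑ k ∈ range (n + 2), qBinom t (n + 1) k * g k = 0 := by
  have h : ∑ k ∈ range (n + 1), t ^ k * qBinom t n k * g k =
      ∑ k ∈ range (n + 1), t ^ (k + 1) * qBinom t n (k + 1) * g (k + 1) + g 0 := by
    rw [sum_range_succ', sum_range_succ _ n, qBinom_eq_zero t (Nat.lt_succ_self n)]
    simp
  rw [sum_range_succ']
  simp only [qBinom_succ_succ, add_mul, sum_add_distrib, qBinom_zero_right, one_mul]
  rw [add_assoc, ← h, ← sum_add_distrib]
  refine sum_eq_zero fun k _ => ?_
  rw [hg]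
  ring

end QBinomial

/-! ### Symmetric sums of `ratio` and composition of convolutions. -/

section Symmetric
variable {ι L : Type*} [LinearOrder ι] [Field L]

/-- Lagrange interpolation: after multiplication by `1 - t` the sum is the top coefficient, computed
from the values at the `x i`, of a polynomial of degree less than `#S`. The case `t = 1` is separate
because `1 - t` is cancelled. -/
theorem sum_prod_ratio (t : L) {x : ι → L} (hx : Function.Injective x) (hx0 : ∀ i, x i ≠ 0)
    (S : Finset ι) : ∑ i ∈ S, ∏ j ∈ S.erase i, ratio t (x i) (x j) = qInt t #S := by
  by_cases ht : t = 1
  · have : ∀ i ∈ S, ∏ j ∈ S.erase i, ratio t (x i) (x j) = 1 := fun i _ =>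
      prod_eq_one fun j hj => by
        rw [ratio, ht, one_mul, div_self (sub_ne_zero.2 (hx.ne (ne_of_mem_erase hj).symm))]
    rw [sum_congr rfl this]
    simp [qInt, ht]
  have ht' : 1 - t ≠ 0 := sub_ne_zero.2 (Ne.symm ht)
  refine mul_left_cancel₀ ht' ?_
  rw [one_sub_mul_qInt]
  rcases S.eq_empty_or_nonempty with rfl | hS
  · simp
  have hpos := hS.card_pos
  -- The second product vanishes at every `x i`, and its coefficient `t ^ #S` removes the constant
  -- term; dividing by `X` then cancels the factor `x i` in `x i - t * x i`.
  set P : L[X] := ∏ j ∈ S, (X - C (t * x j)) - C (t ^ #S) * ∏ j ∈ S, (X - C (x j)) with hP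
  have hP0 : P.coeff 0 = 0 := by
    rw [coeff_zero_eq_eval_zero, hP]
    simp only [eval_sub, eval_mul, eval_prod, eval_X, eval_C, zero_sub, ← mul_neg]
    rw [prod_mul_distrib, prod_const, sub_self]
  have hPX : P.divX * X = P := by
    have := divX_mul_X_add P
    rwa [hP0, C_0, add_zero] at this
  have hm1 : (∏ j ∈ S, (X - C (t * x j)) : L[X]).natDegree = #S := by
    rw [natDegree_prod_of_monic _ _ fun j _ => monic_X_sub_C _]
    simp only [natDegree_X_sub_C, sum_const, smul_eq_mul, mul_one]
  have hm2 : (∏ j ∈ S, (X - C (x j)) : L[X]).natDegree = #S := by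
    rw [natDegree_prod_of_monic _ _ fun j _ => monic_X_sub_C _]
    simp only [natDegree_X_sub_C, sum_const, smul_eq_mul, mul_one]
  have hdeg : P.natDegree ≤ #S := by
    refine (natDegree_sub_le _ _).trans (max_le hm1.le ((natDegree_C_mul_le _ _).trans hm2.le))
  have hlead : P.divX.coeff (#S - 1) = 1 - t ^ #S := by
    have c1 := (monic_prod_of_monic S (fun j => (X - C (t * x j) : L[X]))
      fun j _ => monic_X_sub_C _).coeff_natDegree
    have c2 := (monic_prod_of_monic S (fun j => (X - C (x j) : L[X]))
      fun j _ => monic_X_sub_C _).coeff_natDegree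
    rw [hm1] at c1
    rw [hm2] at c2
    rw [coeff_divX, Nat.sub_add_cancel hpos, hP, coeff_sub, coeff_C_mul, c1, c2, mul_one]
  have hdd : P.divX.degree < #S := by
    have h2 : P.divX.natDegree ≤ #S - 1 := by
      rw [natDegree_divX_eq_natDegree_tsub_one]; omega
    exact (degree_le_of_natDegree_le h2).trans_lt (by exact_mod_cast Nat.sub_lt hpos one_pos)
  rw [← hlead, Lagrange.coeff_eq_sum hx.injOn hdd, mul_sum]
  refine sum_congr rfl fun i hi => ?_
  have he : P.divX.eval (x i) * x i = (1 - t) * x i * ∏ j ∈ S.erase i, (x i - t * x j) := by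
    have : P.divX.eval (x i) * x i = P.eval (x i) := by
      conv_rhs => rw [← hPX]
      rw [eval_mul, eval_X]
    rw [this, hP, eval_sub, eval_mul, eval_prod, eval_prod, prod_eq_zero hi (f := fun j =>
      eval (x i) (X - C (x j))) (by simp), mul_zero, sub_zero, ← mul_prod_erase S _ hi]
    simp only [eval_sub, eval_X, eval_C]
    ring
  have he' : P.divX.eval (x i) = (1 - t) * ∏ j ∈ S.erase i, (x i - t * x j) :=
    mul_right_cancel₀ (hx0 i) (by rw [he]; ring)
  rw [he', mul_div_assoc, ← prod_div_distrib]
  rfl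

/-- Double counting of pairs `i ∈ V`: by `sum_prod_ratio`, distinguishing an element costs `qInt t
(k + 1)` inside `V` and `qInt t #B` inside `B`, which matches the absorption rule for `qBinom`. -/
theorem sum_cross_powersetCard {t : L} (ht : ∀ n : ℕ, 0 < n → qInt t n ≠ 0) {x : ι → L}
    (hx : Function.Injective x) (hx0 : ∀ i, x i ≠ 0) (k : ℕ) (B : Finset ι) :
    ∑ V ∈ B.powersetCard k, cross t x V (B \ V) = qBinom t #B k := by
  induction k generalizing B with
  | zero => simp [cross]
  | succ k ih =>
    rcases B.eq_empty_or_nonempty with rfl | hB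
    · rw [powersetCard_eq_empty.2 (by simp)]
      simp
    obtain ⟨m, hm⟩ := Nat.exists_eq_succ_of_ne_zero hB.card_pos.ne'
    refine mul_left_cancel₀ (ht (k + 1) k.succ_pos) ?_
    rw [hm, Nat.succ_eq_add_one, qInt_mul_qBinom, ← Nat.succ_eq_add_one m, ← hm,
      ← sum_prod_ratio t hx hx0 B, sum_mul]
    have h1 : ∀ V ∈ B.powersetCard (k + 1), qInt t (k + 1) * cross t x V (B \ V) =
        ∑ i ∈ V, (∏ j ∈ V.erase i, ratio t (x i) (x j)) * cross t x V (B \ V) := by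
      intro V hV
      rw [← (mem_powersetCard.1 hV).2, ← sum_prod_ratio t hx hx0 V, sum_mul]
    have h2 : ∀ i ∈ B, (∏ j ∈ B.erase i, ratio t (x i) (x j)) * qBinom t m k =
        ∑ V ∈ (B.erase i).powersetCard k, (∏ j ∈ B.erase i, ratio t (x i) (x j)) *
          cross t x V (B.erase i \ V) := by
      intro i hi
      have : #(B.erase i) = m := by rw [card_erase_of_mem hi]; omega
      rw [← mul_sum, ih, this]
    rw [mul_sum, sum_congr rfl h1, sum_congr rfl h2, sum_sigma', sum_sigma']
    refine sum_bij' (fun p _ => ⟨p.2, p.1.erase p.2⟩) (fun p _ => ⟨insert p.1 p.2, p.1⟩)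
      ?_ ?_ ?_ ?_ ?_
    · rintro ⟨V, i⟩ h
      simp only [mem_sigma, mem_powersetCard] at h ⊢
      refine ⟨h.1.1 h.2, erase_subset_erase _ h.1.1, ?_⟩
      rw [card_erase_of_mem h.2, h.1.2]
      rfl
    · rintro ⟨i, V⟩ h
      simp only [mem_sigma, mem_powersetCard] at h ⊢
      have hiV : i ∉ V := fun h' => notMem_erase i B (h.2.1 h')
      refine ⟨⟨insert_subset h.1 (h.2.1.trans (erase_subset _ _)), ?_⟩, mem_insert_self _ _⟩
      rw [card_insert_of_notMem hiV, h.2.2]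
    · rintro ⟨V, i⟩ h
      simp only [mem_sigma] at h
      simp [insert_erase h.2]
    · rintro ⟨i, V⟩ h
      simp only [mem_sigma, mem_powersetCard] at h
      have hiV : i ∉ V := fun h' => notMem_erase i B (h.2.1 h')
      simp [erase_insert hiV]
    · rintro ⟨V, i⟩ h
      simp only [mem_sigma, mem_powersetCard] at h
      obtain ⟨W, hiW, rfl⟩ : ∃ W, i ∉ W ∧ V = insert i W :=
        ⟨V.erase i, by simp, (insert_erase h.2).symm⟩
      have hiB : i ∈ B := h.1.1 h.2
      have e1 : B.erase i \ W = B \ insert i W := by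
        ext j; simp only [mem_sdiff, mem_erase, mem_insert]; tauto
      have e2 : W ⊆ B.erase i := fun j hj => mem_erase.2
        ⟨fun h' => hiW (h' ▸ hj), h.1.1 (mem_insert_of_mem hj)⟩
      simp only [erase_insert hiW]
      rw [cross_insert_left _ _ hiW, e1, ← prod_sdiff e2, e1]
      ring

theorem sum_powerset_cross {t : L} (ht : ∀ n : ℕ, 0 < n → qInt t n ≠ 0) {x : ι → L}
    (hx : Function.Injective x) (hx0 : ∀ i, x i ≠ 0) (c d : ℕ → L) (B : Finset ι) :
    ∑ V ∈ B.powerset, c #(B \ V) * d #V * cross t x V (B \ V) =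
      ∑ k ∈ range (#B + 1), qBinom t #B k * (c (#B - k) * d k) := by
  rw [sum_powerset]
  refine sum_congr rfl fun k _ => ?_
  rw [← sum_cross_powersetCard ht hx hx0, sum_mul]
  refine sum_congr rfl fun V hV => ?_
  rw [card_sdiff_of_subset (mem_powersetCard.1 hV).1, (mem_powersetCard.1 hV).2]
  ring

/-- For a chain `T ⊆ U ⊆ S` the two kernels multiply to `cross` of `T` against `S \ T` times `cross`
of `U \ T` against `S \ U`. The sum over `U` is then a `t`-binomial sum depending only on the size
of `S \ T`. -/
theorem conv_conv {t : L} (ht : ∀ n : ℕ, 0 < n → qInt t n ≠ 0) {x : ι → L}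
    (hx : Function.Injective x) (hx0 : ∀ i, x i ≠ 0) (c d : ℕ → L) (A : Finset ι → L)
    (S : Finset ι) : conv t x c (conv t x d A) S =
      conv t x (fun n => ∑ k ∈ range (n + 1), qBinom t n k * (c (n - k) * d k)) A S := by
  simp only [conv, ← sum_powerset_cross ht hx hx0, mul_sum, sum_mul]
  rw [sum_sigma', sum_sigma']
  refine sum_bij' (fun p _ => ⟨p.2, p.1 \ p.2⟩) (fun p _ => ⟨p.1 ∪ p.2, p.1⟩) ?_ ?_ ?_ ?_ ?_
  · rintro ⟨U, T⟩ h
    simp only [mem_sigma, mem_powerset] at h ⊢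
    exact ⟨h.2.trans h.1, sdiff_subset_sdiff h.1 le_rfl⟩
  · rintro ⟨T, V⟩ h
    simp only [mem_sigma, mem_powerset] at h ⊢
    exact ⟨union_subset h.1 (h.2.trans sdiff_subset), subset_union_left⟩
  · rintro ⟨U, T⟩ h
    simp only [mem_sigma, mem_powerset] at h
    simp [union_eq_right.2 h.2]
  · rintro ⟨T, V⟩ h
    simp only [mem_sigma, mem_powerset] at h
    have hd : Disjoint T V := disjoint_of_subset_right h.2 disjoint_sdiff
    simp [union_sdiff_cancel_left hd]
  · rintro ⟨U, T⟩ h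
    simp only [mem_sigma, mem_powerset] at h
    have e1 : (S \ T) \ (U \ T) = S \ U := by
      ext j
      have := @h.2 j
      simp only [mem_sdiff]; tauto
    have e2 : cross t x U (S \ U) = cross t x T (S \ U) * cross t x (U \ T) (S \ U) := by
      rw [mul_comm]; exact (prod_sdiff h.2).symm
    have e3 : cross t x T (S \ T) = cross t x T (U \ T) * cross t x T (S \ U) := by
      have hs : U \ T ⊆ S \ T := sdiff_subset_sdiff h.1 le_rfl
      simp only [cross]
      rw [← prod_mul_distrib]
      refine prod_congr rfl fun i _ => ?_
      rw [← prod_sdiff hs, e1, mul_comm]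
    simp only [e1]
    rw [e2, e3]
    ring

end Symmetric

end HallLittlewood

namespace HallLittlewood
open Finset

/-! ### The system for the two parities and its unique solution. -/

section System
variable {ι L : Type*} [LinearOrder ι] [Field L]

theorem conv_congr {t : L} {x : ι → L} {c : ℕ → L} {A B : Finset ι → L} {S : Finset ι}
    (h : ∀ T ⊆ S, A T = B T) : conv t x c A S = conv t x c B S :=
  sum_congr rfl fun T hT => by rw [h T (mem_powerset.1 hT)]

theorem conv_congr_left {t : L} {x : ι → L} {c d : ℕ → L} {A : Finset ι → L} {S : Finset ι}
    (h : ∀ n, c n = d n) : conv t x c A S = conv t x d A S := by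
  rw [funext h]

/-- The convolution is triangular with respect to inclusion; only `T = S` can contribute. -/
theorem conv_sub_conv {t : L} {x : ι → L} {c : ℕ → L} {A B : Finset ι → L} {S : Finset ι}
    (h : ∀ T ⊂ S, A T = B T) : conv t x c A S - conv t x c B S = c 0 * (A S - B S) := by
  unfold conv
  rw [← sum_sub_distrib, sum_eq_single S]
  · simp [cross, mul_sub]
  · intro T hT hTS
    rw [h T ((mem_powerset.1 hT).ssubset_of_ne hTS), sub_self]
  · simp

theorem conv_delta {t : L} {x : ι → L} {c : ℕ → L} (hc0 : c 0 = 1) (hc : ∀ n, c (n + 1) = 0)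
    (A : Finset ι → L) (S : Finset ι) : conv t x c A S = A S := by
  unfold conv
  rw [sum_eq_single S]
  · simp [cross, hc0]
  · intro T hT hTS
    have hs := card_pos.2 (sdiff_nonempty.2 fun h => hTS ((mem_powerset.1 hT).antisymm h))
    obtain ⟨m, hm⟩ := Nat.exists_eq_succ_of_ne_zero hs.ne'
    rw [hm, Nat.succ_eq_add_one, hc]
    ring
  · simp

theorem conv_empty (t : L) (x : ι → L) (c : ℕ → L) (A : Finset ι → L) :
    conv t x c A ∅ = c 0 * A ∅ := by
  simp [conv, cross]

/-- The sequence inverse to the constant sequence `1`. -/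
def altSeq (t : L) (k : ℕ) : L := (-1) ^ k * t ^ (k.choose 2)

theorem altSeq_succ (t : L) (k : ℕ) : altSeq t (k + 1) = - (t ^ k * altSeq t k) := by
  rw [altSeq, altSeq, Nat.choose_succ_succ, Nat.choose_one_right, pow_add]
  ring

theorem conv_one_conv_altSeq {t : L} (ht : ∀ n : ℕ, 0 < n → qInt t n ≠ 0) {x : ι → L}
    (hx : Function.Injective x) (hx0 : ∀ i, x i ≠ 0) (A : Finset ι → L) (S : Finset ι) :
    conv t x (fun _ => 1) (conv t x (altSeq t) A) S = A S := by
  rw [conv_conv ht hx hx0]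
  refine conv_delta ?_ (fun n => ?_) A S
  · simp [altSeq]
  · simp only [one_mul]
    exact sum_qBinom_mul t _ (altSeq_succ t) n

theorem conv_pow_conv_one {t : L} (ht : ∀ n : ℕ, 0 < n → qInt t n ≠ 0) {x : ι → L}
    (hx : Function.Injective x) (hx0 : ∀ i, x i ≠ 0) (a : L) (A : Finset ι → L) (S : Finset ι) :
    conv t x (fun k => a ^ k) (conv t x (fun _ => 1) A) S = conv t x (rogersSzego t a) A S := by
  rw [conv_conv ht hx hx0]
  simp only [mul_one]
  rfl

/-- The recursion over the parity of the smallest part determines the sum over partitions. -/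
theorem conv_one_eq_prodSide {t : L} (ht0 : t ≠ 0) (ht : ∀ n : ℕ, 0 < n → qInt t n ≠ 0) {x : ι → L}
    (hx : Function.Injective x) (hx0 : ∀ i, x i ≠ 0) (hxx : ∀ i j, x i * x j ≠ t)
    (hxS : ∀ S : Finset ι, S.Nonempty → (∏ i ∈ S, t⁻¹ * x i) * ∏ i ∈ S, x i ≠ 1)
    (E O : Finset ι → L) (hE0 : E ∅ = 1)
    (hE : ∀ S, E S = conv t x (fun n => if Even n then oddProd t n else 0)
      (fun T => (∏ i ∈ T, t⁻¹ * x i) * O T) S)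
    (hO : ∀ S, O S = conv t x (oddProd t) (fun T => (∏ i ∈ T, x i) * E T) S) (S : Finset ι) :
    conv t x (fun _ => 1) (fun T => (∏ i ∈ T, t⁻¹ * x i) * O T) S =
      prodSide t (t⁻¹ - 1) (- t⁻¹) x S := by
  set F := conv t x (fun _ => 1) (fun T => (∏ i ∈ T, t⁻¹ * x i) * O T) with hF
  set F' := conv t x (fun _ => 1) (fun T => (∏ i ∈ T, x i) * E T) with hF'
  set P := prodSide t (t⁻¹ - 1) (- t⁻¹) x with hP
  set P' := prodSide t 0 (-1) x with hP'
  have hEF : ∀ S, E S = conv t x (fun k => (-1) ^ k) F S := fun S => by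
    rw [hE, hF, conv_pow_conv_one ht hx hx0]
    exact conv_congr_left fun n => (rogersSzego_neg_one t n).symm
  have hOF : ∀ S, O S = conv t x (fun k => (-t) ^ k) F' S := fun S => by
    rw [hO, hF', conv_pow_conv_one ht hx hx0]
    exact conv_congr_left fun n => (rogersSzego_neg t n).symm
  -- Undoing the outer convolution with `altSeq` leaves `conv_prodSide` with `τ = t⁻¹`; the next
  -- claim is the same with `τ = 1` and the roles of `P` and `P'` exchanged.
  have hPP : ∀ S, P S =
      conv t x (fun _ => 1) (fun T => (∏ i ∈ T, t⁻¹ * x i) * conv t x (fun k => (-t) ^ k) P' T) S := by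
    intro S
    rw [← conv_one_conv_altSeq ht hx hx0 P S]
    refine conv_congr fun T _ => ?_
    refine conv_prodSide ht0 x _ _ _ _ t⁻¹ _ _ (by simp [altSeq]) (altSeq_succ t) ?_ ?_ ?_ ?_ T
      hx.injOn (fun i _ => hx0 i) (fun i _ j _ => hxx i j)
    · intro k; ring
    · field_simp; ring
    · field_simp; ring
    · field_simp
  have hPP' : ∀ S, P' S =
      conv t x (fun _ => 1) (fun T => (∏ i ∈ T, x i) * conv t x (fun k => (-1) ^ k) P T) S := by
    intro S
    rw [← conv_one_conv_altSeq ht hx hx0 P' S]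
    refine conv_congr fun T _ => ?_
    rw [conv_prodSide ht0 x 0 (-1) (t⁻¹ - 1) (-t⁻¹) 1 (altSeq t) (fun k => (-1) ^ k)
      (by simp [altSeq]) (altSeq_succ t) ?_ ?_ ?_ ?_ T
      hx.injOn (fun i _ => hx0 i) (fun i _ j _ => hxx i j)]
    · simp only [one_mul, hP]
    · intro k; field_simp; ring
    · field_simp; ring
    · field_simp; ring
    · field_simp
  suffices h : F S = P S ∧ F' S = P' S from h.1
  induction S using Finset.strongInduction with
  | H S ih =>
  rcases S.eq_empty_or_nonempty with rfl | hS
  · have hO0 : O ∅ = 1 := by rw [hO, conv_empty, hE0]; simp [oddProd]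
    refine ⟨?_, ?_⟩
    · rw [hF, conv_empty, hO0, hP]; simp [prodSide]
    · rw [hF', conv_empty, hE0, hP']; simp [prodSide]
  have ihF : ∀ T ⊂ S, F T = P T := fun T hT => (ih T hT).1
  have ihF' : ∀ T ⊂ S, F' T = P' T := fun T hT => (ih T hT).2
  -- By induction all proper subsets cancel in both nested convolutions, leaving the term of `S`
  -- alone.
  have d1 : F S - P S = (∏ i ∈ S, t⁻¹ * x i) * (F' S - P' S) := by
    rw [hPP S, hF, conv_sub_conv, one_mul, ← mul_sub, hOF, conv_sub_conv ihF', pow_zero, one_mul]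
    intro T hT
    rw [hOF, conv_congr fun U hU => ihF' U (hU.trans_ssubset hT)]
  have d2 : F' S - P' S = (∏ i ∈ S, x i) * (F S - P S) := by
    rw [hPP' S, hF', conv_sub_conv, one_mul, ← mul_sub, hEF, conv_sub_conv ihF, pow_zero, one_mul]
    intro T hT
    rw [hEF, conv_congr fun U hU => ihF U (hU.trans_ssubset hT)]
  -- Substituting `d2` into `d1` multiplies the difference by a scalar which is not `1` by `hxS`.
  have d3 : F S - P S = 0 := by
    have h1 : (1 - (∏ i ∈ S, t⁻¹ * x i) * ∏ i ∈ S, x i) * (F S - P S) = 0 := by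
      linear_combination d1 + (∏ i ∈ S, t⁻¹ * x i) * d2
    exact (mul_eq_zero.1 h1).resolve_left (sub_ne_zero.2 (hxS S hS).symm)
  rw [d3, mul_zero] at d2
  exact ⟨sub_eq_zero.1 d3, sub_eq_zero.1 d2⟩

end System

end HallLittlewood

namespace HallLittlewood
open Finset

/-! ### Sums over exponent vectors and removal of the zero level. -/

section LevelSum
variable {ι L : Type*} [Field L]

/-- The product over the values `k` of `f` on `S` of the weight of `k` with its multiplicity. -/
def levelWeight {M : Type*} [CommMonoid M] (h : ℕ → ℕ → M) (S : Finset ι) (f : ι → ℕ) : M :=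
  ∏ k ∈ S.image f, h k #{i ∈ S | f i = k}

/-- The summand attached to the exponents `f` in the expansion of the symmetrization. -/
def expTerm (t : L) (x : ι → L) (S : Finset ι) (f : ι → ℕ) : L :=
  (∏ i ∈ S, x i ^ f i) * ∏ i ∈ S, ∏ j ∈ S, if f j < f i then ratio t (x i) (x j) else 1

/-- The weighted sum over all exponents on `S` of total degree `d`. -/
def levelSum [DecidableEq ι] (t : L) (x : ι → L) (h : ℕ → ℕ → L) (S : Finset ι) (d : ℕ) : L :=
  ∑ f ∈ S.piAntidiag d, levelWeight h S f * expTerm t x S f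

theorem levelWeight_eq_prod_range {M : Type*} [CommMonoid M] {h : ℕ → ℕ → M}
    (h0 : ∀ k, h k 0 = 1) (S : Finset ι) (f : ι → ℕ) {N : ℕ} (hN : ∀ i ∈ S, f i < N) :
    levelWeight h S f = ∏ k ∈ range N, h k #{i ∈ S | f i = k} := by
  refine prod_subset (fun k hk => ?_) fun k _ hk => ?_
  · obtain ⟨i, hi, rfl⟩ := mem_image.1 hk
    exact mem_range.2 (hN i hi)
  · rw [filter_eq_empty_iff.2, card_empty, h0]
    exact fun i hi h => hk (mem_image.2 ⟨i, hi, h⟩)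

theorem levelWeight_mul_pow {M : Type*} [CommMonoid M] (h : ℕ → ℕ → M) (a : M) (S : Finset ι)
    (f : ι → ℕ) : levelWeight (fun k m => h k m * a ^ m) S f = levelWeight h S f * a ^ #S := by
  rw [levelWeight, prod_mul_distrib, prod_pow_eq_pow_sum, ← card_eq_sum_card_image]
  rfl

variable [LinearOrder ι]

theorem levelSum_mul_pow (t : L) (x : ι → L) (h : ℕ → ℕ → L) (a : L) (S : Finset ι) (d : ℕ) :
    levelSum t x (fun k m => h k m * a ^ m) S d = a ^ #S * levelSum t x h S d := by
  unfold levelSum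
  rw [mul_sum]
  refine sum_congr rfl fun f _ => ?_
  rw [levelWeight_mul_pow]
  ring

/-- The exponents on `S` that vanish outside `T` and are `g + 1` on `T`. -/
def raise (T : Finset ι) (g : ι → ℕ) (i : ι) : ℕ := if i ∈ T then g i + 1 else 0

theorem levelWeight_raise {M : Type*} [CommMonoid M] {h : ℕ → ℕ → M} (h0 : ∀ k, h k 0 = 1)
    {S T : Finset ι} (hT : T ⊆ S) (g : ι → ℕ) : levelWeight h S (raise T g) =
      h 0 #(S \ T) * levelWeight (fun k => h (k + 1)) T g := by
  obtain ⟨N, hN⟩ : ∃ N, ∀ i ∈ S, g i < N :=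
    ⟨S.sup g + 1, fun i hi => Nat.lt_succ_of_le (le_sup hi)⟩
  rw [levelWeight_eq_prod_range h0 S (N := N + 1), levelWeight_eq_prod_range (fun k => h0 (k + 1)) T g
    fun i hi => hN i (hT hi), prod_range_succ', mul_comm]
  · congr 2
    · congr 1
      ext i
      simp [raise]
    · ext k
      congr 2
      ext i
      rw [mem_filter, mem_filter, raise]
      constructor
      · rintro ⟨_, h⟩
        split_ifs at h with hi
        exact ⟨hi, by omega⟩
      · rintro ⟨hi, h⟩
        exact ⟨hT hi, by simp [hi, h]⟩
  · intro i hi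
    have := hN i hi
    rw [raise]
    split_ifs <;> omega

/-- The pairs between `T` and its complement are exactly those comparing a positive exponent with
`0`; they form the kernel of the convolution. -/
theorem expTerm_raise (t : L) (x : ι → L) {S T : Finset ι} (hT : T ⊆ S) (g : ι → ℕ) :
    expTerm t x S (raise T g) = cross t x T (S \ T) * (∏ i ∈ T, x i) * expTerm t x T g := by
  unfold expTerm
  have h1 : ∏ i ∈ S, x i ^ raise T g i = (∏ i ∈ T, x i) * ∏ i ∈ T, x i ^ g i := by
    rw [← prod_sdiff hT, prod_eq_one fun i hi => by simp [raise, (mem_sdiff.1 hi).2], one_mul,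
      ← prod_mul_distrib]
    exact prod_congr rfl fun i hi => by simp [raise, hi, pow_succ']
  have h2 : ∏ i ∈ S, ∏ j ∈ S, (if raise T g j < raise T g i then ratio t (x i) (x j) else 1) =
      cross t x T (S \ T) * ∏ i ∈ T, ∏ j ∈ T, if g j < g i then ratio t (x i) (x j) else 1 := by
    rw [← prod_sdiff hT, prod_eq_one fun i hi => by simp [raise, (mem_sdiff.1 hi).2], one_mul, cross,
      ← prod_mul_distrib]
    refine prod_congr rfl fun i hi => ?_
    rw [← prod_sdiff hT]
    congr 1
    · exact prod_congr rfl fun j hj => by simp [raise, (mem_sdiff.1 hj).2, hi]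
    · exact prod_congr rfl fun j hj => by simp [raise, hj, hi]
  rw [h1, h2]
  ring

/-- Every exponent vector arises once from its support `T` by lowering the exponents there by one,
which lowers the degree by `#T`. -/
theorem levelSum_eq_sum_powerset (t : L) (x : ι → L) {h : ℕ → ℕ → L} (h0 : ∀ k, h k 0 = 1)
    (S : Finset ι) (d : ℕ) : levelSum t x h S d = ∑ T ∈ S.powerset,
      h 0 #(S \ T) * cross t x T (S \ T) * ((∏ i ∈ T, x i) *
        if #T ≤ d then levelSum t x (fun k => h (k + 1)) T (d - #T) else 0) := by
  have e : ∑ T ∈ S.powerset, h 0 #(S \ T) * cross t x T (S \ T) * ((∏ i ∈ T, x i) *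
        if #T ≤ d then levelSum t x (fun k => h (k + 1)) T (d - #T) else 0) =
      ∑ T ∈ S.powerset with #T ≤ d, ∑ g ∈ T.piAntidiag (d - #T),
        levelWeight h S (raise T g) * expTerm t x S (raise T g) := by
    rw [sum_filter]
    refine sum_congr rfl fun T hT => ?_
    split_ifs
    · rw [levelSum, mul_sum, mul_sum]
      refine sum_congr rfl fun g _ => ?_
      rw [levelWeight_raise h0 (mem_powerset.1 hT), expTerm_raise _ _ (mem_powerset.1 hT)]
      ring
    · ring
  rw [e, sum_sigma', levelSum]
  have hraise : ∀ f ∈ S.piAntidiag d, raise {i ∈ S | f i ≠ 0} (fun i => f i - 1) = f := by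
    intro f hf
    ext i
    rw [mem_piAntidiag] at hf
    have := hf.2 i
    simp only [raise, mem_filter]
    split_ifs with h
    · omega
    · by_contra h'
      exact h ⟨this (Ne.symm h'), Ne.symm h'⟩
  -- Truncated subtraction keeps `f i - 1` equal to `0` off the support, as membership in
  -- `piAntidiag` requires.
  refine sum_bij' (fun f _ => ⟨{i ∈ S | f i ≠ 0}, fun i => f i - 1⟩) (fun p _ => raise p.1 p.2)
    ?_ ?_ ?_ ?_ ?_
  · intro f hf
    have hf' := mem_piAntidiag.1 hf
    have hsum : ∑ i ∈ S with f i ≠ 0, (f i - 1) + #{i ∈ S | f i ≠ 0} = d := by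
      rw [card_eq_sum_ones, ← sum_add_distrib, ← hf'.1, ← sum_filter_ne_zero S]
      refine sum_congr rfl fun i hi => ?_
      have := (mem_filter.1 hi).2
      omega
    simp only [mem_sigma, mem_filter, mem_powerset, mem_piAntidiag]
    refine ⟨⟨filter_subset _ _, by omega⟩, ?_, fun i hi => ⟨hf'.2 i (by omega), by omega⟩⟩
    exact Nat.eq_sub_of_add_eq hsum
  · rintro ⟨T, g⟩ hp
    simp only [mem_sigma, mem_filter, mem_powerset, mem_piAntidiag] at hp ⊢
    obtain ⟨⟨hTS, hTd⟩, hg, _⟩ := hp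
    constructor
    · rw [← sum_subset hTS (fun i _ hi => by simp [raise, hi])]
      have : ∑ i ∈ T, raise T g i = ∑ i ∈ T, (g i + 1) :=
        sum_congr rfl fun i hi => by simp [raise, hi]
      rw [this, sum_add_distrib, ← card_eq_sum_ones, hg]
      omega
    · intro i hi
      by_contra h
      exact hi (if_neg fun h' => h (hTS h'))
  · exact hraise
  · rintro ⟨T, g⟩ hp
    simp only [mem_sigma, mem_filter, mem_powerset, mem_piAntidiag] at hp
    obtain ⟨⟨hTS, hTd⟩, _, hg⟩ := hp
    have e1 : ({i ∈ S | raise T g i ≠ 0} : Finset ι) = T := by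
      ext i
      rw [mem_filter, raise]
      constructor
      · rintro ⟨_, h⟩
        by_contra h'
        exact h (if_neg h')
      · intro h
        exact ⟨hTS h, by simp [h]⟩
    have e2 : (fun i => raise T g i - 1) = g := by
      ext i
      by_cases h : i ∈ T
      · simp [raise, h]
      · simp only [raise, h, if_false]
        by_contra h'
        exact h (hg i (by omega))
    simp only [e1, e2]
  · intro f hf
    simp only [hraise f hf]

open PowerSeries in
/-- The generating series of `levelSum`. -/
noncomputable def levelSeries (t : L) (x : ι → L) (h : ℕ → ℕ → L) (S : Finset ι) : L⟦X⟧ :=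
  PowerSeries.mk (levelSum t x h S)

open PowerSeries in
theorem levelSeries_eq (t : L) (x : ι → L) {h : ℕ → ℕ → L} (h0 : ∀ k, h k 0 = 1) (S : Finset ι) :
    levelSeries t x h S = ∑ T ∈ S.powerset, C (h 0 #(S \ T)) * C (cross t x T (S \ T)) *
      ((∏ i ∈ T, C (x i) * X) * levelSeries t x (fun k => h (k + 1)) T) := by
  ext d
  rw [levelSeries, coeff_mk, levelSum_eq_sum_powerset t x h0, map_sum]
  refine sum_congr rfl fun T _ => ?_
  rw [prod_mul_distrib, prod_const, ← map_prod, ← map_mul, mul_assoc (C _), coeff_C_mul, coeff_C_mul,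
    coeff_X_pow_mul', levelSeries]
  simp only [coeff_mk]

open PowerSeries in
theorem levelSeries_mul_pow (t : L) (x : ι → L) (h : ℕ → ℕ → L) (a : L) (S : Finset ι) :
    levelSeries t x (fun k m => h k m * a ^ m) S = (∏ _i ∈ S, C a) * levelSeries t x h S := by
  ext d
  rw [prod_const, ← map_pow, coeff_C_mul, levelSeries, levelSeries, coeff_mk, coeff_mk,
    levelSum_mul_pow]

theorem levelSeries_empty (t : L) (x : ι → L) (h : ℕ → ℕ → L) : levelSeries t x h ∅ = 1 := by
  ext d
  rw [levelSeries, PowerSeries.coeff_mk, PowerSeries.coeff_one, levelSum, piAntidiag_empty]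
  split_ifs <;> simp [levelWeight, expTerm]

/-- The weight of the part `k` with multiplicity `m`, up to powers of `t`. -/
def parityWeight (t : L) (k m : ℕ) : L :=
  if Even k then if Even m then oddProd t m else 0 else oddProd t m

/-- The weight of the part `k` with multiplicity `m`. -/
def evenWeight (t : L) (k m : ℕ) : L := parityWeight t k m * t⁻¹ ^ (m * ((k + 1) / 2))

/-- The weight of the part `k + 1` with multiplicity `m`, divided by the one for `k = 0`. -/
def oddWeight (t : L) (k m : ℕ) : L := parityWeight t (k + 1) m * t⁻¹ ^ (m * (k / 2))

/-- The weight of the part `k` with multiplicity `m`, where the part `0` has weight `1`. -/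
def partWeight (t : L) (k m : ℕ) : L := if k = 0 then 1 else evenWeight t k m

theorem parityWeight_zero (t : L) (k : ℕ) : parityWeight t k 0 = 1 := by
  simp [parityWeight, oddProd]

theorem evenWeight_zero (t : L) (k : ℕ) : evenWeight t k 0 = 1 := by
  simp [evenWeight, parityWeight_zero]

theorem oddWeight_zero (t : L) (k : ℕ) : oddWeight t k 0 = 1 := by
  simp [oddWeight, parityWeight_zero]

theorem partWeight_zero (t : L) (k : ℕ) : partWeight t k 0 = 1 := by
  simp [partWeight, evenWeight_zero]

/-- Together with `oddWeight_succ` this is the periodicity that closes the recursion: shifting the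
exponents twice returns to the same weights up to `t⁻¹` per variable. -/
theorem evenWeight_succ (t : L) :
    (fun k => evenWeight t (k + 1)) = fun k m => oddWeight t k m * t⁻¹ ^ m := by
  ext k m
  have : (k + 1 + 1) / 2 = k / 2 + 1 := by omega
  rw [evenWeight, oddWeight, this, mul_add, mul_one, pow_add, mul_assoc]

theorem oddWeight_succ (t : L) : (fun k => oddWeight t (k + 1)) = evenWeight t := by
  ext k m
  simp [evenWeight, oddWeight, parityWeight, Nat.even_add_one]

theorem partWeight_succ (t : L) :
    (fun k => partWeight t (k + 1)) = fun k m => oddWeight t k m * t⁻¹ ^ m := by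
  rw [← evenWeight_succ]
  rfl

-- Applies `conv_one_eq_prodSide` to the variables `x i * X`. The scaling does not change `ratio`,
-- and the grading supplies the genericity hypotheses.
open PowerSeries in
theorem map_levelSeries_partWeight {L' : Type*} [Field L'] (φ : L⟦X⟧ →+* L') (hφ : Function.Injective φ)
    {t : L} (ht0 : t ≠ 0) (ht : ∀ n : ℕ, 0 < n → qInt t n ≠ 0) {x : ι → L}
    (hx : Function.Injective x) (hx0 : ∀ i, x i ≠ 0) (S : Finset ι) :
    φ (levelSeries t x (partWeight t) S) = prodSide (φ (C t)) ((φ (C t))⁻¹ - 1) (- (φ (C t))⁻¹)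
      (fun i => φ (C (x i) * X)) S := by
  have hinv : (φ (C t))⁻¹ = φ (C t⁻¹) := by
    rw [inv_eq_iff_eq_inv, ← RingHom.comp_apply, ← RingHom.comp_apply, map_inv₀, inv_inv]
  have hXne : φ X ≠ 0 := (map_ne_zero_iff φ hφ).2 X_ne_zero
  have hratio : ∀ i j, ratio (φ (C t)) (φ (C (x i) * X)) (φ (C (x j) * X)) =
      φ (C (ratio t (x i) (x j))) := by
    intro i j
    have : φ (C (ratio t (x i) (x j))) = (φ.comp C) (ratio t (x i) (x j)) := rfl
    rw [this, ratio, ratio, map_div₀]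
    simp only [map_mul, map_sub, RingHom.comp_apply]
    rw [← mul_assoc, ← sub_mul, ← sub_mul, mul_div_mul_right _ _ hXne]
  have hcross : ∀ T U : Finset ι, cross (φ (C t)) (fun i => φ (C (x i) * X)) T U =
      φ (C (cross t x T U)) := by
    intro T U
    simp only [cross, hratio, map_prod]
  have hodd : ∀ m, φ (C (oddProd t m)) = oddProd (φ (C t)) m := by
    intro m
    simp [oddProd, map_prod]
  have hconv : ∀ (h : ℕ → ℕ → L), (∀ k, h k 0 = 1) → ∀ S, φ (levelSeries t x h S) =
      conv (φ (C t)) (fun i => φ (C (x i) * X)) (fun n => φ (C (h 0 n)))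
        (fun T => (∏ i ∈ T, φ (C (x i) * X)) * φ (levelSeries t x (fun k => h (k + 1)) T)) S := by
    intro h h0 S
    rw [levelSeries_eq t x h0, map_sum, conv]
    refine sum_congr rfl fun T _ => ?_
    rw [hcross]
    simp only [map_mul, map_prod]
  have hscale : ∀ T : Finset ι, (∏ i ∈ T, φ (C (x i) * X)) *
      φ (levelSeries t x (fun k m => oddWeight t k m * t⁻¹ ^ m) T) =
      (∏ i ∈ T, (φ (C t))⁻¹ * φ (C (x i) * X)) * φ (levelSeries t x (oddWeight t) T) := by
    intro T
    rw [levelSeries_mul_pow, map_mul, map_prod, prod_mul_distrib, hinv]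
    ring
  rw [hconv _ (partWeight_zero t), partWeight_succ]
  simp only [hscale]
  have h1 : (fun n => φ (C (partWeight t 0 n))) = fun _ => 1 := by
    ext n
    simp [partWeight]
  rw [h1]
  refine conv_one_eq_prodSide ((map_ne_zero_iff (φ.comp C) (φ.comp C).injective).2 ht0) ?_ ?_ ?_ ?_ ?_
    (fun T => φ (levelSeries t x (evenWeight t) T)) (fun T => φ (levelSeries t x (oddWeight t) T))
    ?_ ?_ ?_ S
  · intro n hn
    have : qInt ((φ.comp C) t) n = (φ.comp C) (qInt t n) := by simp [qInt, map_sum]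
    rw [this]
    exact (map_ne_zero_iff (φ.comp C) (φ.comp C).injective).2 (ht n hn)
  · intro i j h
    have h := mul_right_cancel₀ X_ne_zero (hφ h)
    exact hx (C_injective h)
  · intro i
    exact (map_ne_zero_iff φ hφ).2 (mul_ne_zero ((map_ne_zero_iff C C_injective).2 (hx0 i)) X_ne_zero)
  -- A product of two scaled variables has constant coefficient `0`, whereas `t ≠ 0`; the next
  -- condition follows in the same way with `1` in place of `t`.
  · intro i j h
    rw [← map_mul] at h
    have h := congrArg constantCoeff (hφ h)
    simp at h
    exact ht0 h.symm
  · intro T hT h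
    rw [RingHom.comp_apply, hinv] at h
    simp only [← map_mul, ← map_prod] at h
    rw [← map_one φ] at h
    have h := congrArg constantCoeff (hφ h)
    obtain ⟨i, hi⟩ := hT
    rw [map_mul, map_prod, prod_eq_zero hi (by simp), zero_mul, map_one] at h
    exact zero_ne_one h
  · rw [levelSeries_empty, map_one]
  · intro T
    rw [hconv _ (evenWeight_zero t), evenWeight_succ]
    simp only [hscale]
    refine conv_congr_left fun n => ?_
    by_cases hn : Even n <;> simp [evenWeight, parityWeight, hn, hodd]
  · intro T
    rw [hconv _ (oddWeight_zero t), oddWeight_succ]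
    refine conv_congr_left fun n => ?_
    simp [oddWeight, parityWeight, hodd]

end LevelSum

end HallLittlewood

namespace HallLittlewood
open Finset

/-! ### The symmetrization as a sum over exponent vectors of fixed type. -/

section Types
variable {ι L : Type*} [Field L]

theorem expTerm_congr (t : L) (x : ι → L) {S : Finset ι} {f g : ι → ℕ} (h : ∀ i ∈ S, f i = g i) :
    expTerm t x S f = expTerm t x S g := by
  unfold expTerm
  congr 1
  · exact prod_congr rfl fun i hi => by rw [h i hi]
  · exact prod_congr rfl fun i hi => prod_congr rfl fun j hj => by rw [h i hi, h j hj]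

variable [LinearOrder ι]

/-- The exponents on `S` whose multiset of values is `s`. -/
def typeSet (S : Finset ι) (s : Multiset ℕ) : Finset (ι → ℕ) :=
  {f ∈ S.piAntidiag s.sum | S.val.map f = s}

theorem mem_typeSet {S : Finset ι} {s : Multiset ℕ} {f : ι → ℕ} :
    f ∈ typeSet S s ↔ S.val.map f = s ∧ ∀ i, f i ≠ 0 → i ∈ S := by
  rw [typeSet, mem_filter, mem_piAntidiag]
  constructor
  · exact fun h => ⟨h.2, h.1.2⟩
  · exact fun h => ⟨⟨congrArg Multiset.sum h.1, h.2⟩, h.1⟩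

/-- A variable of maximal exponent is compared in `expTerm` only with strictly smaller exponents;
the factors for ties on the left complete this to a product over all of `S`. -/
theorem expTerm_insert_max (t : L) (x : ι → L) {S : Finset ι} {a : ι} (ha : a ∉ S) (f : ι → ℕ)
    (hf : ∀ i ∈ S, f i ≤ f a) :
    (∏ b ∈ S with f b = f a, ratio t (x a) (x b)) * expTerm t x (insert a S) f =
      x a ^ f a * (∏ b ∈ S, ratio t (x a) (x b)) * expTerm t x S f := by
  unfold expTerm
  have h1 : ∏ b ∈ S, ratio t (x a) (x b) = (∏ b ∈ S with f b = f a, ratio t (x a) (x b)) *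
      ∏ b ∈ S, if f b < f a then ratio t (x a) (x b) else 1 := by
    rw [prod_filter, ← prod_mul_distrib]
    refine prod_congr rfl fun b hb => ?_
    rcases (hf b hb).eq_or_lt with h | h
    · simp [h]
    · simp [h, h.ne]
  have h2 : ∏ i ∈ S, ∏ j ∈ insert a S, (if f j < f i then ratio t (x i) (x j) else 1) =
      ∏ i ∈ S, ∏ j ∈ S, if f j < f i then ratio t (x i) (x j) else 1 := by
    refine prod_congr rfl fun i hi => ?_
    rw [prod_insert ha, if_neg (not_lt.2 (hf i hi)), one_mul]
  rw [prod_insert ha, prod_insert ha, prod_insert ha, h2, if_neg (lt_irrefl _), h1]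
  ring

/-- For fixed exponents, the sum over the choice of `a` in the top level set is `sum_prod_ratio` for
that set, hence the `t`-integer of the new multiplicity. -/
theorem sum_typeSet_cons (t : L) {x : ι → L} (hx : Function.Injective x) (hx0 : ∀ i, x i ≠ 0)
    (S : Finset ι) (m : ℕ) (s : Multiset ℕ) (hm : ∀ k ∈ s, k ≤ m) :
    ∑ a ∈ S, x a ^ m * (∏ b ∈ S.erase a, ratio t (x a) (x b)) *
        ∑ f ∈ typeSet (S.erase a) s, expTerm t x (S.erase a) f =
      qInt t (s.count m + 1) * ∑ f ∈ typeSet S (m ::ₘ s), expTerm t x S f := by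
  have h1 : ∀ f ∈ typeSet S (m ::ₘ s), qInt t (s.count m + 1) * expTerm t x S f =
      ∑ a ∈ S with f a = m, (∏ b ∈ S.erase a with f b = f a, ratio t (x a) (x b)) *
        expTerm t x S f := by
    intro f hf
    have hc : s.count m + 1 = #{i ∈ S | f i = m} := by
      rw [← Multiset.count_cons_self, ← (mem_typeSet.1 hf).1, Multiset.count_map]
      simp only [eq_comm (a := m)]
      rfl
    rw [hc, ← sum_prod_ratio t hx hx0, sum_mul]
    refine sum_congr rfl fun a ha => ?_
    rw [(mem_filter.1 ha).2, ← filter_erase]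
  rw [mul_sum, sum_congr rfl h1]
  simp only [mul_sum]
  rw [sum_sigma', sum_sigma']
  refine sum_bij' (fun p _ => ⟨Function.update p.2 p.1 m, p.1⟩)
    (fun p _ => ⟨p.2, Function.update p.1 p.2 0⟩) ?_ ?_ ?_ ?_ ?_
  · rintro ⟨a, f⟩ h
    simp only [mem_sigma, mem_typeSet, mem_filter] at h ⊢
    refine ⟨⟨?_, fun i hi => ?_⟩, h.1, by simp⟩
    · rw [← insert_erase h.1, insert_val_of_notMem (notMem_erase a S), Multiset.map_cons,
        Function.update_self]
      congr 1
      rw [← h.2.1]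
      refine Multiset.map_congr rfl fun i hi => ?_
      rw [Function.update_of_ne (ne_of_mem_erase hi)]
    · by_cases hia : i = a
      · exact hia ▸ h.1
      · rw [Function.update_of_ne hia] at hi
        exact mem_of_mem_erase (h.2.2 i hi)
  · rintro ⟨f, a⟩ h
    simp only [mem_sigma, mem_typeSet, mem_filter] at h ⊢
    obtain ⟨⟨hf, hf'⟩, ha, hfa⟩ := h
    refine ⟨ha, ?_, fun i hi => ?_⟩
    · rw [← insert_erase ha, insert_val_of_notMem (notMem_erase a S), Multiset.map_cons, hfa,
        Multiset.cons_inj_right] at hf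
      rw [← hf]
      refine Multiset.map_congr rfl fun i hi => ?_
      rw [Function.update_of_ne (ne_of_mem_erase hi)]
    · by_cases hia : i = a
      · rw [hia, Function.update_self] at hi
        exact absurd rfl hi
      · rw [Function.update_of_ne hia] at hi
        exact mem_erase.2 ⟨hia, hf' i hi⟩
  · rintro ⟨a, f⟩ h
    simp only [mem_sigma, mem_typeSet] at h
    have : f a = 0 := by
      by_contra h'
      exact notMem_erase a S (h.2.2 a h')
    simp [← this]
  · rintro ⟨f, a⟩ h
    simp only [mem_sigma, mem_filter] at h
    simp [← h.2.2]
  · rintro ⟨a, f⟩ h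
    simp only [mem_sigma, mem_typeSet] at h
    obtain ⟨S, ha, rfl⟩ : ∃ S', a ∉ S' ∧ S = insert a S' :=
      ⟨S.erase a, by simp, (insert_erase h.1).symm⟩
    have hu : ∀ i ∈ S, Function.update f a m i = f i := fun i hi =>
      Function.update_of_ne (by rintro rfl; exact ha hi) _ _
    simp only [erase_insert ha] at h ⊢
    rw [expTerm_insert_max t x ha, Function.update_self, expTerm_congr t x hu]
    intro i hi
    rw [hu i hi, Function.update_self]
    exact hm _ (h.2.1 ▸ Multiset.mem_map_of_mem f hi)

/-- The product of the `t`-factorials of the multiplicities of a multiset. -/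
def qFactorials (t : L) (s : Multiset ℕ) : L :=
  ∏ k ∈ s.toFinset, ∏ j ∈ Icc 1 (s.count k), qInt t j

theorem qFactorials_cons (t : L) (m : ℕ) (s : Multiset ℕ) :
    qFactorials t (m ::ₘ s) = qInt t (s.count m + 1) * qFactorials t s := by
  have h : ∀ u : Multiset ℕ, u ≤ m ::ₘ s → qFactorials t u =
      ∏ k ∈ (m ::ₘ s).toFinset, ∏ j ∈ Icc 1 (u.count k), qInt t j := by
    intro u hu
    refine prod_subset (Multiset.toFinset_subset.2 (Multiset.subset_of_le hu)) fun k _ hk => ?_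
    rw [Multiset.count_eq_zero_of_notMem fun h => hk (Multiset.mem_toFinset.2 h)]
    simp
  have hm : m ∈ (m ::ₘ s).toFinset := by simp
  rw [h _ le_rfl, h s (Multiset.le_cons_self s m), ← mul_prod_erase _ _ hm, ← mul_prod_erase _ _ hm,
    Multiset.count_cons_self, prod_Icc_succ_top (Nat.le_add_left 1 _)]
  have h2 : ∏ k ∈ (m ::ₘ s).toFinset.erase m, ∏ j ∈ Icc 1 ((m ::ₘ s).count k), qInt t j =
      ∏ k ∈ (m ::ₘ s).toFinset.erase m, ∏ j ∈ Icc 1 (s.count k), qInt t j :=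
    prod_congr rfl fun k hk => by rw [Multiset.count_cons_of_ne (ne_of_mem_erase hk)]
  rw [h2]
  ring

theorem qFactorials_ne_zero {t : L} (ht : ∀ n : ℕ, 0 < n → qInt t n ≠ 0) (s : Multiset ℕ) :
    qFactorials t s ≠ 0 :=
  prod_ne_zero_iff.2 fun _ _ => prod_ne_zero_iff.2 fun j hj => ht j (mem_Icc.1 hj).1

/-- Induction on `n`, choosing first the variable that receives the largest part; each step
contributes one `t`-integer, and these multiply to the `t`-factorials. -/
theorem sum_perm_eq (t : L) {x : ι → L} (hx : Function.Injective x) (hx0 : ∀ i, x i ≠ 0) (n : ℕ)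
    (μ : Fin n → ℕ) (hμ : Antitone μ) (y : Fin n ↪ ι) :
    ∑ w : Equiv.Perm (Fin n), (∏ i, x (y (w i)) ^ μ i) *
        ∏ i, ∏ j ∈ Ioi i, ratio t (x (y (w i))) (x (y (w j))) =
      qFactorials t (univ.val.map μ) *
        ∑ f ∈ typeSet (univ.map y) (univ.val.map μ), expTerm t x (univ.map y) f := by
  induction n with
  | zero =>
    have h : typeSet (univ.map y) (univ.val.map μ) = {fun _ => 0} := by
      ext f
      rw [mem_typeSet]
      simp [funext_iff]
    rw [h]
    simp [qFactorials, expTerm]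
  | succ n ih =>
    -- An enumeration of the variables other than `y p`, in the order used by
    -- `Equiv.Perm.decomposeFin`.
    let y' : Fin (n + 1) → (Fin n ↪ ι) := fun p =>
      ((Fin.succEmb n).trans (Equiv.swap 0 p).toEmbedding).trans y
    have hy' : ∀ p, univ.map (y' p) = (univ.map y).erase (y p) := by
      intro p
      ext a
      simp only [y', mem_map, mem_univ, true_and, mem_erase, Function.Embedding.trans_apply,
        Equiv.coe_toEmbedding, Fin.coe_succEmb]
      constructor
      · rintro ⟨i, rfl⟩
        refine ⟨fun h => ?_, _, rfl⟩
        have := (Equiv.swap_apply_eq_iff.1 (y.injective h))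
        rw [Equiv.swap_apply_right] at this
        exact Fin.succ_ne_zero _ this
      · rintro ⟨ha, i, rfl⟩
        have h0 : Equiv.swap 0 p i ≠ 0 := by
          intro h
          rw [Equiv.swap_apply_eq_iff, Equiv.swap_apply_left] at h
          exact ha (h ▸ rfl)
        obtain ⟨j, hj⟩ := Fin.exists_succ_eq.2 h0
        exact ⟨j, by rw [hj, Equiv.swap_apply_self]⟩
    have hmul : (univ : Finset (Fin (n + 1))).val.map μ =
        μ 0 ::ₘ (univ : Finset (Fin n)).val.map (fun i => μ i.succ) := by
      rw [Fin.univ_succ]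
      simp [Function.comp_def]
    have hμ' : Antitone fun i : Fin n => μ i.succ := fun i j h => hμ (Fin.succ_le_succ_iff.2 h)
    rw [← (Equiv.Perm.decomposeFin.symm).sum_comp, Fintype.sum_prod_type, hmul, qFactorials_cons,
      mul_comm (qInt t _), mul_assoc, ← sum_typeSet_cons t hx hx0, sum_map, mul_sum]
    · refine sum_congr rfl fun p _ => ?_
      rw [← hy', mul_left_comm, ← ih _ hμ' (y' p), mul_sum]
      refine sum_congr rfl fun e _ => ?_
      rw [Fin.prod_univ_succ, Fin.prod_univ_succ, Fin.prod_Ioi_zero]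
      simp only [Fin.prod_Ioi_succ, Equiv.Perm.decomposeFin_symm_apply_zero,
        Equiv.Perm.decomposeFin_symm_apply_succ]
      rw [prod_map, ← Equiv.prod_comp e fun i => ratio t (x (y p)) (x (y' p i))]
      simp only [y', Function.Embedding.trans_apply, Equiv.coe_toEmbedding, Fin.coe_succEmb]
      ring
    · intro k hk
      obtain ⟨i, _, rfl⟩ := Multiset.mem_map.1 hk
      exact hμ (Fin.zero_le _)

end Types

/-! ### Young diagrams and their multisets of parts. -/

/-- The parts of `μ`, written with `n` parts. -/
def parts (n : ℕ) (μ : YoungDiagram) : Multiset ℕ := (range n).val.map μ.rowLen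

theorem map_univ_rowLen (n : ℕ) (μ : YoungDiagram) :
    (univ : Finset (Fin n)).val.map (fun i : Fin n => μ.rowLen i) = parts n μ := by
  rw [parts, ← Nat.Iio_eq_range, ← Fin.map_valEmbedding_univ, map_val, Multiset.map_map]
  rfl

theorem count_parts (n : ℕ) (μ : YoungDiagram) (k : ℕ) : (parts n μ).count k = mult n μ k := by
  rw [parts, Multiset.count_map, mult]
  simp only [eq_comm (a := k)]
  rfl

theorem vFactor_eq_qFactorials {K : Type*} [Field K] (t : K) (n : ℕ) (μ : YoungDiagram) :
    vFactor t n μ = qFactorials t (parts n μ) := by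
  unfold vFactor qFactorials
  simp only [count_parts]
  refine (prod_subset (fun k hk => ?_) fun k _ hk => ?_).symm
  · obtain ⟨i, _, rfl⟩ := Multiset.mem_map.1 (Multiset.mem_toFinset.1 hk)
    exact mem_range.2 (Nat.lt_succ_of_le (μ.rowLen_anti _ _ (Nat.zero_le _)))
  · rw [← count_parts, Multiset.count_eq_zero_of_notMem fun h => hk (Multiset.mem_toFinset.2 h)]
    simp

theorem symmetrization_eq_sum {L : Type*} [Field L] {t : L} (ht : ∀ n : ℕ, 0 < n → qInt t n ≠ 0)
    (n : ℕ) (μ : YoungDiagram) {x : Fin n → L} (hx : Function.Injective x) (hx0 : ∀ i, x i ≠ 0) :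
    symmetrization t n μ x = ∑ f ∈ typeSet univ (parts n μ), expTerm t x univ f := by
  have h := sum_perm_eq t hx hx0 n (fun i => μ.rowLen i)
    (fun i j hij => μ.rowLen_anti _ _ hij) (Function.Embedding.refl _)
  rw [map_refl, map_univ_rowLen] at h
  rw [symmetrization, vFactor_eq_qFactorials, inv_mul_eq_iff_eq_mul₀ (qFactorials_ne_zero ht _), ← h]
  rfl

end HallLittlewood

namespace HallLittlewood
open Finset

/-! ### Multiplicities, arms, legs and the weight of a partition. -/

section Diagrams

theorem parts_injective {n : ℕ} {μ ν : YoungDiagram} (hμ : μ.colLen 0 ≤ n) (hν : ν.colLen 0 ≤ n)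
    (h : parts n μ = parts n ν) : μ = ν := by
  have hs : ∀ ρ : YoungDiagram, ((List.range n).map ρ.rowLen).SortedGE := fun ρ =>
    (List.pairwise_map.2 (List.pairwise_lt_range.imp fun {a b} h => ρ.rowLen_anti a b h.le)).sortedGE
  have hl : (List.range n).map μ.rowLen = (List.range n).map ν.rowLen :=
    (Multiset.coe_eq_coe.1 h).eq_of_sortedGE (hs μ) (hs ν)
  have hr : ∀ i, μ.rowLen i = ν.rowLen i := by
    intro i
    rcases lt_or_ge i n with hi | hi
    · exact List.map_inj_left.1 hl i (List.mem_range.2 hi)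
    · rw [(rowLen_eq_zero_iff μ i).2 (hμ.trans hi), (rowLen_eq_zero_iff ν i).2 (hν.trans hi)]
  ext ⟨i, j⟩
  rw [YoungDiagram.mem_cells, YoungDiagram.mem_cells, YoungDiagram.mem_iff_lt_rowLen,
    YoungDiagram.mem_iff_lt_rowLen, hr]

theorem exists_parts_eq {n : ℕ} (s : Multiset ℕ) (hs : s.card = n) :
    ∃ μ : YoungDiagram, μ.colLen 0 ≤ n ∧ parts n μ = s := by
  have hw : (s.sort (· ≥ ·)).SortedGE := (s.pairwise_sort (· ≥ ·)).sortedGE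
  have hlen : (s.sort (· ≥ ·)).length = n := by rw [Multiset.length_sort, hs]
  refine ⟨YoungDiagram.ofRowLens _ hw, ?_, ?_⟩
  · rw [← rowLen_eq_zero_iff]
    by_contra h
    have h' := YoungDiagram.mem_iff_lt_rowLen.2 (Nat.pos_of_ne_zero h)
    obtain ⟨h1, _⟩ := YoungDiagram.mem_ofRowLens.1 h'
    exact absurd h1 (by simp [hlen])
  · conv_rhs => rw [← s.sort_eq (· ≥ ·)]
    rw [← map_univ_rowLen]
    subst hlen
    simp only [YoungDiagram.rowLen_ofRowLens]
    rw [Fin.univ_val_map]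
    exact congrArg _ List.ofFn_getElem

theorem card_eq_sum_rowLen (μ : YoungDiagram) :
    μ.card = ∑ i ∈ range (μ.colLen 0), μ.rowLen i := by
  have hmaps : Set.MapsTo Prod.fst (μ.cells : Set (ℕ × ℕ)) (range (μ.colLen 0)) := by
    intro s hs
    have h1 : (s.1, s.2) ∈ μ := hs
    exact mem_coe.2 (mem_range.2 (YoungDiagram.mem_iff_lt_colLen.1
      (μ.up_left_mem le_rfl (Nat.zero_le _) h1)))
  refine (card_eq_sum_card_fiberwise hmaps).trans (sum_congr rfl fun i _ => ?_)
  rw [YoungDiagram.rowLen_eq_card]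
  rfl

theorem sum_parts_eq {n : ℕ} {μ : YoungDiagram} (hμ : μ.colLen 0 ≤ n) (g : ℕ → ℕ) (hg : g 0 = 0) :
    ((parts n μ).map g).sum = ∑ i ∈ range (μ.colLen 0), g (μ.rowLen i) := by
  rw [parts, Multiset.map_map]
  refine (sum_subset (range_subset_range.2 hμ) fun i _ hi => ?_).symm
  rw [Function.comp_apply, (rowLen_eq_zero_iff μ i).2 (by simpa using hi), hg]

theorem sum_parts {n : ℕ} {μ : YoungDiagram} (hμ : μ.colLen 0 ≤ n) :
    (parts n μ).sum = μ.card := by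
  rw [card_eq_sum_rowLen, ← Multiset.map_id (parts n μ)]
  exact sum_parts_eq hμ id rfl

/-- A part `k` contributes `k`, plus `1` if it is odd, to `o(μ) + |μ|`; this is twice `(k + 1) / 2`
with truncated division. -/
theorem oddParts_add_card_div_two {n : ℕ} {μ : YoungDiagram} (hμ : μ.colLen 0 ≤ n) :
    (oddParts μ + μ.card) / 2 =
      ∑ k ∈ (parts n μ).toFinset, (parts n μ).count k * ((k + 1) / 2) := by
  have h := sum_parts_eq hμ (fun k => (k + 1) / 2) rfl
  rw [sum_multiset_map_count] at h
  simp only [smul_eq_mul] at h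
  have h2 : oddParts μ + μ.card = 2 * ∑ i ∈ range (μ.colLen 0), (μ.rowLen i + 1) / 2 := by
    rw [card_eq_sum_rowLen, oddParts, card_filter, ← sum_add_distrib, mul_sum]
    refine sum_congr rfl fun i _ => ?_
    split_ifs with ho
    · obtain ⟨a, ha⟩ := ho
      omega
    · obtain ⟨a, ha⟩ := Nat.not_odd_iff_even.1 ho
      omega
  rw [h, h2]
  omega

theorem mult_eq_of_colLen_le {n : ℕ} {μ : YoungDiagram} (hμ : μ.colLen 0 ≤ n) {k : ℕ} (hk : k ≠ 0) :
    mult n μ k = mult (μ.colLen 0) μ k := by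
  induction n, hμ using Nat.le_induction with
  | base => rfl
  | succ n hn ih => rw [mult_succ n μ hn k hk, ih]

theorem evenPartsEvenMult_iff {n : ℕ} {μ : YoungDiagram} (hμ : μ.colLen 0 ≤ n) :
    EvenPartsEvenMult μ ↔ ∀ k, k ≠ 0 → Even k → Even (mult n μ k) := by
  have h : ∀ k, μ.rowLens.count k = mult (μ.colLen 0) μ k := fun k =>
    (Multiset.coe_count k _).symm.trans (count_parts _ μ k)
  unfold EvenPartsEvenMult
  constructor
  · intro H k hk hk'
    rw [mult_eq_of_colLen_le hμ hk, ← h]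
    exact H k hk'
  · intro H k hk'
    by_cases hk : k = 0
    · subst hk
      rw [List.count_eq_zero_of_not_mem fun h0 => absurd (μ.pos_of_mem_rowLens 0 h0) (lt_irrefl 0)]
      exact Even.zero
    · rw [h, ← mult_eq_of_colLen_le hμ hk]
      exact H k hk hk'

theorem leg_eq (μ : YoungDiagram) (s : ℕ × ℕ) : leg μ s = μ.colLen s.2 - (s.1 + 1) := by
  have : μ.cells.filter (fun u => u.2 = s.2 ∧ s.1 < u.1) =
      Ico (s.1 + 1) (μ.colLen s.2) ×ˢ {s.2} := by
    ext ⟨i, j⟩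
    simp only [mem_filter, YoungDiagram.mem_cells, YoungDiagram.mem_iff_lt_colLen, mem_product,
      mem_Ico, mem_singleton]
    constructor
    · rintro ⟨h, rfl, h'⟩
      exact ⟨⟨h', h⟩, rfl⟩
    · rintro ⟨⟨h', h⟩, rfl⟩
      exact ⟨h, rfl, h'⟩
  rw [leg, this, card_product, Nat.card_Ico, card_singleton, mul_one]

theorem arm_eq (μ : YoungDiagram) (s : ℕ × ℕ) : arm μ s = μ.rowLen s.1 - (s.2 + 1) := by
  have : μ.cells.filter (fun u => u.1 = s.1 ∧ s.2 < u.2) =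
      {s.1} ×ˢ Ico (s.2 + 1) (μ.rowLen s.1) := by
    ext ⟨i, j⟩
    simp only [mem_filter, YoungDiagram.mem_cells, YoungDiagram.mem_iff_lt_rowLen, mem_product,
      mem_Ico, mem_singleton]
    constructor
    · rintro ⟨h, rfl, h'⟩
      exact ⟨rfl, h', h⟩
    · rintro ⟨rfl, h', h⟩
      exact ⟨h, rfl, h'⟩
  rw [arm, this, card_product, Nat.card_Ico, card_singleton, one_mul]

theorem rowLen_eq_succ_iff (μ : YoungDiagram) (i k : ℕ) :
    μ.rowLen i = k + 1 ↔ μ.colLen (k + 1) ≤ i ∧ i < μ.colLen k := by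
  rw [← YoungDiagram.mem_iff_lt_colLen, ← not_lt, ← YoungDiagram.mem_iff_lt_colLen,
    YoungDiagram.mem_iff_lt_rowLen, YoungDiagram.mem_iff_lt_rowLen]
  omega

theorem mult_succ_eq {n : ℕ} {μ : YoungDiagram} (hμ : μ.colLen 0 ≤ n) (k : ℕ) :
    mult n μ (k + 1) = μ.colLen k - μ.colLen (k + 1) := by
  have : (range n).filter (fun i => μ.rowLen i = k + 1) = Ico (μ.colLen (k + 1)) (μ.colLen k) := by
    ext i
    rw [mem_filter, mem_Ico, rowLen_eq_succ_iff, mem_range]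
    have := μ.colLen_anti 0 k (Nat.zero_le k)
    omega
  rw [mult, this, Nat.card_Ico]

/-- The cells of arm `0` are the row ends; those of the rows of length `k` lie in one column and
have legs `0, …, m_k - 1`. -/
theorem cCoeff_eq {K : Type*} [Field K] (t : K) {n : ℕ} {μ : YoungDiagram} (hμ : μ.colLen 0 ≤ n) :
    cCoeff t μ = ∏ k ∈ (parts n μ).toFinset.erase 0, oddProd t (mult n μ k) := by
  unfold oddProd cCoeff
  rw [prod_sigma']
  have hanti := fun k => μ.colLen_anti k (k + 1) (Nat.le_succ k)
  -- A row end is encoded by its row length and its leg; the row is recovered by counting upwards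
  -- from the bottom of its column.
  refine prod_bij' (fun s _ => ⟨s.2 + 1, leg μ s⟩) (fun p _ => (μ.colLen (p.1 - 1) - 1 - p.2, p.1 - 1))
    ?_ ?_ ?_ ?_ ?_
  · rintro ⟨i, j⟩ h
    simp only [mem_filter, YoungDiagram.mem_cells, arm_eq, leg_eq] at h
    obtain ⟨h1, h2, h3⟩ := h
    have h4 := YoungDiagram.mem_iff_lt_rowLen.1 h1
    have h5 := YoungDiagram.mem_iff_lt_colLen.1 h1
    have h6 : μ.rowLen i = j + 1 := by omega
    have h7 := (rowLen_eq_succ_iff μ i j).1 h6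
    have h8 := μ.colLen_anti 0 j (Nat.zero_le j)
    simp only [mem_sigma, mem_erase, mem_filter, mem_range, leg_eq, mult_succ_eq hμ,
      Multiset.mem_toFinset]
    refine ⟨⟨Nat.succ_ne_zero j, ?_⟩, by omega, h3⟩
    exact Multiset.mem_map.2 ⟨i, mem_range.2 (by omega), h6⟩
  · rintro ⟨k, m⟩ h
    simp only [mem_sigma, mem_erase, mem_filter, mem_range] at h
    obtain ⟨⟨hk, _⟩, hm, hme⟩ := h
    obtain ⟨k, rfl⟩ := Nat.exists_eq_succ_of_ne_zero hk
    rw [Nat.succ_eq_add_one, mult_succ_eq hμ] at hm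
    have h6 := (rowLen_eq_succ_iff μ (μ.colLen k - 1 - m) k).2 (by omega)
    simp only [Nat.succ_eq_add_one, Nat.add_sub_cancel, mem_filter, YoungDiagram.mem_cells, arm_eq,
      leg_eq, h6, Nat.sub_self, true_and, YoungDiagram.mem_iff_lt_rowLen]
    refine ⟨Nat.lt_succ_self k, ?_⟩
    convert hme using 1
    omega
  · rintro ⟨i, j⟩ h
    simp only [mem_filter, YoungDiagram.mem_cells] at h
    have h5 := YoungDiagram.mem_iff_lt_colLen.1 h.1
    simp only [leg_eq, Nat.add_sub_cancel, Prod.mk.injEq, and_true]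
    omega
  · rintro ⟨k, m⟩ h
    simp only [mem_sigma, mem_erase, mem_filter, mem_range] at h
    obtain ⟨⟨hk, _⟩, hm, hme⟩ := h
    obtain ⟨k, rfl⟩ := Nat.exists_eq_succ_of_ne_zero hk
    rw [Nat.succ_eq_add_one, mult_succ_eq hμ] at hm
    simp only [leg_eq, Nat.succ_eq_add_one, Nat.add_sub_cancel, Sigma.mk.injEq, heq_eq_eq, true_and]
    omega
  · rintro ⟨i, j⟩ h
    rfl

/-- The weight of a partition is the product of the weights of its parts. -/
theorem prod_partWeight {K : Type*} [Field K] (t : K) {n : ℕ} {μ : YoungDiagram}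
    (hμ : μ.colLen 0 ≤ n) [Decidable (EvenPartsEvenMult μ)] :
    ∏ k ∈ (parts n μ).toFinset, partWeight t k ((parts n μ).count k) =
      if EvenPartsEvenMult μ then cCoeff t μ / t ^ ((oddParts μ + μ.card) / 2) else 0 := by
  have h1 : ∀ k, partWeight t k ((parts n μ).count k) =
      (if k = 0 then 1 else parityWeight t k ((parts n μ).count k)) *
        t⁻¹ ^ ((parts n μ).count k * ((k + 1) / 2)) := by
    intro k
    by_cases hk : k = 0
    · simp [partWeight, hk]
    · simp [partWeight, hk, evenWeight]
  have h2 : ∏ k ∈ (parts n μ).toFinset, (if k = 0 then 1 else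
      parityWeight t k ((parts n μ).count k)) =
      ∏ k ∈ (parts n μ).toFinset.erase 0, parityWeight t k (mult n μ k) := by
    rw [prod_ite, prod_const_one, one_mul, filter_ne']
    exact prod_congr rfl fun k _ => by rw [count_parts]
  rw [prod_congr rfl fun k _ => h1 k, prod_mul_distrib, prod_pow_eq_pow_sum,
    ← oddParts_add_card_div_two hμ, h2]
  split_ifs with h
  · rw [cCoeff_eq t hμ, inv_pow, div_eq_mul_inv]
    congr 1
    refine prod_congr rfl fun k hk => ?_
    rw [parityWeight]
    split_ifs with hk' hm
    · rfl
    · exact absurd ((evenPartsEvenMult_iff hμ).1 h k (ne_of_mem_erase hk) hk') hm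
    · rfl
  · rw [evenPartsEvenMult_iff hμ] at h
    push Not at h
    obtain ⟨k, hk0, hk, hm⟩ := h
    have hmem : k ∈ (parts n μ).toFinset.erase 0 := by
      refine mem_erase.2 ⟨hk0, Multiset.mem_toFinset.2 (Multiset.count_ne_zero.1 fun h0 => ?_)⟩
      rw [count_parts] at h0
      rw [h0] at hm
      exact hm Even.zero
    rw [prod_eq_zero hmem, zero_mul]
    simp [parityWeight, hk, hm]

end Diagrams

end HallLittlewood

namespace HallLittlewood
open Finset

/-! ### Grading power series by an auxiliary variable. -/

section Split
variable {σ K : Type*} [CommRing K]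

/-- The power series with given coefficients. -/
def ofCoeff (g : (σ →₀ ℕ) → K) : MvPowerSeries σ K := g

@[simp] theorem coeff_ofCoeff (g : (σ →₀ ℕ) → K) (m : σ →₀ ℕ) :
    MvPowerSeries.coeff m (ofCoeff g) = g m := rfl

open MvPowerSeries in
/-- The decomposition of a power series into its homogeneous components, as a power series in a
further variable. -/
noncomputable def split : MvPowerSeries σ K →+* PowerSeries (MvPowerSeries σ K) where
  toFun p := PowerSeries.mk fun d => ofCoeff fun m => if m.degree = d then coeff m p else 0
  map_zero' := by
    ext d m
    simp [PowerSeries.coeff_mk]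
  map_one' := by
    classical
    ext d m
    rw [PowerSeries.coeff_mk, PowerSeries.coeff_one, coeff_ofCoeff, coeff_one]
    by_cases hm : m = 0
    · subst hm
      by_cases hd : d = 0
      · simp [hd]
      · simp [hd, Ne.symm hd]
    · split_ifs <;> simp [coeff_one, hm]
  map_add' p q := by
    ext d m
    rw [map_add, map_add, PowerSeries.coeff_mk, PowerSeries.coeff_mk, PowerSeries.coeff_mk,
      coeff_ofCoeff, coeff_ofCoeff, coeff_ofCoeff]
    split_ifs <;> simp
  map_mul' p q := by
    classical
    ext d m
    rw [PowerSeries.coeff_mul, map_sum, PowerSeries.coeff_mk, coeff_ofCoeff]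
    simp only [PowerSeries.coeff_mk, coeff_mul, coeff_ofCoeff]
    rw [sum_comm]
    -- For fixed exponents `a` only the pair of their degrees contributes, and it lies in the
    -- antidiagonal of `d` exactly when `m` has degree `d`.
    have h : ∀ a ∈ antidiagonal m, ∑ b ∈ antidiagonal d,
        (if a.1.degree = b.1 then coeff a.1 p else 0) *
          (if a.2.degree = b.2 then coeff a.2 q else 0) =
        if m.degree = d then coeff a.1 p * coeff a.2 q else 0 := by
      intro a ha
      rw [← mem_antidiagonal.1 ha, map_add]
      split_ifs with h
      · rw [sum_eq_single (a.1.degree, a.2.degree)]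
        · simp
        · rintro ⟨i, j⟩ _ hb
          by_cases h1 : a.1.degree = i
          · have h2 : a.2.degree ≠ j := fun h2 => hb (by rw [h1, h2])
            simp [h2]
          · simp [h1]
        · intro h'
          exact absurd (mem_antidiagonal.2 h) h'
      · refine sum_eq_zero fun b hb => ?_
        by_cases h1 : a.1.degree = b.1
        · have h2 : a.2.degree ≠ b.2 := fun h2 => h (by rw [h1, h2]; exact mem_antidiagonal.1 hb)
          simp [h2]
        · simp [h1]
    rw [sum_congr rfl h]
    split_ifs <;> simp

open MvPowerSeries

theorem coeff_coeff_split (p : MvPowerSeries σ K) (d : ℕ) (m : σ →₀ ℕ) :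
    coeff m (PowerSeries.coeff d (split p)) = if m.degree = d then coeff m p else 0 := by
  change coeff m (PowerSeries.coeff d (PowerSeries.mk fun d => ofCoeff fun m =>
    if m.degree = d then coeff m p else 0)) = _
  rw [PowerSeries.coeff_mk, coeff_ofCoeff]

theorem split_C (a : K) : split (C a : MvPowerSeries σ K) = PowerSeries.C (C a) := by
  classical
  ext d m
  rw [coeff_coeff_split, PowerSeries.coeff_C, coeff_C]
  by_cases hm : m = 0
  · subst hm
    by_cases hd : d = 0
    · simp [hd]
    · simp [hd, Ne.symm hd]
  · split_ifs <;> simp [coeff_C, hm]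

theorem split_X (i : σ) : split (X i : MvPowerSeries σ K) = PowerSeries.C (X i) * PowerSeries.X := by
  classical
  ext d m
  rw [coeff_coeff_split, PowerSeries.coeff_C_mul, PowerSeries.coeff_X, coeff_X]
  by_cases hm : m = Finsupp.single i 1
  · subst hm
    by_cases hd : d = 1
    · simp [hd]
    · simp [hd, Ne.symm hd]
  · split_ifs <;> simp [coeff_X, hm]

end Split

/-! ### Coefficientwise convergence of sums and products. -/

section Topology
variable {σ K ι : Type*} [Field K]
open MvPowerSeries

theorem coeff_eq_zero_of_X_dvd {m : σ →₀ ℕ} {k : σ} (hk : m k = 0) {p : MvPowerSeries σ K}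
    (h : X k ∣ p) : coeff m p = 0 :=
  X_dvd_iff.1 h m hk

/-- A factor congruent to `1` modulo a variable absent from `m` does not affect the coefficient of
`m`. -/
theorem coeff_mul_prod_eq {m : σ →₀ ℕ} {f : ι → MvPowerSeries σ K} (p : MvPowerSeries σ K)
    (s : Finset ι) (hs : ∀ i ∈ s, ∃ k, m k = 0 ∧ X k ∣ f i - 1) :
    coeff m (p * ∏ i ∈ s, f i) = coeff m p := by
  classical
  induction s using Finset.induction_on with
  | empty => simp
  | insert a s ha ih =>
    obtain ⟨k, hk, hdvd⟩ := hs a (mem_insert_self a s)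
    have e : p * ∏ i ∈ insert a s, f i = p * ∏ i ∈ s, f i + (f a - 1) * (p * ∏ i ∈ s, f i) := by
      rw [prod_insert ha]; ring
    rw [e, map_add, coeff_eq_zero_of_X_dvd hk (hdvd.mul_right _), add_zero,
      ih fun i hi => hs i (mem_insert_of_mem hi)]

theorem coeff_prod_eq_of_subset {m : σ →₀ ℕ} {f : ι → MvPowerSeries σ K} {S s : Finset ι}
    (hS : ∀ i ∉ S, ∃ k, m k = 0 ∧ X k ∣ f i - 1) (hs : S ⊆ s) :
    coeff m (∏ i ∈ s, f i) = coeff m (∏ i ∈ S, f i) := by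
  classical
  rw [← prod_sdiff hs, mul_comm]
  exact coeff_mul_prod_eq _ _ fun i hi => hS i (mem_sdiff.1 hi).2

variable [TopologicalSpace K]

theorem hasSum_of_coeff {f : ι → MvPowerSeries σ K} {a : MvPowerSeries σ K}
    (h : ∀ m, ∃ S : Finset ι, (∀ i ∉ S, coeff m (f i) = 0) ∧ ∑ i ∈ S, coeff m (f i) = coeff m a) :
    HasSum f a := by
  change Filter.Tendsto _ _ _
  rw [SummationFilter.unconditional_filter, WithPiTopology.tendsto_iff_coeff_tendsto]
  intro m
  obtain ⟨S, hS, hsum⟩ := h m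
  refine tendsto_const_nhds.congr' ?_
  filter_upwards [Filter.eventually_ge_atTop S] with s hs
  rw [map_sum, ← hsum]
  exact sum_subset hs fun i _ hi => hS i hi

theorem hasProd_of_coeff {f : ι → MvPowerSeries σ K} (S : (σ →₀ ℕ) → Finset ι)
    (hS : ∀ m, ∀ i ∉ S m, ∃ k, m k = 0 ∧ X k ∣ f i - 1) :
    HasProd f (ofCoeff fun m => coeff m (∏ i ∈ S m, f i)) := by
  change Filter.Tendsto _ _ _
  rw [SummationFilter.unconditional_filter, WithPiTopology.tendsto_iff_coeff_tendsto]
  intro m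
  refine tendsto_const_nhds.congr' ?_
  filter_upwards [Filter.eventually_ge_atTop (S m)] with s hs
  rw [coeff_prod_eq_of_subset (hS m) hs, coeff_ofCoeff]

/-- Any sufficiently large `s` serves, not only `S m`; this permits one common truncation for both
infinite products. -/
theorem coeff_tprod_eq [T2Space K] {f : ι → MvPowerSeries σ K} (S : (σ →₀ ℕ) → Finset ι)
    (hS : ∀ m, ∀ i ∉ S m, ∃ k, m k = 0 ∧ X k ∣ f i - 1) (m : σ →₀ ℕ) {s : Finset ι}
    (hs : ∀ i ∉ s, ∃ k, m k = 0 ∧ X k ∣ f i - 1) :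
    coeff m (∏' i, f i) = coeff m (∏ i ∈ s, f i) := by
  classical
  rw [(hasProd_of_coeff S hS).tprod_eq, coeff_ofCoeff, ← coeff_prod_eq_of_subset (hS m) subset_union_left,
    coeff_prod_eq_of_subset hs (subset_union_right (s₁ := S m))]

end Topology

/-! ### The factors of the product side. -/

section Factors
variable {K : Type*} [Field K]
open MvPowerSeries

/-- The factor of the product side with index `i`. -/
noncomputable def singleSeries (t : K) (i : ℕ) : MvPowerSeries ℕ K :=
  (1 + C t⁻¹ * X i) * (1 + X i)⁻¹

/-- The factor of the product side with indices `i ≤ j`. -/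
noncomputable def pairSeries (t : K) (i j : ℕ) : MvPowerSeries ℕ K :=
  (1 - X i * X j) * (1 - C t⁻¹ * (X i * X j))⁻¹

theorem X_dvd_singleSeries_sub_one (t : K) (i : ℕ) : X i ∣ singleSeries t i - 1 := by
  have h : (1 + X i : MvPowerSeries ℕ K) * (1 + X i)⁻¹ = 1 := MvPowerSeries.mul_inv_cancel _ (by simp)
  refine ⟨(C t⁻¹ - 1) * (1 + X i)⁻¹, ?_⟩
  rw [singleSeries]
  linear_combination h

theorem X_dvd_pairSeries_sub_one (t : K) (i j : ℕ) : X j ∣ pairSeries t i j - 1 := by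
  have h : (1 - C t⁻¹ * (X i * X j) : MvPowerSeries ℕ K) * (1 - C t⁻¹ * (X i * X j))⁻¹ = 1 :=
    MvPowerSeries.mul_inv_cancel _ (by simp)
  refine ⟨X i * (C t⁻¹ - 1) * (1 - C t⁻¹ * (X i * X j))⁻¹, ?_⟩
  rw [pairSeries]
  linear_combination h

/-- The pairs of indices `i ≤ j < n`. -/
def pairSet (n : ℕ) : Finset {p : ℕ × ℕ // p.1 ≤ p.2} :=
  (range n ×ˢ range n).subtype fun p => p.1 ≤ p.2

theorem prod_pairSet {M : Type*} [CommMonoid M] (n : ℕ) (g : ℕ → ℕ → M) :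
    ∏ p ∈ pairSet n, g p.1.1 p.1.2 =
      ∏ i : Fin n, ∏ j : Fin n, if i ≤ j then g i j else 1 := by
  have := prod_subtype_eq_prod_filter (s := range n ×ˢ range n) (p := fun p : ℕ × ℕ => p.1 ≤ p.2)
    (fun p => g p.1 p.2)
  rw [pairSet, this, prod_filter, prod_product, prod_range]
  refine prod_congr rfl fun i _ => ?_
  rw [prod_range]
  rfl

theorem le_of_notMem_pairSet {n : ℕ} {p : {p : ℕ × ℕ // p.1 ≤ p.2}} (hp : p ∉ pairSet n) :
    n ≤ p.1.2 := by
  by_contra h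
  refine hp (mem_subtype.2 (mem_product.2 ⟨?_, ?_⟩)) <;> rw [mem_range]
  · exact p.2.trans_lt (not_le.1 h)
  · exact not_le.1 h

/-- The product side in `n` variables. -/
noncomputable def prodSeries (t : K) (n : ℕ) : MvPowerSeries ℕ K :=
  (∏ i ∈ range n, singleSeries t i) * ∏ p ∈ pairSet n, pairSeries t p.1.1 p.1.2

theorem map_prodSeries {F : Type*} [Field F] (g : MvPowerSeries ℕ K →+* F) (t : K) (n : ℕ) :
    g (prodSeries t n) = prodSide (g (C t)) ((g (C t))⁻¹ - 1) (- (g (C t))⁻¹)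
      (fun i : Fin n => g (X (i : ℕ))) univ := by
  have hinv : ∀ p : MvPowerSeries ℕ K, constantCoeff p ≠ 0 → g p ≠ 0 ∧ g p⁻¹ = (g p)⁻¹ := by
    intro p hp
    have h : g p * g p⁻¹ = 1 := by rw [← map_mul, MvPowerSeries.mul_inv_cancel _ hp, map_one]
    exact ⟨left_ne_zero_of_mul_eq_one h, eq_inv_of_mul_eq_one_right h⟩
  have hC : g (C t⁻¹) = (g (C t))⁻¹ := by
    rw [← RingHom.comp_apply, ← RingHom.comp_apply, map_inv₀]
  have hpair : ∀ i j, g (pairSeries t i j) = pairFactor (g (C t)) (g (X i)) (g (X j)) := by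
    intro i j
    rw [pairSeries, map_mul, (hinv _ (by simp)).2, pairFactor]
    simp only [map_sub, map_mul, map_one, hC]
    rw [div_eq_mul_inv, div_eq_mul_inv _ (g (C t)), mul_comm (g (C t))⁻¹]
  -- The diagonal pair factor cancels `1 + x`: `(1 + x / t) (1 - x ^ 2) / (1 + x) = (1 + x / t) (1 -
  -- x)`, whence the parameters `t⁻¹ - 1` and `-t⁻¹`.
  have hsingle : ∀ i, g (singleSeries t i) * g (pairSeries t i i) =
      oneFactor (g (C t)) ((g (C t))⁻¹ - 1) (- (g (C t))⁻¹) (g (X i)) := by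
    intro i
    have h1 := hinv (1 + X i) (by simp)
    rw [hpair, singleSeries, map_mul, h1.2, pairFactor, oneFactor, mul_div_assoc']
    rw [map_add, map_one] at h1
    simp only [map_add, map_mul, map_one, hC]
    rw [sq (g (X i))]
    congr 1
    field_simp [h1.1]
    ring
  rw [prodSeries, map_mul, map_prod, map_prod, prod_range,
    prod_pairSet n fun i j => g (pairSeries t i j), prodSide]
  have h2 : ∏ i : Fin n, ∏ j : Fin n, (if i ≤ j then g (pairSeries t i j) else 1) =
      (∏ i : Fin n, g (pairSeries t i i)) * ∏ i : Fin n, ∏ j : Fin n,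
        if i < j then pairFactor (g (C t)) (g (X (i : ℕ))) (g (X (j : ℕ))) else 1 := by
    rw [← prod_mul_distrib]
    refine prod_congr rfl fun i _ => ?_
    have h3 : g (pairSeries t i i) = ∏ j : Fin n, if i = j then g (pairSeries t i j) else 1 := by
      simp
    rw [h3, ← prod_mul_distrib]
    refine prod_congr rfl fun j _ => ?_
    rcases lt_trichotomy i j with h | h | h
    · simp [h, h.le, h.ne, hpair]
    · simp [h]
    · simp [not_le.2 h, not_lt.2 h.le, h.ne']
  rw [h2, ← mul_assoc, ← prod_mul_distrib]
  simp only [hsingle]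

end Factors

end HallLittlewood

namespace HallLittlewood
open Finset

/-! ### The identity in finitely many variables, degree by degree. -/

section Assembly
variable {K : Type*} [Field K]

/-- The Hall–Littlewood polynomial as a formal power series in the variables with index in `ℕ`. -/
noncomputable def polySeries (t : K) (n : ℕ) (μ : YoungDiagram) : MvPowerSeries ℕ K :=
  (MvPolynomial.rename Fin.val (poly t n μ) : MvPolynomial ℕ K)

theorem coeff_polySeries (t : K) (n : ℕ) (μ : YoungDiagram) (m : ℕ →₀ ℕ) :
    MvPowerSeries.coeff m (polySeries t n μ) =
      MvPolynomial.coeff m (MvPolynomial.rename Fin.val (poly t n μ)) := by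
  rw [polySeries, MvPolynomial.coeff_coe]

theorem map_polySeries {F : Type*} [Field F] (g : MvPowerSeries ℕ K →+* F) (t : K) (n : ℕ)
    (μ : YoungDiagram) (hg : Function.Injective fun i : Fin n => g (MvPowerSeries.X (i : ℕ))) :
    g (polySeries t n μ) = symmetrization (g (MvPowerSeries.C t)) n μ
      (fun i : Fin n => g (MvPowerSeries.X (i : ℕ))) := by
  let _ := (g.comp MvPowerSeries.C).toAlgebra
  have h := aeval_poly (L := F) t n μ (fun i : Fin n => g (MvPowerSeries.X (i : ℕ))) hg
  refine Eq.trans ?_ h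
  have hp : ∀ p : MvPolynomial (Fin n) K,
      g ((MvPolynomial.rename Fin.val p : MvPolynomial ℕ K) : MvPowerSeries ℕ K) =
        MvPolynomial.aeval (fun i : Fin n => g (MvPowerSeries.X (i : ℕ))) p := by
    intro p
    induction p using MvPolynomial.induction_on with
    | C a => rw [MvPolynomial.rename_C, MvPolynomial.coe_C, MvPolynomial.aeval_C]; rfl
    | add p q hp hq => rw [map_add, MvPolynomial.coe_add, map_add, map_add, hp, hq]
    | mul_X p i hp =>
      rw [map_mul, MvPolynomial.coe_mul, map_mul, map_mul, hp, MvPolynomial.rename_X,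
        MvPolynomial.coe_X, MvPolynomial.aeval_X]
  exact hp _

theorem colLen_zero_le_card (μ : YoungDiagram) : μ.colLen 0 ≤ μ.card := by
  rw [card_eq_sum_rowLen]
  calc μ.colLen 0 = ∑ _i ∈ range (μ.colLen 0), 1 := by simp
    _ ≤ _ := sum_le_sum fun i hi => Nat.one_le_iff_ne_zero.2 fun h =>
      absurd ((rowLen_eq_zero_iff μ i).1 h) (not_le.2 (mem_range.1 hi))

variable {L L' : Type*} [Field L] [Field L']

/-- The quotients have degree `0`, so scaling the variables acts only on the monomial; `hμ` ensures
that its degree is all of `|μ|`. -/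
theorem symmetrization_mul (ψ : L →+* L') {t : L} (n : ℕ) (μ : YoungDiagram) (hμ : μ.colLen 0 ≤ n)
    (x : Fin n → L) {z : L'} (hz : z ≠ 0) :
    symmetrization (ψ t) n μ (fun i => ψ (x i) * z) = ψ (symmetrization t n μ x) * z ^ μ.card := by
  unfold symmetrization
  rw [map_mul, map_inv₀, map_vFactor, mul_assoc, map_sum, sum_mul]
  congr 1
  refine sum_congr rfl fun w _ => ?_
  have h1 : ∏ i, (ψ (x (w i)) * z) ^ μ.rowLen i =
      (∏ i, ψ (x (w i)) ^ μ.rowLen i) * z ^ μ.card := by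
    have h : ∑ i : Fin n, μ.rowLen i = μ.card := by
      rw [← sum_parts hμ, ← map_univ_rowLen]
      rfl
    rw [← h, ← prod_pow_eq_pow_sum, ← prod_mul_distrib]
    simp only [mul_pow]
  rw [h1]
  simp only [map_mul, map_prod, map_pow, map_div₀, map_sub, ← mul_assoc, ← sub_mul,
    mul_div_mul_right _ _ hz]
  ring

theorem qInt_map_ne_zero {t : K} (ht : ∀ n : ℕ, 0 < n → ∑ a ∈ range n, t ^ a ≠ 0) (g : K →+* L)
    (n : ℕ) (hn : 0 < n) : qInt (g t) n ≠ 0 := by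
  have : qInt (g t) n = g (∑ a ∈ range n, t ^ a) := by simp [qInt, map_sum]
  rw [this]
  exact (map_ne_zero g).2 (ht n hn)

/-- The homomorphism `X i ↦ z X i` into the field `L'`. -/
noncomputable def scaleHom (ψ : MvPowerSeries ℕ K →+* L) (φ : PowerSeries L →+* L') :
    MvPowerSeries ℕ K →+* L' :=
  (φ.comp (PowerSeries.map ψ)).comp split

variable {ψ : MvPowerSeries ℕ K →+* L} {φ : PowerSeries L →+* L'}

theorem scaleHom_C (a : K) : scaleHom ψ φ (MvPowerSeries.C a) =
    φ (PowerSeries.C (ψ (MvPowerSeries.C a))) := by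
  simp [scaleHom, split_C]

theorem scaleHom_X (i : ℕ) : scaleHom ψ φ (MvPowerSeries.X i) =
    φ (PowerSeries.C (ψ (MvPowerSeries.X i)) * PowerSeries.X) := by
  simp [scaleHom, split_X]

theorem map_coeff_split (hφ : Function.Injective φ) {p : MvPowerSeries ℕ K} {q : PowerSeries L}
    (h : scaleHom ψ φ p = φ q) (d : ℕ) :
    ψ (PowerSeries.coeff d (split p)) = PowerSeries.coeff d q := by
  have := hφ h
  rw [← this]
  simp

theorem injective_map_X (hψ : Function.Injective ψ) (n : ℕ) :
    Function.Injective fun i : Fin n => ψ (MvPowerSeries.X (i : ℕ)) :=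
  fun _ _ h => Fin.ext (MvPowerSeries.X_inj.1 (hψ h))

theorem map_X_ne_zero (hψ : Function.Injective ψ) (i : ℕ) : ψ (MvPowerSeries.X i) ≠ 0 := by
  intro h
  have h0 : (MvPowerSeries.X i : MvPowerSeries ℕ K) = 0 := hψ (h.trans (map_zero ψ).symm)
  have := congrArg (MvPowerSeries.coeff (Finsupp.single i 1)) h0
  simp [MvPowerSeries.coeff_X] at this

/-- `P_μ` is homogeneous of degree `|μ|`. -/
theorem coeff_polySeries_eq_zero (hψ : Function.Injective ψ) (hφ : Function.Injective φ) (t : K)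
    {n : ℕ} {μ : YoungDiagram} (hμ : μ.colLen 0 ≤ n) {m : ℕ →₀ ℕ} (hm : m.degree ≠ μ.card) :
    MvPowerSeries.coeff m (polySeries t n μ) = 0 := by
  have hX : φ PowerSeries.X ≠ 0 := (map_ne_zero_iff φ hφ).2 PowerSeries.X_ne_zero
  -- Scaling all variables by `X` multiplies the polynomial by `X ^ |μ|`, so all its other
  -- homogeneous components vanish.
  have h : scaleHom ψ φ (polySeries t n μ) =
      φ (PowerSeries.C (ψ (polySeries t n μ)) * PowerSeries.X ^ μ.card) := by
    rw [map_polySeries (scaleHom ψ φ), map_polySeries ψ t n μ (injective_map_X hψ n), map_mul, map_pow]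
    · simp only [scaleHom_C, scaleHom_X, map_mul]
      exact symmetrization_mul (φ.comp PowerSeries.C) n μ hμ _ hX
    · simp only [scaleHom_X, map_mul]
      intro i j h
      exact injective_map_X hψ n ((φ.comp PowerSeries.C).injective (mul_right_cancel₀ hX h))
  have h2 := map_coeff_split hφ h m.degree
  rw [PowerSeries.coeff_C_mul, PowerSeries.coeff_X_pow, if_neg hm, mul_zero] at h2
  have h3 := congrArg (MvPowerSeries.coeff m) (hψ (h2.trans (map_zero ψ).symm))
  rwa [coeff_coeff_split, if_pos rfl, map_zero] at h3

theorem map_partWeight (g : K →+* L) (t : K) (k m : ℕ) :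
    g (partWeight t k m) = partWeight (g t) k m := by
  have h : g (oddProd t m) = oddProd (g t) m := by simp [oddProd, map_prod]
  unfold partWeight evenWeight parityWeight
  split_ifs <;> simp [h]

theorem exists_finset_diagrams (n d : ℕ) : ∃ Λ : Finset YoungDiagram,
    ∀ μ, μ ∈ Λ ↔ μ.colLen 0 ≤ n ∧ μ.card = d := by
  classical
  choose D hD1 hD2 using fun f : Fin n → ℕ =>
    exists_parts_eq (n := n) ((univ : Finset (Fin n)).val.map f) (by simp)
  refine ⟨((univ : Finset (Fin n)).piAntidiag d).image D, fun μ => ?_⟩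
  rw [mem_image]
  constructor
  · rintro ⟨f, hf, rfl⟩
    refine ⟨hD1 f, ?_⟩
    rw [← sum_parts (hD1 f), hD2]
    exact (mem_piAntidiag.1 hf).1
  · rintro ⟨h1, h2⟩
    have hp := map_univ_rowLen n μ
    refine ⟨fun i : Fin n => μ.rowLen i, mem_piAntidiag.2 ⟨?_, fun i _ => mem_univ i⟩,
      parts_injective (hD1 _) h1 ((hD2 _).trans hp)⟩
    rw [← h2, ← sum_parts h1, ← hp]
    rfl

/-- Both sides are compared in a field after grading: the product side becomes `levelSeries`, whose
coefficient of degree `d` is a sum over exponent vectors, grouped here by the partition of their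
values. -/
theorem sum_polySeries (hψ : Function.Injective ψ) (hφ : Function.Injective φ) {t : K}
    (ht0 : t ≠ 0) (ht : ∀ n : ℕ, 0 < n → ∑ a ∈ range n, t ^ a ≠ 0) {n d : ℕ}
    (Λ : Finset YoungDiagram) (hΛ : ∀ μ, μ ∈ Λ ↔ μ.colLen 0 ≤ n ∧ μ.card = d) :
    ∑ μ ∈ Λ, MvPowerSeries.C (∏ k ∈ (parts n μ).toFinset, partWeight t k ((parts n μ).count k)) *
      polySeries t n μ = PowerSeries.coeff d (split (prodSeries t n)) := by
  classical
  have htL : ∀ k : ℕ, 0 < k → qInt (ψ (MvPowerSeries.C t)) k ≠ 0 :=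
    qInt_map_ne_zero ht (ψ.comp MvPowerSeries.C)
  have ht0L : ψ (MvPowerSeries.C t) ≠ 0 := (map_ne_zero (ψ.comp MvPowerSeries.C)).2 ht0
  have hinj := injective_map_X hψ n
  have hne : ∀ i : Fin n, ψ (MvPowerSeries.X (i : ℕ)) ≠ 0 := fun i => map_X_ne_zero hψ i
  have h : scaleHom ψ φ (prodSeries t n) = φ (levelSeries (ψ (MvPowerSeries.C t))
      (fun i : Fin n => ψ (MvPowerSeries.X (i : ℕ))) (partWeight (ψ (MvPowerSeries.C t))) univ) := by
    rw [map_prodSeries, map_levelSeries_partWeight φ hφ ht0L htL hinj hne]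
    simp only [scaleHom_C, scaleHom_X]
  apply hψ
  rw [map_coeff_split hφ h, levelSeries, PowerSeries.coeff_mk, levelSum, map_sum]
  choose D hD1 hD2 using fun f : Fin n → ℕ =>
    exists_parts_eq (n := n) ((univ : Finset (Fin n)).val.map f) (by simp)
  have hmaps : ∀ f ∈ (univ : Finset (Fin n)).piAntidiag d, D f ∈ Λ := by
    intro f hf
    refine (hΛ _).2 ⟨hD1 f, ?_⟩
    rw [← sum_parts (hD1 f), hD2]
    exact (mem_piAntidiag.1 hf).1
  rw [← sum_fiberwise_of_maps_to hmaps]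
  refine sum_congr rfl fun μ hμ => ?_
  obtain ⟨h1, h2⟩ := (hΛ μ).1 hμ
  have hfib : {f ∈ (univ : Finset (Fin n)).piAntidiag d | D f = μ} = typeSet univ (parts n μ) := by
    ext f
    rw [mem_filter, mem_typeSet, mem_piAntidiag]
    constructor
    · rintro ⟨_, rfl⟩
      exact ⟨(hD2 f).symm, fun i _ => mem_univ i⟩
    · rintro ⟨h, _⟩
      refine ⟨⟨?_, fun i _ => mem_univ i⟩, parts_injective (hD1 f) h1 ((hD2 f).trans h)⟩
      rw [← h2, ← sum_parts h1, ← h]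
      rfl
  rw [hfib, map_mul, map_polySeries ψ t n μ hinj, symmetrization_eq_sum htL n μ hinj hne, mul_sum]
  refine sum_congr rfl fun f hf => ?_
  congr 1
  have hmap := (mem_typeSet.1 hf).1
  rw [← RingHom.comp_apply, map_prod, ← hmap]
  refine prod_congr rfl fun k _ => ?_
  rw [map_partWeight, Multiset.count_map]
  simp only [eq_comm (a := k)]
  rfl

theorem coeff_sum_polySeries {t : K} (ht0 : t ≠ 0)
    (ht : ∀ n : ℕ, 0 < n → ∑ a ∈ range n, t ^ a ≠ 0) {n : ℕ} (m : ℕ →₀ ℕ)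
    (Λ : Finset YoungDiagram) (hΛ : ∀ μ, μ ∈ Λ ↔ μ.colLen 0 ≤ n ∧ μ.card = m.degree)
    [DecidablePred EvenPartsEvenMult] :
    ∑ μ ∈ Λ with EvenPartsEvenMult μ, cCoeff t μ / t ^ ((oddParts μ + μ.card) / 2) *
      MvPowerSeries.coeff m (polySeries t n μ) = MvPowerSeries.coeff m (prodSeries t n) := by
  have h := congrArg (MvPowerSeries.coeff m) (sum_polySeries
    (IsFractionRing.injective (MvPowerSeries ℕ K) (FractionRing (MvPowerSeries ℕ K)))
    (IsFractionRing.injective (PowerSeries (FractionRing (MvPowerSeries ℕ K)))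
      (FractionRing (PowerSeries (FractionRing (MvPowerSeries ℕ K))))) ht0 ht Λ hΛ)
  rw [coeff_coeff_split, if_pos rfl] at h
  rw [← h, map_sum, sum_filter]
  refine sum_congr rfl fun μ hμ => ?_
  rw [MvPowerSeries.coeff_C_mul, prod_partWeight t ((hΛ μ).1 hμ).1]
  split_ifs <;> simp

end Assembly
end HallLittlewood

/-! ### Passage to infinitely many variables. -/

open HallLittlewood in
theorem theorem2p1 {K : Type*} [Field K] [TopologicalSpace K] [DiscreteTopology K] (t : K)
    (ht0 : t ≠ 0) (ht : ∀ n : ℕ, 0 < n → ∑ a ∈ Finset.range n, t ^ a ≠ 0) :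
    Multipliable (fun i : ℕ =>
      (1 + MvPowerSeries.C t⁻¹ * MvPowerSeries.X i : MvPowerSeries ℕ K) *
        (1 + MvPowerSeries.X i)⁻¹) ∧
    Multipliable (fun p : {p : ℕ × ℕ // p.1 ≤ p.2} =>
      (1 - MvPowerSeries.X p.1.1 * MvPowerSeries.X p.1.2 : MvPowerSeries ℕ K) *
        (1 - MvPowerSeries.C t⁻¹ * (MvPowerSeries.X p.1.1 * MvPowerSeries.X p.1.2))⁻¹) ∧
    HasSum (fun μ : {μ : YoungDiagram // HallLittlewood.EvenPartsEvenMult μ} =>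
        MvPowerSeries.C (HallLittlewood.cCoeff t μ.1 /
          t ^ ((HallLittlewood.oddParts μ.1 + μ.1.card) / 2)) * HallLittlewood.func t μ.1)
      ((∏' i : ℕ,
        (1 + MvPowerSeries.C t⁻¹ * MvPowerSeries.X i : MvPowerSeries ℕ K) *
          (1 + MvPowerSeries.X i)⁻¹) *
      ∏' p : {p : ℕ × ℕ // p.1 ≤ p.2},
        (1 - MvPowerSeries.X p.1.1 * MvPowerSeries.X p.1.2 : MvPowerSeries ℕ K) *
          (1 - MvPowerSeries.C t⁻¹ * (MvPowerSeries.X p.1.1 * MvPowerSeries.X p.1.2))⁻¹) := by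
  classical
  have hsingle : ∀ (m : ℕ →₀ ℕ) (n : ℕ), (∀ k, n ≤ k → m k = 0) → ∀ i ∉ Finset.range n,
      ∃ k, m k = 0 ∧ MvPowerSeries.X k ∣ singleSeries t i - 1 := fun m n hn i hi =>
    ⟨i, hn i (by simpa using hi), X_dvd_singleSeries_sub_one t i⟩
  have hpair : ∀ (m : ℕ →₀ ℕ) (n : ℕ), (∀ k, n ≤ k → m k = 0) → ∀ p ∉ pairSet n,
      ∃ k, m k = 0 ∧ MvPowerSeries.X k ∣ pairSeries t p.1.1 p.1.2 - 1 := fun m n hn p hp =>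
    ⟨p.1.2, hn _ (le_of_notMem_pairSet hp), X_dvd_pairSeries_sub_one t p.1.1 p.1.2⟩
  have hN : ∀ (m : ℕ →₀ ℕ) (k : ℕ), m.support.sup Nat.succ ≤ k → m k = 0 := fun m k hk => by
    by_contra h
    exact absurd (Finset.le_sup (f := Nat.succ) (Finsupp.mem_support_iff.2 h)) (by omega)
  have hS1 := fun m => hsingle m _ (hN m)
  have hS2 := fun m => hpair m _ (hN m)
  refine ⟨(hasProd_of_coeff _ hS1).multipliable, (hasProd_of_coeff _ hS2).multipliable,
    hasSum_of_coeff fun m => ?_⟩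
  -- With this many variables `m` is visible, and every partition of size `m.degree` has at most `n`
  -- parts, so the bound on the length in `Λ` excludes none of them.
  set n := max (m.support.sup Nat.succ) m.degree with hn
  have hmn : ∀ k, n ≤ k → m k = 0 := fun k hk => hN m k ((le_max_left _ _).trans hk)
  obtain ⟨Λ, hΛ⟩ := exists_finset_diagrams n m.degree
  refine ⟨Λ.subtype EvenPartsEvenMult, fun μ hμ => ?_, ?_⟩
  · have hcard : m.degree ≠ μ.1.card := fun h => hμ (Finset.mem_subtype.2 ((hΛ _).2
      ⟨((colLen_zero_le_card μ.1).trans h.ge).trans (le_max_right _ _), h.symm⟩))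
    rw [MvPowerSeries.coeff_C_mul, coeff_func t ht μ.1 m (max n (μ.1.colLen 0)) (le_max_right _ _)
      fun i hi => ?_, ← coeff_polySeries, coeff_polySeries_eq_zero
        (IsFractionRing.injective (MvPowerSeries ℕ K) (FractionRing (MvPowerSeries ℕ K)))
        (IsFractionRing.injective (PowerSeries (FractionRing (MvPowerSeries ℕ K)))
          (FractionRing (PowerSeries (FractionRing (MvPowerSeries ℕ K))))) t
        (le_max_right _ _) hcard, mul_zero]
    by_contra h
    exact Finsupp.mem_support_iff.1 hi (hmn i (by omega))
  · have hprod : MvPowerSeries.coeff m ((∏' i, singleSeries t i) *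
        ∏' p : {p : ℕ × ℕ // p.1 ≤ p.2}, pairSeries t p.1.1 p.1.2) =
        MvPowerSeries.coeff m (prodSeries t n) := by
      rw [prodSeries, MvPowerSeries.coeff_mul, MvPowerSeries.coeff_mul]
      refine Finset.sum_congr rfl fun a ha => ?_
      -- Both exponents are bounded by `m`, so the same truncation computes each infinite product at
      -- them.
      have hle : ∀ k, n ≤ k → a.1 k = 0 ∧ a.2 k = 0 := fun k hk => by
        have h := hmn k hk
        rw [← Finset.HasAntidiagonal.mem_antidiagonal.1 ha, Finsupp.add_apply] at h
        omega
      rw [coeff_tprod_eq _ hS1 a.1 (hsingle a.1 n fun k hk => (hle k hk).1),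
        coeff_tprod_eq _ hS2 a.2 (hpair a.2 n fun k hk => (hle k hk).2)]
    refine Eq.trans ?_ hprod.symm
    rw [← coeff_sum_polySeries ht0 ht m Λ hΛ, ← Finset.sum_subtype_eq_sum_filter]
    refine Finset.sum_congr rfl fun μ hμ => ?_
    rw [MvPowerSeries.coeff_C_mul, coeff_polySeries, coeff_func t ht μ.1 m n
      ((hΛ _).1 (Finset.mem_subtype.1 hμ)).1 fun i hi => ?_]
    by_contra h
    exact Finsupp.mem_support_iff.1 hi (hmn i (by omega))
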